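/- Let $\varepsilon_0\ge 0$, $\varepsilon_1,\lambda\in\mathbb R$, $a>b>0$, and put $p^2=a^2+b^2$, $r^2=a^2-b^2$. On $\mathbb R^9(\mathbf M,\boldsymbol\alpha,\boldsymbol\beta)$ consider the Euler equations on $e(3,2)^*$ $$\dot{\mathbf M}=\mathbf M\times\tfrac{\partial H}{\partial\mathbf M}+\boldsymbol\alpha\times\tfrac{\partial H}{\partial\boldsymbol\alpha}+\boldsymbol\beta\times\tfrac{\partial H}{\partial\boldsymbol\beta},\qquad \dot{\boldsymbol\alpha}=\boldsymbol\alpha\times\tfrac{\partial H}{\partial\mathbf M},\qquad \dot{\boldsymbol\beta}=\boldsymbol\beta\times\tfrac{\partial H}{\partial\mathbf M}$$ of the Sokolov–Tsiganov generalized two-field gyrostat, $$H=\tfrac14(M_1^2+M_2^2)+\tfrac12(M_3-\lambda)^2-\varepsilon_1[(\alpha_2M_3-\alpha_3M_2)+(\beta_3M_1-\beta_1M_3)]-\varepsilon_0(\alpha_1+\beta_2),$$ on the phase space $\mathcal P^6=\{\boldsymbol\alpha^2=a^2,\ \boldsymbol\beta^2=b^2,\ \boldsymbol\alpha\cdot\boldsymbol\beta=0\}$.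 Its further integrals are, with $\mathbf e_i$ the standard basis vectors, $$\begin{aligned}K={}&\bigl[\tfrac14(M_1^2-M_2^2)+\varepsilon_0(\alpha_1-\beta_2)+\varepsilon_1\bigl((\boldsymbol\alpha\times\mathbf M)\cdot\mathbf e_1-(\boldsymbol\beta\times\mathbf M)\cdot\mathbf e_2-\varepsilon_1(\boldsymbol\alpha^2-\boldsymbol\beta^2)\bigr)\bigr]^2\\&+\bigl[\tfrac12M_1M_2+\varepsilon_0(\alpha_2+\beta_1)+\varepsilon_1\bigl((\boldsymbol\alpha\times\mathbf M)\cdot\mathbf e_2+(\boldsymbol\beta\times\mathbf M)\cdot\mathbf e_1-2\varepsilon_1\boldsymbol\alpha\cdot\boldsymbol\beta\bigr)\bigr]^2\\&+2\lambda\bigl[\tfrac14(M_1^2+M_2^2)(M_3-2\lambda)+\varepsilon_0(\alpha_3M_1+\beta_3M_2)\bigr]\\&-2\varepsilon_1\lambda\bigl[\alpha_2M_1^2-\beta_1M_2^2-(\alpha_1-\beta_2)M_1M_2+\varepsilon_1(\boldsymbol\alpha^2+\boldsymbol\beta^2)M_3-2\varepsilon_1(\boldsymbol\alpha\times\boldsymbol\beta)\cdot\mathbf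 M\bigr],\end{aligned}$$ $$\begin{aligned}G={}&\tfrac14[(\mathbf M\cdot\boldsymbol\alpha)^2+(\mathbf M\cdot\boldsymbol\beta)^2]+\tfrac12(M_3-2\lambda)(\boldsymbol\alpha\times\boldsymbol\beta)\cdot\mathbf M-\varepsilon_0[\boldsymbol\beta^2\alpha_1+\boldsymbol\alpha^2\beta_2-(\boldsymbol\alpha\cdot\boldsymbol\beta)(\alpha_2+\beta_1)]\\&-\varepsilon_1\bigl[\boldsymbol\beta^2(\boldsymbol\alpha\times\mathbf M)\cdot\mathbf e_1+\boldsymbol\alpha^2(\boldsymbol\beta\times\mathbf M)\cdot\mathbf e_2-(\boldsymbol\alpha\cdot\boldsymbol\beta)\bigl((\boldsymbol\alpha\times\mathbf M)\cdot\mathbf e_2+(\boldsymbol\beta\times\mathbf M)\cdot\mathbf e_1\bigr)\bigr].\end{aligned}$$ Put $x_{1,2}=(\alpha_1-\beta_2)\pm i(\alpha_2+\beta_1)$, $z_{1,2}=\alpha_3\pm i\beta_3$, $w_{1,2}=\tfrac12(M_1\pm iM_2)$ and, where $w_1w_2\ne0$, $$U_1=\frac{\mathbf M\cdot\boldsymbol\alpha+i\,\mathbf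 M\cdot\boldsymbol\beta}{M_1+iM_2}-\frac{\mathbf M\cdot\boldsymbol\alpha-i\,\mathbf M\cdot\boldsymbol\beta}{M_1-iM_2},\qquad U_2=4w_1w_2\,U_1',$$ where the prime is $d/d(it)$ along the system. Let $\mathfrak M_3$ be the closure of the set $\{U_1=0,\ U_2=0\}$ in $\mathcal P^6\cap\{w_1w_2\neq0\}$. Then: 1. $\mathfrak M_3$ is a non-empty invariant subset of $\mathcal P^6$: every trajectory that meets it stays in it. 2. Every point of $\mathfrak M_3$ is a critical point of the integral map $H\times K\times G:\mathcal P^6\to\mathbb R^3$ (its differential on the tangent space of $\mathcal P^6$ has rank less than $3$). 3. $\mathfrak M_3$ is almost everywhere a smooth 4-dimensional manifold: the points near which it is a smooth embedded 4-dimensional submanifold are dense in $\mathfrak M_3$, and the remaining points form a set of zero 4-dimensional Hausdorff measure. 4. The functions $$S=-\frac12\left[\frac{\mathbf M\cdot\boldsymbol\alpha+i\,\mathbf M\cdot\boldsymbol\beta}{M_1+iM_2}+\frac{\mathbf M\cdot\boldsymbol\alpha-i\,\mathbf M\cdot\boldsymbol\beta}{M_1-iM_2}\right],$$ $$T=x_1x_2+z_1z_2-\frac{2S}{\varepsilon_0+2\varepsilon_1^2S}\bigl[(w_1+i\varepsilon_1z_1)(w_2-i\varepsilon_1z_2)+\varepsilon_1^2x_1x_2\bigr]$$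 are partial integrals on $\mathfrak M_3$: along each trajectory in $\mathfrak M_3$, $S$ has the same value at all times at which $w_1w_2\ne0$, and so has $T$ if moreover $\varepsilon_0+2\varepsilon_1^2S\ne0$. If $\varepsilon_0>0$, then $S\neq0$ at all points of $\mathfrak M_3$ with $w_1w_2\ne0$. 5. At all points of $\mathfrak M_3$ at which $S$, $T$ are defined (that is, $w_1w_2\ne0$, $\varepsilon_0+2\varepsilon_1^2S\neq0$) and $S\neq0$, $$H=\varepsilon_0S+\frac{\varepsilon_0}{2S}(p^2-T)-\varepsilon_1^2T+\frac{\lambda^2}2,\qquad K=\frac{(\varepsilon_0+2\varepsilon_1^2S)^2\,[r^4+T(T+4S^2-2p^2)]}{4S^2},$$ $$G=\frac{\varepsilon_0(p^4-r^4+2p^2S^2)}{4S}-\frac12S(\varepsilon_0+2\varepsilon_1^2S)T.$$ -/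

import Mathlib

open scoped Matrix ContDiff

noncomputable section

namespace GTFG

/-! ### The space `e(3,2)* ≅ ℝ⁹(M, α, β)` and the Euler equations -/

/-- The space `ℝ³(M) × ℝ³(α) × ℝ³(β)`. Coordinates are indexed by `0, 1, 2`. -/
abbrev Phase : Type := (Fin 3 → ℝ) × (Fin 3 → ℝ) × (Fin 3 → ℝ)

/-- The kinetic momentum `M`. -/
abbrev mom (u : Phase) : Fin 3 → ℝ := u.1

/-- The first field intensity `α`. -/
abbrev fa (u : Phase) : Fin 3 → ℝ := u.2.1

/-- The second field intensity `β`. -/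
abbrev fb (u : Phase) : Fin 3 → ℝ := u.2.2

/-- The partial gradient `∂f/∂M`. -/
def gradM (f : Phase → ℝ) (u : Phase) : Fin 3 → ℝ :=
  fun i => fderiv ℝ f u (Pi.single i 1, 0, 0)

/-- The partial gradient `∂f/∂α`. -/
def gradA (f : Phase → ℝ) (u : Phase) : Fin 3 → ℝ :=
  fun i => fderiv ℝ f u (0, Pi.single i 1, 0)

/-- The partial gradient `∂f/∂β`. -/
def gradB (f : Phase → ℝ) (u : Phase) : Fin 3 → ℝ :=
  fun i => fderiv ℝ f u (0, 0, Pi.single i 1)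

/-- The right-hand side of the Euler equations on `e(3,2)*` with the Hamilton function `f`:
`M' = M × ∂f/∂M + α × ∂f/∂α + β × ∂f/∂β`, `α' = α × ∂f/∂M`, `β' = β × ∂f/∂M`. -/
def eulerField (f : Phase → ℝ) (u : Phase) : Phase :=
  (mom u ⨯₃ gradM f u + fa u ⨯₃ gradA f u + fb u ⨯₃ gradB f u,
    fa u ⨯₃ gradM f u, fb u ⨯₃ gradM f u)

/-- The Casimir functions `(α·α, β·β, α·β)`. -/
def casimir (u : Phase) : ℝ × ℝ × ℝ :=
  (fa u ⬝ᵥ fa u, fb u ⬝ᵥ fb u, fa u ⬝ᵥ fb u)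

/-- The phase space `α·α = a²`, `β·β = b²`, `α·β = 0`. -/
def phaseSpace (a b : ℝ) : Set Phase := {u | casimir u = (a ^ 2, b ^ 2, 0)}

/-- The tangent space at `u` of the common level of the Casimir functions through `u`. -/
def tangentSpace (u : Phase) : Submodule ℝ Phase :=
  LinearMap.ker (fderiv ℝ casimir u : Phase →ₗ[ℝ] ℝ × ℝ × ℝ)

/-! ### The generalized two-field gyrostat -/

/-- The Hamilton function. -/
def hamH (ε₀ ε₁ lam : ℝ) (u : Phase) : ℝ :=
  1 / 4 * (mom u 0 ^ 2 + mom u 1 ^ 2) + 1 / 2 * (mom u 2 - lam) ^ 2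
    - ε₁ * ((fa u 1 * mom u 2 - fa u 2 * mom u 1) + (fb u 2 * mom u 0 - fb u 0 * mom u 2))
    - ε₀ * (fa u 0 + fb u 1)

/-- The first integral `K`. -/
def intK (ε₀ ε₁ lam : ℝ) (u : Phase) : ℝ :=
  (1 / 4 * (mom u 0 ^ 2 - mom u 1 ^ 2) + ε₀ * (fa u 0 - fb u 1)
      + ε₁ * ((fa u ⨯₃ mom u) 0 - (fb u ⨯₃ mom u) 1
        - ε₁ * (fa u ⬝ᵥ fa u - fb u ⬝ᵥ fb u))) ^ 2
    + (1 / 2 * mom u 0 * mom u 1 + ε₀ * (fa u 1 + fb u 0)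
      + ε₁ * ((fa u ⨯₃ mom u) 1 + (fb u ⨯₃ mom u) 0 - 2 * ε₁ * (fa u ⬝ᵥ fb u))) ^ 2
    + 2 * lam * (1 / 4 * (mom u 0 ^ 2 + mom u 1 ^ 2) * (mom u 2 - 2 * lam)
      + ε₀ * (fa u 2 * mom u 0 + fb u 2 * mom u 1))
    - 2 * ε₁ * lam * (fa u 1 * mom u 0 ^ 2 - fb u 0 * mom u 1 ^ 2
      - (fa u 0 - fb u 1) * mom u 0 * mom u 1
      + ε₁ * (fa u ⬝ᵥ fa u + fb u ⬝ᵥ fb u) * mom u 2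
      - 2 * ε₁ * ((fa u ⨯₃ fb u) ⬝ᵥ mom u))

/-- The first integral `G`. -/
def intG (ε₀ ε₁ lam : ℝ) (u : Phase) : ℝ :=
  1 / 4 * ((mom u ⬝ᵥ fa u) ^ 2 + (mom u ⬝ᵥ fb u) ^ 2)
    + 1 / 2 * (mom u 2 - 2 * lam) * ((fa u ⨯₃ fb u) ⬝ᵥ mom u)
    - ε₀ * ((fb u ⬝ᵥ fb u) * fa u 0 + (fa u ⬝ᵥ fa u) * fb u 1
      - (fa u ⬝ᵥ fb u) * (fa u 1 + fb u 0))
    - ε₁ * ((fb u ⬝ᵥ fb u) * (fa u ⨯₃ mom u) 0 + (fa u ⬝ᵥ fa u) * (fb u ⨯₃ mom u) 1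
      - (fa u ⬝ᵥ fb u) * ((fa u ⨯₃ mom u) 1 + (fb u ⨯₃ mom u) 0))

/-- The vector field of the generalized two-field gyrostat. -/
def gyroField (ε₀ ε₁ lam : ℝ) : Phase → Phase := eulerField (hamH ε₀ ε₁ lam)

/-- The integral map `J = H × K × G`. -/
def integralMap (ε₀ ε₁ lam : ℝ) (u : Phase) : ℝ × ℝ × ℝ :=
  (hamH ε₀ ε₁ lam u, intK ε₀ ε₁ lam u, intG ε₀ ε₁ lam u)

/-- `u` is a critical point of the restriction of the integral map to the phase space:
the differential restricted to the tangent space of the phase space has rank less than `3`. -/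
def IsCriticalPoint (ε₀ ε₁ lam : ℝ) (u : Phase) : Prop :=
  Module.finrank ℝ ((tangentSpace u).map
    (fderiv ℝ (integralMap ε₀ ε₁ lam) u : Phase →ₗ[ℝ] ℝ × ℝ × ℝ)) < 3

/-! ### Complex variables and the invariant relations -/

/-- `x₁ = (α₁ - β₂) + i (α₂ + β₁)`. -/
def x₁ (u : Phase) : ℂ := ((fa u 0 - fb u 1 : ℝ) : ℂ) + Complex.I * ((fa u 1 + fb u 0 : ℝ) : ℂ)

/-- `x₂ = (α₁ - β₂) - i (α₂ + β₁)`. -/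
def x₂ (u : Phase) : ℂ := ((fa u 0 - fb u 1 : ℝ) : ℂ) - Complex.I * ((fa u 1 + fb u 0 : ℝ) : ℂ)

/-- `z₁ = α₃ + i β₃`. -/
def z₁ (u : Phase) : ℂ := (fa u 2 : ℂ) + Complex.I * (fb u 2 : ℂ)

/-- `z₂ = α₃ - i β₃`. -/
def z₂ (u : Phase) : ℂ := (fa u 2 : ℂ) - Complex.I * (fb u 2 : ℂ)

/-- `w₁ = (M₁ + i M₂) / 2`. -/
def w₁ (u : Phase) : ℂ := 1 / 2 * ((mom u 0 : ℂ) + Complex.I * (mom u 1 : ℂ))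

/-- `w₂ = (M₁ - i M₂) / 2`. -/
def w₂ (u : Phase) : ℂ := 1 / 2 * ((mom u 0 : ℂ) - Complex.I * (mom u 1 : ℂ))

/-- The ratio `(M·α + i M·β) / (M₁ + i M₂)`. -/
def ratioPlus (u : Phase) : ℂ :=
  (((mom u ⬝ᵥ fa u : ℝ) : ℂ) + Complex.I * ((mom u ⬝ᵥ fb u : ℝ) : ℂ)) /
    ((mom u 0 : ℂ) + Complex.I * (mom u 1 : ℂ))

/-- The ratio `(M·α - i M·β) / (M₁ - i M₂)`. -/
def ratioMinus (u : Phase) : ℂ :=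
  (((mom u ⬝ᵥ fa u : ℝ) : ℂ) - Complex.I * ((mom u ⬝ᵥ fb u : ℝ) : ℂ)) /
    ((mom u 0 : ℂ) - Complex.I * (mom u 1 : ℂ))

/-- The function `U₁`, meaningful where `w₁ w₂ ≠ 0`. -/
def U₁ (u : Phase) : ℂ := ratioPlus u - ratioMinus u

/-- The derivative `f' = df/d(it) = -i df/dt` along the gyrostat system. -/
def primeDeriv (ε₀ ε₁ lam : ℝ) (f : Phase → ℂ) (u : Phase) : ℂ :=
  -Complex.I * fderiv ℝ f u (gyroField ε₀ ε₁ lam u)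

/-- The function `U₂ = 4 w₁ w₂ U₁'`. -/
def U₂ (ε₀ ε₁ lam : ℝ) (u : Phase) : ℂ := 4 * w₁ u * w₂ u * primeDeriv ε₀ ε₁ lam U₁ u

/-- The set given by `U₁ = 0`, `U₂ = 0` in the domain `w₁ w₂ ≠ 0` of the phase space. -/
def relationSet (ε₀ ε₁ lam a b : ℝ) : Set Phase :=
  {u | u ∈ phaseSpace a b ∧ w₁ u * w₂ u ≠ 0 ∧ U₁ u = 0 ∧ U₂ ε₀ ε₁ lam u = 0}

/-- The closure of the set `U₁ = 0`, `U₂ = 0` (the phase space is closed in `Phase`). -/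
def setM₃ (ε₀ ε₁ lam a b : ℝ) : Set Phase := closure (relationSet ε₀ ε₁ lam a b)

/-- The function `S`, meaningful where `w₁ w₂ ≠ 0`. -/
def intS (u : Phase) : ℂ := -(1 / 2) * (ratioPlus u + ratioMinus u)

/-- The denominator `ε₀ + 2 ε₁² S` in the definition of `T`. -/
def denT (ε₀ ε₁ : ℝ) (u : Phase) : ℂ := (ε₀ : ℂ) + 2 * (ε₁ : ℂ) ^ 2 * intS u

/-- The function `T`, meaningful where `w₁ w₂ ≠ 0` and `ε₀ + 2 ε₁² S ≠ 0`. -/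
def intT (ε₀ ε₁ : ℝ) (u : Phase) : ℂ :=
  x₁ u * x₂ u + z₁ u * z₂ u - 2 * intS u / denT ε₀ ε₁ u *
    ((w₁ u + Complex.I * ε₁ * z₁ u) * (w₂ u - Complex.I * ε₁ * z₂ u)
      + (ε₁ : ℂ) ^ 2 * (x₁ u * x₂ u))

end GTFG

/-! ### Trajectories, invariant sets, smooth points of a set -/

/-- `γ` solves `γ' = X(γ)` on the set of times `I` (used for intervals `I` of any kind). -/
def IsTrajectoryOn {E : Type*} [NormedAddCommGroup E] [NormedSpace ℝ E]
    (X : E → E) (I : Set ℝ) (γ : ℝ → E) : Prop :=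
  ∀ t ∈ I, HasDerivWithinAt γ (X (γ t)) I t

/-- A trajectory that meets `N` stays in `N`, both forward and backward in time. -/
def IsInvariantSet {E : Type*} [NormedAddCommGroup E] [NormedSpace ℝ E]
    (X : E → E) (N : Set E) : Prop :=
  ∀ (I : Set ℝ) (γ : ℝ → E), I.OrdConnected → IsTrajectoryOn X I γ →
    ∀ t₀ ∈ I, γ t₀ ∈ N → ∀ t ∈ I, γ t ∈ N

/-- Near its point `p` the set `N` is a smooth embedded `k`-dimensional submanifold of `E`:
it is the zero set of a smooth map to `ℝᶜ`, `c = dim E - k`, with surjective differential. -/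
def IsSmoothPoint {E : Type*} [NormedAddCommGroup E] [NormedSpace ℝ E]
    (N : Set E) (k : ℕ) (p : E) : Prop :=
  p ∈ N ∧ ∃ (c : ℕ) (U : Set E) (f : E → Fin c → ℝ),
    k + c = Module.finrank ℝ E ∧ IsOpen U ∧ p ∈ U ∧ ContDiffOn ℝ ∞ f U ∧
    (∀ q ∈ N ∩ U, Function.Surjective (fderiv ℝ f q)) ∧
    N ∩ U = {q | q ∈ U ∧ f q = 0}

end

noncomputable section
namespace GTFG

/-! ### Coordinates along curves -/

/-! Where M₁² + M₂² ≠ 0, the relation U₁ = 0 says that the two conjugate ratios coincide. Their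
common value -S is then real, and M is orthogonal to both shifted fields α + S e₁ and β + S e₂.
Given this, U₂ = 0 amounts to ε₀ (α + S e₁) × (β + S e₂) = S D M with D = M₃/2 - λ - ε₁(α₂ - β₁).
These five scalar relations form `Rel`; the translation is `mem_relationSet_iff`.

Invariance: for a frozen number S the five relations satisfy a homogeneous linear system along
trajectories (`rel_of_trajectory`), so they persist and S is a partial integral. A trajectory can
meet M₁ = M₂ = 0 only at isolated times unless it stays there (`trajectory_mem_setM₃`). Continuous
dependence on initial data then carries invariance over to the closure (`isInvariantSet_closure`).

Integrals: put ε₀ = S δ. The expressions of H and G through S and T hold up to terms linear in the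
relations (`defectH_eq`, `defectG_eq`). A combination of the defects of K, G and H is quadratic in
the relations (`defect_combination`). Setting the relations to zero gives the three formulas, and
constancy of H gives constancy of T. Differentiating the quadratic identity gives a linear
dependence of dH, dK, dG modulo the Casimir differentials in which dK has a non-zero coefficient
(`differential_combination`). Criticality passes to the closure because regular points form an open
set.

Smoothness: eliminating S leaves two polynomial equations, `polyU` and `polyV`, which with the three
Casimir equations cut out the closure off M₁ = M₂ = 0. Explicit tangent vectors show that the five
differentials are independent outside three families (`isSmoothPoint_or`): folds, where the momentum
is a double root for given fields and S; an axis family with λ = 0; and points with ε₀ = S = D = 0.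
Each family is approached by smooth points; the delicate case is a fold with S < 0, resolved by
rotating the fields (`mem_closure_of_fold_of_neg`). The families, and the points of the closure with
M₁ = M₂ = 0, are covered by differentiable images of ℝ³. Their Hausdorff dimension is therefore at
most three and their 4-dimensional measure is zero. -/

@[simp] theorem mom_mk (x y z : Fin 3 → ℝ) : mom (x, y, z) = x := rfl

@[simp] theorem fa_mk (x y z : Fin 3 → ℝ) : fa (x, y, z) = y := rfl

@[simp] theorem fb_mk (x y z : Fin 3 → ℝ) : fb (x, y, z) = z := rfl

section Curves

variable {γ : ℝ → Phase} {v : Phase} {I : Set ℝ} {t : ℝ}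

theorem hasDerivWithinAt_mom (h : HasDerivWithinAt γ v I t) (i : Fin 3) :
    HasDerivWithinAt (fun s => mom (γ s) i) (mom v i) I t :=
  hasDerivWithinAt_pi.1 h.fst i

theorem hasDerivWithinAt_fa (h : HasDerivWithinAt γ v I t) (i : Fin 3) :
    HasDerivWithinAt (fun s => fa (γ s) i) (fa v i) I t :=
  hasDerivWithinAt_pi.1 h.snd.fst i

theorem hasDerivWithinAt_fb (h : HasDerivWithinAt γ v I t) (i : Fin 3) :
    HasDerivWithinAt (fun s => fb (γ s) i) (fb v i) I t :=
  hasDerivWithinAt_pi.1 h.snd.snd i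

theorem hasDerivWithinAt_line (u v : Phase) (t : ℝ) :
    HasDerivWithinAt (fun s : ℝ => u + s • v) v Set.univ t := by
  have h := ((hasDerivAt_id t).smul_const v).const_add u
  rw [one_smul] at h
  exact h.hasDerivWithinAt

/-- The value of a Fréchet derivative is the derivative along a line. -/
theorem fderiv_apply_of_line {F : Type*} [NormedAddCommGroup F] [NormedSpace ℝ F]
    {f : Phase → F} {u v : Phase} {d : F}
    (hf : DifferentiableAt ℝ f u)
    (h : HasDerivWithinAt (fun s : ℝ => f (u + s • v)) d Set.univ 0) :
    fderiv ℝ f u v = d := by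
  have h0 : HasFDerivAt f (fderiv ℝ f u) (u + (0 : ℝ) • v) := by simpa using hf.hasFDerivAt
  have h1 := h0.comp_hasDerivAt (0 : ℝ)
    ((hasDerivWithinAt_line u v 0).hasDerivAt Filter.univ_mem)
  exact h1.unique (h.hasDerivAt Filter.univ_mem)

/-- The differential of the Hamilton function. -/
def dHam (ε₀ ε₁ lam : ℝ) (u v : Phase) : ℝ :=
  (mom u 0 / 2 - ε₁ * fb u 2) * mom v 0 + (mom u 1 / 2 + ε₁ * fa u 2) * mom v 1
    + (mom u 2 - lam - ε₁ * (fa u 1 - fb u 0)) * mom v 2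
    - ε₀ * fa v 0 - ε₁ * mom u 2 * fa v 1 + ε₁ * mom u 1 * fa v 2
    + ε₁ * mom u 2 * fb v 0 - ε₀ * fb v 1 - ε₁ * mom u 0 * fb v 2

theorem hasDerivWithinAt_hamH (ε₀ ε₁ lam : ℝ) (h : HasDerivWithinAt γ v I t) :
    HasDerivWithinAt (fun s => hamH ε₀ ε₁ lam (γ s)) (dHam ε₀ ε₁ lam (γ t) v) I t := by
  have m := hasDerivWithinAt_mom h
  have a := hasDerivWithinAt_fa h
  have b := hasDerivWithinAt_fb h
  have e := ((((((m 0).pow 2).add ((m 1).pow 2)).const_mul (1 / 4)).add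
    ((((m 2).sub_const lam).pow 2).const_mul (1 / 2))).sub
    (((((a 1).mul (m 2)).sub ((a 2).mul (m 1))).add
      (((b 2).mul (m 0)).sub ((b 0).mul (m 2)))).const_mul ε₁)).sub
    (((a 0).add (b 1)).const_mul ε₀)
  refine (e.congr_deriv ?_)
  simp only [dHam]
  ring

end Curves

theorem contDiff_hamH (ε₀ ε₁ lam : ℝ) : ContDiff ℝ ∞ (hamH ε₀ ε₁ lam) := by
  unfold hamH mom fa fb; fun_prop

theorem contDiff_intK (ε₀ ε₁ lam : ℝ) : ContDiff ℝ ∞ (intK ε₀ ε₁ lam) := by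
  unfold intK
  simp only [cross_apply, dotProduct, Fin.sum_univ_three, Matrix.cons_val_zero,
    Matrix.cons_val_one, Matrix.cons_val]
  unfold mom fa fb; fun_prop

theorem contDiff_intG (ε₀ ε₁ lam : ℝ) : ContDiff ℝ ∞ (intG ε₀ ε₁ lam) := by
  unfold intG
  simp only [cross_apply, dotProduct, Fin.sum_univ_three, Matrix.cons_val_zero,
    Matrix.cons_val_one, Matrix.cons_val]
  unfold mom fa fb; fun_prop

theorem contDiff_casimir : ContDiff ℝ ∞ casimir := by
  unfold casimir
  simp only [dotProduct, Fin.sum_univ_three]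
  unfold fa fb; fun_prop

theorem fderiv_hamH (ε₀ ε₁ lam : ℝ) (u v : Phase) :
    fderiv ℝ (hamH ε₀ ε₁ lam) u v = dHam ε₀ ε₁ lam u v := by
  refine fderiv_apply_of_line ((contDiff_hamH ε₀ ε₁ lam).differentiable (by simp) u) ?_
  simpa using hasDerivWithinAt_hamH ε₀ ε₁ lam (hasDerivWithinAt_line u v 0)

/-- The vector field of the gyrostat in coordinates. -/
theorem gyroField_eq (ε₀ ε₁ lam : ℝ) (u : Phase) :
    gyroField ε₀ ε₁ lam u =
      (![mom u 1 * (mom u 2 / 2 - lam + ε₁ * fb u 0) - ε₁ * fb u 1 * mom u 0 + ε₀ * fb u 2,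
        mom u 0 * (lam - mom u 2 / 2 + ε₁ * fa u 1) - ε₁ * fa u 0 * mom u 1 - ε₀ * fa u 2,
        ε₁ * (mom u 0 * fa u 2 + mom u 1 * fb u 2 - (fa u 0 + fb u 1) * mom u 2)
          + ε₀ * (fa u 1 - fb u 0)],
      fa u ⨯₃ ![mom u 0 / 2 - ε₁ * fb u 2, mom u 1 / 2 + ε₁ * fa u 2,
        mom u 2 - lam - ε₁ * (fa u 1 - fb u 0)],
      fb u ⨯₃ ![mom u 0 / 2 - ε₁ * fb u 2, mom u 1 / 2 + ε₁ * fa u 2,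
        mom u 2 - lam - ε₁ * (fa u 1 - fb u 0)]) := by
  have hM : gradM (hamH ε₀ ε₁ lam) u = ![mom u 0 / 2 - ε₁ * fb u 2, mom u 1 / 2 + ε₁ * fa u 2,
        mom u 2 - lam - ε₁ * (fa u 1 - fb u 0)] := by
    ext i; fin_cases i <;> simp [gradM, fderiv_hamH, dHam, mom, fa, fb]
  have hA : gradA (hamH ε₀ ε₁ lam) u = ![-ε₀, -ε₁ * mom u 2, ε₁ * mom u 1] := by
    ext i; fin_cases i <;> simp [gradA, fderiv_hamH, dHam, mom, fa, fb]
  have hB : gradB (hamH ε₀ ε₁ lam) u = ![ε₁ * mom u 2, -ε₀, -ε₁ * mom u 0] := by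
    ext i; fin_cases i <;> simp [gradB, fderiv_hamH, dHam, mom, fa, fb]
  simp only [gyroField, eulerField, hM, hA, hB, Prod.mk.injEq, and_true]
  ext i
  fin_cases i <;> simp [cross_apply] <;> ring


/-! ### Real form of the invariant relations -/

/-- `M₁² + M₂² = 4 w₁ w₂`. -/
def planarSq (u : Phase) : ℝ := mom u 0 ^ 2 + mom u 1 ^ 2

/-- `M₃ / 2 - λ - ε₁ (α₂ - β₁)`. -/
def redMom (ε₁ lam : ℝ) (u : Phase) : ℝ := mom u 2 / 2 - lam - ε₁ * (fa u 1 - fb u 0)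

/-- `M · (α + S e₁)`. -/
def relA (S : ℝ) (u : Phase) : ℝ :=
  mom u 0 * fa u 0 + mom u 1 * fa u 1 + mom u 2 * fa u 2 + S * mom u 0

/-- `M · (β + S e₂)`. -/
def relB (S : ℝ) (u : Phase) : ℝ :=
  mom u 0 * fb u 0 + mom u 1 * fb u 1 + mom u 2 * fb u 2 + S * mom u 1

/-- First component of `(α + S e₁) × (β + S e₂)`. -/
def crossX (S : ℝ) (u : Phase) : ℝ := fa u 1 * fb u 2 - fa u 2 * fb u 1 - S * fa u 2

/-- Second component of `(α + S e₁) × (β + S e₂)`. -/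
def crossY (S : ℝ) (u : Phase) : ℝ := fa u 2 * fb u 0 - fa u 0 * fb u 2 - S * fb u 2

/-- Third component of `(α + S e₁) × (β + S e₂)`. -/
def crossZ (S : ℝ) (u : Phase) : ℝ :=
  fa u 0 * fb u 1 - fa u 1 * fb u 0 + S * (fa u 0 + fb u 1) + S ^ 2

/-- First component of `c (α + S e₁) × (β + S e₂) - s D M`. -/
def relX (ε₁ lam c s S : ℝ) (u : Phase) : ℝ := c * crossX S u - s * redMom ε₁ lam u * mom u 0

/-- Second component of `c (α + S e₁) × (β + S e₂) - s D M`. -/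
def relY (ε₁ lam c s S : ℝ) (u : Phase) : ℝ := c * crossY S u - s * redMom ε₁ lam u * mom u 1

/-- Third component of `c (α + S e₁) × (β + S e₂) - s D M`. -/
def relZ (ε₁ lam c s S : ℝ) (u : Phase) : ℝ := c * crossZ S u - s * redMom ε₁ lam u * mom u 2

/-- The relations satisfied by a point with the value `S` of the partial integral. -/
structure Rel (ε₀ ε₁ lam S : ℝ) (u : Phase) : Prop where
  a : relA S u = 0
  b : relB S u = 0
  x : relX ε₁ lam ε₀ S S u = 0
  y : relY ε₁ lam ε₀ S S u = 0
  z : relZ ε₁ lam ε₀ S S u = 0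

/-- `M₂ (M·α) - M₁ (M·β)`. -/
def polyU (u : Phase) : ℝ :=
  mom u 1 * (mom u 0 * fa u 0 + mom u 1 * fa u 1 + mom u 2 * fa u 2)
    - mom u 0 * (mom u 0 * fb u 0 + mom u 1 * fb u 1 + mom u 2 * fb u 2)

/-- `M₁ (M·α) + M₂ (M·β)`. -/
def polyS (u : Phase) : ℝ :=
  mom u 0 * (mom u 0 * fa u 0 + mom u 1 * fa u 1 + mom u 2 * fa u 2)
    + mom u 1 * (mom u 0 * fb u 0 + mom u 1 * fb u 1 + mom u 2 * fb u 2)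

/-- The polynomial form of the second invariant relation. -/
def polyV (ε₀ ε₁ lam : ℝ) (u : Phase) : ℝ :=
  ε₀ * planarSq u * (mom u 0 * crossX 0 u + mom u 1 * crossY 0 u)
    + ε₀ * polyS u * (mom u 0 * fa u 2 + mom u 1 * fb u 2)
    + planarSq u * polyS u * redMom ε₁ lam u

theorem w₁_mul_w₂ (u : Phase) : w₁ u * w₂ u = ((planarSq u / 4 : ℝ) : ℂ) := by
  simp only [w₁, w₂, planarSq]
  push_cast
  linear_combination -(1 / 4) * (mom u 1 : ℂ) ^ 2 * Complex.I_sq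

theorem w₁_mul_w₂_ne_zero_iff (u : Phase) : w₁ u * w₂ u ≠ 0 ↔ planarSq u ≠ 0 := by
  rw [w₁_mul_w₂, Ne, Complex.ofReal_eq_zero]
  simp

theorem planar_factor_ne_zero {u : Phase} (h : planarSq u ≠ 0) :
    ((mom u 0 : ℂ) + Complex.I * (mom u 1 : ℂ)) ≠ 0 ∧
      ((mom u 0 : ℂ) - Complex.I * (mom u 1 : ℂ)) ≠ 0 := by
  rw [← w₁_mul_w₂_ne_zero_iff] at h
  simp only [w₁, w₂] at h
  exact ⟨fun h0 => h (by rw [h0]; ring), fun h0 => h (by rw [h0]; ring)⟩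

theorem planarSq_cast (u : Phase) : (planarSq u : ℂ) =
    ((mom u 0 : ℂ) + Complex.I * (mom u 1 : ℂ)) * ((mom u 0 : ℂ) - Complex.I * (mom u 1 : ℂ)) := by
  simp only [planarSq]
  push_cast
  linear_combination (mom u 1 : ℂ) ^ 2 * Complex.I_sq

theorem ratioPlus_eq {u : Phase} (h : planarSq u ≠ 0) :
    ratioPlus u = ((polyS u : ℂ) - Complex.I * polyU u) / planarSq u := by
  obtain ⟨h1, h2⟩ := planar_factor_ne_zero h
  rw [planarSq_cast, ratioPlus, div_eq_div_iff h1 (mul_ne_zero h1 h2)]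
  simp only [polyS, polyU, dotProduct, Fin.sum_univ_three]
  push_cast
  linear_combination -((mom u 0 : ℂ) + Complex.I * (mom u 1 : ℂ)) *
    ((mom u 1 : ℂ) * ((mom u 0 : ℂ) * fb u 0 + mom u 1 * fb u 1 + mom u 2 * fb u 2))
      * Complex.I_sq

theorem ratioMinus_eq {u : Phase} (h : planarSq u ≠ 0) :
    ratioMinus u = ((polyS u : ℂ) + Complex.I * polyU u) / planarSq u := by
  obtain ⟨h1, h2⟩ := planar_factor_ne_zero h
  rw [planarSq_cast, ratioMinus, div_eq_div_iff h2 (mul_ne_zero h1 h2)]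
  simp only [polyS, polyU, dotProduct, Fin.sum_univ_three]
  push_cast
  linear_combination -((mom u 0 : ℂ) - Complex.I * (mom u 1 : ℂ)) *
    ((mom u 1 : ℂ) * ((mom u 0 : ℂ) * fb u 0 + mom u 1 * fb u 1 + mom u 2 * fb u 2))
      * Complex.I_sq

theorem U₁_eq {u : Phase} (h : planarSq u ≠ 0) :
    U₁ u = ((polyU u / planarSq u : ℝ) : ℂ) * (-2 * Complex.I) := by
  rw [U₁, ratioPlus_eq h, ratioMinus_eq h]
  push_cast
  ring

theorem intS_eq {u : Phase} (h : planarSq u ≠ 0) :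
    intS u = ((-polyS u / planarSq u : ℝ) : ℂ) := by
  rw [intS, ratioPlus_eq h, ratioMinus_eq h]
  push_cast
  ring

theorem U₁_eq_zero_iff {u : Phase} (h : planarSq u ≠ 0) : U₁ u = 0 ↔ polyU u = 0 := by
  rw [U₁_eq h]
  simp [h]

/-- The differential of `polyU`. -/
def dPolyU (u v : Phase) : ℝ :=
  mom v 1 * (mom u 0 * fa u 0 + mom u 1 * fa u 1 + mom u 2 * fa u 2)
    + mom u 1 * (mom v 0 * fa u 0 + mom v 1 * fa u 1 + mom v 2 * fa u 2
      + (mom u 0 * fa v 0 + mom u 1 * fa v 1 + mom u 2 * fa v 2))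
    - mom v 0 * (mom u 0 * fb u 0 + mom u 1 * fb u 1 + mom u 2 * fb u 2)
    - mom u 0 * (mom v 0 * fb u 0 + mom v 1 * fb u 1 + mom v 2 * fb u 2
      + (mom u 0 * fb v 0 + mom u 1 * fb v 1 + mom u 2 * fb v 2))

section Curves

variable {γ : ℝ → Phase} {v : Phase} {I : Set ℝ} {t : ℝ}

theorem hasDerivWithinAt_momA (h : HasDerivWithinAt γ v I t) :
    HasDerivWithinAt (fun s => mom (γ s) 0 * fa (γ s) 0 + mom (γ s) 1 * fa (γ s) 1
        + mom (γ s) 2 * fa (γ s) 2)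
      (mom v 0 * fa (γ t) 0 + mom v 1 * fa (γ t) 1 + mom v 2 * fa (γ t) 2
      + (mom (γ t) 0 * fa v 0 + mom (γ t) 1 * fa v 1 + mom (γ t) 2 * fa v 2)) I t := by
  have m := hasDerivWithinAt_mom h
  have a := hasDerivWithinAt_fa h
  exact ((((m 0).mul (a 0)).add ((m 1).mul (a 1))).add ((m 2).mul (a 2))).congr_deriv (by ring)

theorem hasDerivWithinAt_momB (h : HasDerivWithinAt γ v I t) :
    HasDerivWithinAt (fun s => mom (γ s) 0 * fb (γ s) 0 + mom (γ s) 1 * fb (γ s) 1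
        + mom (γ s) 2 * fb (γ s) 2)
      (mom v 0 * fb (γ t) 0 + mom v 1 * fb (γ t) 1 + mom v 2 * fb (γ t) 2
      + (mom (γ t) 0 * fb v 0 + mom (γ t) 1 * fb v 1 + mom (γ t) 2 * fb v 2)) I t := by
  have m := hasDerivWithinAt_mom h
  have b := hasDerivWithinAt_fb h
  exact ((((m 0).mul (b 0)).add ((m 1).mul (b 1))).add ((m 2).mul (b 2))).congr_deriv (by ring)

theorem hasDerivWithinAt_polyU (h : HasDerivWithinAt γ v I t) :
    HasDerivWithinAt (fun s => polyU (γ s)) (dPolyU (γ t) v) I t := by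
  have m := hasDerivWithinAt_mom h
  exact (((m 1).mul (hasDerivWithinAt_momA h)).sub
    ((m 0).mul (hasDerivWithinAt_momB h))).congr_deriv (by simp only [dPolyU]; ring)

theorem hasDerivWithinAt_planarSq (h : HasDerivWithinAt γ v I t) :
    HasDerivWithinAt (fun s => planarSq (γ s))
      (2 * mom (γ t) 0 * mom v 0 + 2 * mom (γ t) 1 * mom v 1) I t := by
  have m := hasDerivWithinAt_mom h
  exact (((m 0).pow 2).add ((m 1).pow 2)).congr_deriv (by norm_num)

end Curves

theorem contDiff_planarSq : ContDiff ℝ ∞ planarSq := by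
  unfold planarSq mom; fun_prop

theorem contDiff_polyU : ContDiff ℝ ∞ polyU := by
  unfold polyU mom fa fb; fun_prop

theorem isOpen_planarSq_ne_zero : IsOpen {u : Phase | planarSq u ≠ 0} :=
  isOpen_ne_fun contDiff_planarSq.continuous continuous_const

/-- At a zero of the numerator the quotient rule loses the derivative of the denominator. -/
theorem fderiv_U₁ {u : Phase} (h : planarSq u ≠ 0) (hU : polyU u = 0) (v : Phase) :
    fderiv ℝ U₁ u v = ((dPolyU u v / planarSq u : ℝ) : ℂ) * (-2 * Complex.I) := by
  have hev : U₁ =ᶠ[nhds u] fun q => ((polyU q / planarSq q : ℝ) : ℂ) * (-2 * Complex.I) :=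
    Filter.eventually_of_mem (isOpen_planarSq_ne_zero.mem_nhds h) fun q hq => U₁_eq hq
  rw [hev.fderiv_eq]
  have hd : DifferentiableAt ℝ (fun q => polyU q / planarSq q) u :=
    (contDiff_polyU.contDiffAt.div contDiff_planarSq.contDiffAt h).differentiableAt (by simp)
  refine fderiv_apply_of_line ?_ ?_
  · exact (Complex.ofRealCLM.differentiableAt.comp u hd).mul_const _
  · have h0 := hasDerivWithinAt_line u v 0
    have h1 := ((hasDerivWithinAt_polyU h0).div (hasDerivWithinAt_planarSq h0)
      (by simpa using h)).congr_deriv (g' := dPolyU u v / planarSq u)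
      (by simp only [zero_smul, add_zero, hU]; field_simp; ring)
    exact (h1.ofReal_comp).mul_const _

/-- An identity for every number S. Once `relA` and `relB` vanish, the second invariant relation
reduces to the scalar equation M₁ `relX` + M₂ `relY` = 0. -/
theorem dPolyU_gyroField (ε₀ ε₁ lam S : ℝ) (u : Phase) :
    dPolyU u (gyroField ε₀ ε₁ lam u) =
      relA S u * (mom (gyroField ε₀ ε₁ lam u) 1
        - ε₁ * (mom u 1 * fb u 1 + mom u 0 * fb u 0))
      - relB S u * (mom (gyroField ε₀ ε₁ lam u) 0
        - ε₁ * (mom u 1 * fa u 1 + mom u 0 * fa u 0))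
      - mom u 0 * relX ε₁ lam ε₀ S S u - mom u 1 * relY ε₁ lam ε₀ S S u := by
  rw [gyroField_eq]
  simp only [dPolyU, relA, relB, relX, relY, crossX, crossY, redMom, cross_apply, mom, fa, fb,
    Matrix.cons_val_zero, Matrix.cons_val_one, Matrix.cons_val]
  ring

theorem polyU_eq_of_rel {S : ℝ} {u : Phase} (ha : relA S u = 0) (hb : relB S u = 0) :
    polyU u = 0 ∧ polyS u = -S * planarSq u := by
  simp only [relA, relB, polyU, polyS, planarSq] at *
  constructor
  · linear_combination mom u 1 * ha - mom u 0 * hb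
  · linear_combination mom u 0 * ha + mom u 1 * hb

theorem rel_of_polyU {u : Phase} (h : planarSq u ≠ 0) (hU : polyU u = 0) :
    relA (-polyS u / planarSq u) u = 0 ∧ relB (-polyS u / planarSq u) u = 0 := by
  constructor
  · simp only [relA]
    field_simp
    simp only [planarSq, polyS, polyU] at *
    linear_combination mom u 1 * hU
  · simp only [relB]
    field_simp
    simp only [planarSq, polyS, polyU] at *
    linear_combination -mom u 0 * hU

/-- The expansion M × (A × B) = A (M·B) - B (M·A) for the shifted fields A = α + S e₁ and B = β + S
e₂. -/
theorem cross_parallel (S : ℝ) (u : Phase) :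
    mom u 0 * crossY S u - mom u 1 * crossX S u = fa u 2 * relB S u - fb u 2 * relA S u ∧
    mom u 1 * crossZ S u - mom u 2 * crossY S u
      = (fa u 0 + S) * relB S u - fb u 0 * relA S u ∧
    mom u 2 * crossX S u - mom u 0 * crossZ S u
      = fa u 1 * relB S u - (fb u 1 + S) * relA S u := by
  simp only [relA, relB, crossX, crossY, crossZ]
  refine ⟨?_, ?_, ?_⟩ <;> ring

/-- Under the first relation, the second one is equivalent to a single scalar equation. -/
theorem rel_of_planar {ε₀ ε₁ lam S : ℝ} {u : Phase} (h : planarSq u ≠ 0)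
    (ha : relA S u = 0) (hb : relB S u = 0)
    (hE : mom u 0 * relX ε₁ lam ε₀ S S u + mom u 1 * relY ε₁ lam ε₀ S S u = 0) :
    Rel ε₀ ε₁ lam S u := by
  obtain ⟨h1, h2, h3⟩ := cross_parallel S u
  rw [ha, hb] at h1 h2 h3
  have hx : relX ε₁ lam ε₀ S S u = 0 := by
    have : planarSq u * relX ε₁ lam ε₀ S S u = 0 := by
      simp only [relX, relY, planarSq] at *
      linear_combination mom u 0 * hE - ε₀ * mom u 1 * h1
    exact (mul_eq_zero.1 this).resolve_left h
  have hy : relY ε₁ lam ε₀ S S u = 0 := by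
    have : planarSq u * relY ε₁ lam ε₀ S S u = 0 := by
      simp only [relX, relY, planarSq] at *
      linear_combination mom u 1 * hE + ε₀ * mom u 0 * h1
    exact (mul_eq_zero.1 this).resolve_left h
  have hz : relZ ε₁ lam ε₀ S S u = 0 := by
    have : planarSq u * relZ ε₁ lam ε₀ S S u = 0 := by
      simp only [relX, relY, relZ, planarSq] at *
      linear_combination mom u 0 * mom u 2 * hx + mom u 1 * mom u 2 * hy
        + ε₀ * mom u 1 * h2 - ε₀ * mom u 0 * h3
    exact (mul_eq_zero.1 this).resolve_left h
  exact ⟨ha, hb, hx, hy, hz⟩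

theorem intS_eq_of_rel {S : ℝ} {u : Phase} (h : planarSq u ≠ 0)
    (ha : relA S u = 0) (hb : relB S u = 0) : intS u = S := by
  rw [intS_eq h, (polyU_eq_of_rel ha hb).2]
  congr 1
  field_simp

theorem U₂_eq_zero_iff {ε₀ ε₁ lam : ℝ} {u : Phase} (h : planarSq u ≠ 0) (hU : polyU u = 0) :
    U₂ ε₀ ε₁ lam u = 0 ↔ dPolyU u (gyroField ε₀ ε₁ lam u) = 0 := by
  have hw := (w₁_mul_w₂_ne_zero_iff u).2 h
  rw [U₂, primeDeriv, fderiv_U₁ h hU, mul_assoc 4]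
  simp [h, hw]

/-- The real form of the invariant relations on which everything else rests; the witness S is
-`polyS` / `planarSq`, the value of `intS`. -/
theorem mem_relationSet_iff {ε₀ ε₁ lam a b : ℝ} {u : Phase} :
    u ∈ relationSet ε₀ ε₁ lam a b ↔
      u ∈ phaseSpace a b ∧ planarSq u ≠ 0 ∧ ∃ S : ℝ, Rel ε₀ ε₁ lam S u := by
  simp only [relationSet, Set.mem_ofPred_eq, w₁_mul_w₂_ne_zero_iff]
  refine and_congr_right fun _ => and_congr_right fun h => ?_
  rw [U₁_eq_zero_iff h]
  constructor
  · rintro ⟨hU, hV⟩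
    rw [U₂_eq_zero_iff h hU] at hV
    obtain ⟨ha, hb⟩ := rel_of_polyU h hU
    refine ⟨_, rel_of_planar h ha hb ?_⟩
    rw [dPolyU_gyroField ε₀ ε₁ lam (-polyS u / planarSq u), ha, hb] at hV
    linear_combination -hV
  · rintro ⟨S, hS⟩
    have hU := (polyU_eq_of_rel hS.a hS.b).1
    refine ⟨hU, ?_⟩
    rw [U₂_eq_zero_iff h hU, dPolyU_gyroField ε₀ ε₁ lam S, hS.a, hS.b, hS.x, hS.y]
    ring

/-- Multiplying by `planarSq` eliminates S. Polynomial equations survive passage to the closure and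
can serve as defining equations of a manifold. -/
theorem rel_iff_poly {ε₀ ε₁ lam : ℝ} {u : Phase} (h : planarSq u ≠ 0) :
    (∃ S : ℝ, Rel ε₀ ε₁ lam S u) ↔ polyU u = 0 ∧ polyV ε₀ ε₁ lam u = 0 := by
  have key : ∀ S : ℝ, polyS u = -S * planarSq u → polyV ε₀ ε₁ lam u = planarSq u *
      (mom u 0 * relX ε₁ lam ε₀ S S u + mom u 1 * relY ε₁ lam ε₀ S S u) := by
    intro S hs
    simp only [polyV, hs]
    simp only [relX, relY, crossX, crossY, planarSq]
    ring
  constructor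
  · rintro ⟨S, hS⟩
    obtain ⟨h1, h2⟩ := polyU_eq_of_rel hS.a hS.b
    exact ⟨h1, by rw [key S h2, hS.x, hS.y]; ring⟩
  · rintro ⟨hU, hV⟩
    obtain ⟨ha, hb⟩ := rel_of_polyU h hU
    refine ⟨_, rel_of_planar h ha hb ?_⟩
    rw [key (-polyS u / planarSq u) (by field_simp)] at hV
    exact (mul_eq_zero.1 hV).resolve_left h


/-! ### Algebraic identities for the integrals -/

/-- `α·α` in coordinates. -/
def sqA (u : Phase) : ℝ := fa u 0 ^ 2 + fa u 1 ^ 2 + fa u 2 ^ 2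

/-- `β·β` in coordinates. -/
def sqB (u : Phase) : ℝ := fb u 0 ^ 2 + fb u 1 ^ 2 + fb u 2 ^ 2

/-- `α·β` in coordinates. -/
def dotAB (u : Phase) : ℝ := fa u 0 * fb u 0 + fa u 1 * fb u 1 + fa u 2 * fb u 2

theorem casimir_eq (u : Phase) : casimir u = (sqA u, sqB u, dotAB u) := by
  simp only [casimir, sqA, sqB, dotAB, dotProduct, Fin.sum_univ_three, sq]

theorem mem_phaseSpace_iff {a b : ℝ} {u : Phase} :
    u ∈ phaseSpace a b ↔ sqA u = a ^ 2 ∧ sqB u = b ^ 2 ∧ dotAB u = 0 := by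
  simp [phaseSpace, casimir_eq]

/-- `T` multiplied by `δ + 2 ε₁²`, where `ε₀ = S δ`. -/
def scaledT (ε₁ δ : ℝ) (u : Phase) : ℝ :=
  δ * ((fa u 0 - fb u 1) ^ 2 + (fa u 1 + fb u 0) ^ 2 + (fa u 2 ^ 2 + fb u 2 ^ 2))
    - planarSq u / 2 + 2 * ε₁ * (fb u 2 * mom u 0 - fa u 2 * mom u 1)

/-- The defect of the expression of `H` through `S` and `T`. -/
def defectH (ε₁ lam S δ : ℝ) (u : Phase) : ℝ :=
  2 * (hamH (S * δ) ε₁ lam u - lam ^ 2 / 2) - 2 * S ^ 2 * δ - δ * (sqA u + sqB u)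
    + scaledT ε₁ δ u

/-- The defect of the expression of `G` through `S` and `T`. -/
def defectG (ε₁ lam S δ : ℝ) (u : Phase) : ℝ :=
  2 * intG (S * δ) ε₁ lam u - 2 * δ * (sqA u * sqB u - dotAB u ^ 2)
    - S ^ 2 * δ * (sqA u + sqB u) + S ^ 2 * scaledT ε₁ δ u

/-- The defect of the expression of `K` through `S` and `T`. -/
def defectK (ε₁ lam S δ : ℝ) (u : Phase) : ℝ :=
  4 * intK (S * δ) ε₁ lam u - scaledT ε₁ δ u ^ 2
    - (δ + 2 * ε₁ ^ 2) * scaledT ε₁ δ u * (4 * S ^ 2 - 2 * (sqA u + sqB u))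
    - (δ + 2 * ε₁ ^ 2) ^ 2 * ((sqA u - sqB u) ^ 2 + 4 * dotAB u ^ 2)

/-- This single relation already determines T from H, S and the Casimir functions, so T inherits
constancy from H. -/
theorem defectH_eq (ε₁ lam S δ : ℝ) (u : Phase) :
    defectH ε₁ lam S δ u = -2 * relZ ε₁ lam δ 1 S u := by
  simp only [defectH, hamH, scaledT, sqA, sqB, relZ, crossZ, redMom, planarSq]
  ring

theorem defectG_eq (ε₁ lam S δ : ℝ) (u : Phase) :
    defectG ε₁ lam S δ u =
      -S * (relA S u * mom u 0 + relB S u * mom u 1) + (relA S u ^ 2 + relB S u ^ 2) / 2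
      - 2 * (crossX 0 u * relX ε₁ lam δ 1 S u + crossY 0 u * relY ε₁ lam δ 1 S u
        + crossZ 0 u * relZ ε₁ lam δ 1 S u)
      + 2 * ε₁ * ((crossY 0 u + S * fb u 2) * relA S u
        - (crossX 0 u + S * fa u 2) * relB S u) := by
  simp only [defectG, intG, scaledT, sqA, sqB, dotAB, relA, relB, relX, relY, relZ, crossX, crossY,
    crossZ, redMom, planarSq, cross_apply, dotProduct, Fin.sum_univ_three, Matrix.cons_val_zero,
    Matrix.cons_val_one, Matrix.cons_val]
  ring

/-- A combination of the integrals is, up to the Casimir functions, quadratic in the relations. -/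
theorem defect_combination (ε₁ lam S δ : ℝ) (u : Phase) :
    defectK ε₁ lam S δ u + 4 * (δ + 2 * ε₁ ^ 2) * defectG ε₁ lam S δ u
      + 2 * (scaledT ε₁ δ u - (δ + 2 * ε₁ ^ 2) * (sqA u + sqB u)) * defectH ε₁ lam S δ u =
    -4 * (relX ε₁ lam δ 1 S u ^ 2 + relY ε₁ lam δ 1 S u ^ 2)
      + 2 * δ * (relA S u ^ 2 + relB S u ^ 2)
      + 8 * ε₁ * (relA S u * relY ε₁ lam δ 1 S u - relB S u * relX ε₁ lam δ 1 S u) := by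
  simp only [defectK, intK, defectG, defectH, intG, hamH, scaledT, sqA, sqB,
    dotAB, relA, relB, relX, relY, crossX, crossY, redMom, planarSq, cross_apply,
    dotProduct, Fin.sum_univ_three, Matrix.cons_val_zero, Matrix.cons_val_one, Matrix.cons_val]
  ring

theorem cross_sq (u : Phase) :
    crossX 0 u ^ 2 + crossY 0 u ^ 2 + crossZ 0 u ^ 2 = sqA u * sqB u - dotAB u ^ 2 := by
  simp only [crossX, crossY, crossZ, sqA, sqB, dotAB]
  ring

/-- The relations after division by `S`, where `ε₀ = S δ`. -/
structure NormRel (ε₁ lam S δ : ℝ) (u : Phase) : Prop where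
  a : relA S u = 0
  b : relB S u = 0
  x : relX ε₁ lam δ 1 S u = 0
  y : relY ε₁ lam δ 1 S u = 0
  z : relZ ε₁ lam δ 1 S u = 0

theorem Rel.normRel {ε₀ ε₁ lam S : ℝ} {u : Phase} (h : Rel ε₀ ε₁ lam S u) (hS : S ≠ 0) :
    NormRel ε₁ lam S (ε₀ / S) u := by
  obtain ⟨ha, hb, hx, hy, hz⟩ := h
  refine ⟨ha, hb, ?_, ?_, ?_⟩
  · simp only [relX] at *
    field_simp
    linear_combination hx
  · simp only [relY] at *
    field_simp
    linear_combination hy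
  · simp only [relZ] at *
    field_simp
    linear_combination hz

/-- For S = 0 the vector relation becomes ε₀ α × β = 0, while |α × β| = |ab| on the phase space. -/
theorem Rel.S_ne_zero {ε₀ ε₁ lam a b S : ℝ} {u : Phase} (h : Rel ε₀ ε₁ lam S u)
    (hu : u ∈ phaseSpace a b) (ha : a ≠ 0) (hb : b ≠ 0) (hε : ε₀ ≠ 0) : S ≠ 0 := by
  rintro rfl
  obtain ⟨h1, h2, h3⟩ := mem_phaseSpace_iff.1 hu
  have hc := cross_sq u
  obtain ⟨-, -, hx, hy, hz⟩ := h
  simp only [relX, relY, relZ, zero_mul, sub_zero, mul_eq_zero, hε, false_or] at hx hy hz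
  rw [hx, hy, hz, h1, h2, h3] at hc
  have : (a * b) ^ 2 = 0 := by linear_combination -hc
  simp [ha, hb] at this

/-- Division by S is possible unless S = 0, which forces ε₀ = 0. In that case any δ satisfies ε₀ = S
δ, and it can be chosen to fit the vector relation. -/
theorem exists_normRel {ε₀ ε₁ lam a b : ℝ} {u : Phase} (ha : a ≠ 0) (hb : b ≠ 0)
    (hu : u ∈ relationSet ε₀ ε₁ lam a b) : ∃ S δ : ℝ, ε₀ = S * δ ∧ NormRel ε₁ lam S δ u := by
  obtain ⟨hp, hW, S, hS⟩ := mem_relationSet_iff.1 hu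
  by_cases h0 : S = 0
  · have hε : ε₀ = 0 := by
      by_contra h
      exact hS.S_ne_zero hp ha hb h h0
    subst h0
    obtain ⟨h1, h2, h3⟩ := mem_phaseSpace_iff.1 hp
    have hN := cross_sq u
    rw [h1, h2, h3] at hN
    obtain ⟨c1, c2, c3⟩ := cross_parallel 0 u
    rw [hS.a, hS.b] at c1 c2 c3
    have hab : a ^ 2 * b ^ 2 ≠ 0 := by positivity
    -- M is parallel to N = α × β, so δ = D (M·N) / |N|² solves δ N = D M; here |N|² = a²b².
    refine ⟨0, redMom ε₁ lam u * (mom u 0 * crossX 0 u + mom u 1 * crossY 0 u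
      + mom u 2 * crossZ 0 u) / (a ^ 2 * b ^ 2), by simp [hε], hS.a, hS.b, ?_, ?_, ?_⟩
    · simp only [relX]
      field_simp
      linear_combination redMom ε₁ lam u * (-crossY 0 u * c1 + crossZ 0 u * c3 + mom u 0 * hN)
    · simp only [relY]
      field_simp
      linear_combination redMom ε₁ lam u * (crossX 0 u * c1 - crossZ 0 u * c2 + mom u 1 * hN)
    · simp only [relZ]
      field_simp
      linear_combination redMom ε₁ lam u * (crossY 0 u * c2 - crossX 0 u * c3 + mom u 2 * hN)
  · exact ⟨S, ε₀ / S, by field_simp, hS.normRel h0⟩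

/-! ### Closed equations valid on the closure; reality of S and T -/

theorem contDiff_polyV (ε₀ ε₁ lam : ℝ) : ContDiff ℝ ∞ (polyV ε₀ ε₁ lam) := by
  unfold polyV polyS planarSq crossX crossY redMom mom fa fb; fun_prop

theorem isClosed_phaseSpace (a b : ℝ) : IsClosed (phaseSpace a b) :=
  isClosed_eq contDiff_casimir.continuous continuous_const

theorem setM₃_subset_phaseSpace (ε₀ ε₁ lam a b : ℝ) :
    setM₃ ε₀ ε₁ lam a b ⊆ phaseSpace a b :=
  closure_minimal (fun _ hu => hu.1) (isClosed_phaseSpace a b)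

theorem polyU_eq_zero_of_mem_setM₃ {ε₀ ε₁ lam a b : ℝ} {u : Phase}
    (hu : u ∈ setM₃ ε₀ ε₁ lam a b) : polyU u = 0 ∧ polyV ε₀ ε₁ lam u = 0 := by
  have hc : IsClosed {u : Phase | polyU u = 0 ∧ polyV ε₀ ε₁ lam u = 0} :=
    (isClosed_eq contDiff_polyU.continuous continuous_const).inter
      (isClosed_eq (contDiff_polyV ε₀ ε₁ lam).continuous continuous_const)
  refine closure_minimal ?_ hc hu
  intro v hv
  obtain ⟨-, hW, hS⟩ := mem_relationSet_iff.1 hv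
  exact (rel_iff_poly hW).1 hS

/-- The closure adds only points with M₁ = M₂ = 0, because the polynomial relations are closed
conditions. -/
theorem mem_relationSet_of_mem_setM₃ {ε₀ ε₁ lam a b : ℝ} {u : Phase}
    (hu : u ∈ setM₃ ε₀ ε₁ lam a b) (hW : planarSq u ≠ 0) : u ∈ relationSet ε₀ ε₁ lam a b :=
  mem_relationSet_iff.2 ⟨setM₃_subset_phaseSpace _ _ _ _ _ hu, hW,
    (rel_iff_poly hW).2 (polyU_eq_zero_of_mem_setM₃ hu)⟩

theorem intS_ne_zero {ε₀ ε₁ lam a b : ℝ} (ha : a ≠ 0) (hb : b ≠ 0) (hε : ε₀ ≠ 0) {u : Phase}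
    (hu : u ∈ relationSet ε₀ ε₁ lam a b) : intS u ≠ 0 := by
  obtain ⟨hp, hW, S, hS⟩ := mem_relationSet_iff.1 hu
  rw [intS_eq_of_rel hW hS.a hS.b]
  exact_mod_cast hS.S_ne_zero hp ha hb hε

/-- Every complex factor of T pairs with its conjugate, and the denominator is S (δ + 2 ε₁²) with δ
= ε₀ / S; so T is real. -/
theorem intT_eq {ε₀ ε₁ S : ℝ} {u : Phase} (hS : intS u = S) (h0 : S ≠ 0)
    (hd : denT ε₀ ε₁ u ≠ 0) :
    ε₀ / S + 2 * ε₁ ^ 2 ≠ 0 ∧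
      intT ε₀ ε₁ u = ((scaledT ε₁ (ε₀ / S) u / (ε₀ / S + 2 * ε₁ ^ 2) : ℝ) : ℂ) := by
  have hd1 : ε₀ + 2 * ε₁ ^ 2 * S ≠ 0 := by
    rw [denT, hS] at hd
    exact_mod_cast hd
  have hd' : ε₀ / S + 2 * ε₁ ^ 2 ≠ 0 := by
    intro h
    apply hd1
    field_simp at h
    linear_combination h
  refine ⟨hd', ?_⟩
  have hden : denT ε₀ ε₁ u = ((ε₀ + 2 * ε₁ ^ 2 * S : ℝ) : ℂ) := by
    rw [denT, hS]; push_cast; ring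
  have hx : x₁ u * x₂ u = (((fa u 0 - fb u 1) ^ 2 + (fa u 1 + fb u 0) ^ 2 : ℝ) : ℂ) := by
    simp only [x₁, x₂]; push_cast
    linear_combination -((fa u 1 : ℂ) + fb u 0) ^ 2 * Complex.I_sq
  have hz : z₁ u * z₂ u = ((fa u 2 ^ 2 + fb u 2 ^ 2 : ℝ) : ℂ) := by
    simp only [z₁, z₂]; push_cast
    linear_combination -(fb u 2 : ℂ) ^ 2 * Complex.I_sq
  have hw : (w₁ u + Complex.I * ε₁ * z₁ u) * (w₂ u - Complex.I * ε₁ * z₂ u) =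
      ((planarSq u / 4 + ε₁ ^ 2 * (fa u 2 ^ 2 + fb u 2 ^ 2)
        - ε₁ * (fb u 2 * mom u 0 - fa u 2 * mom u 1) : ℝ) : ℂ) := by
    have e : (w₁ u + Complex.I * ε₁ * z₁ u) * (w₂ u - Complex.I * ε₁ * z₂ u) =
      w₁ u * w₂ u - Complex.I ^ 2 * ε₁ ^ 2 * (z₁ u * z₂ u)
        + Complex.I * ε₁ * (z₁ u * w₂ u - w₁ u * z₂ u) := by ring
    rw [e, w₁_mul_w₂, hz]
    simp only [z₁, z₂, w₁, w₂]
    push_cast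
    linear_combination (-(ε₁ : ℂ) ^ 2 * ((fa u 2 : ℂ) ^ 2 + (fb u 2 : ℂ) ^ 2)
      + ε₁ * ((fb u 2 : ℂ) * mom u 0 - fa u 2 * mom u 1)) * Complex.I_sq
  rw [intT, hx, hz, hw, hden, hS]
  norm_cast
  have e : ε₀ / S + 2 * ε₁ ^ 2 = (ε₀ + 2 * ε₁ ^ 2 * S) / S := by field_simp
  rw [e]
  -- With the denominator d as an independent variable in place of ε₀, the claim becomes polynomial
  -- after clearing S and d.
  obtain ⟨d, hd⟩ : ∃ d, d = ε₀ + 2 * ε₁ ^ 2 * S := ⟨_, rfl⟩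
  rw [← hd] at hd1 ⊢
  obtain rfl : ε₀ = d - 2 * ε₁ ^ 2 * S := by linear_combination -hd
  simp only [scaledT]
  field_simp
  ring

/-- The integrals in terms of `S` and `T` in the real form. -/
theorem integrals_eq {ε₀ ε₁ lam a b S T p r : ℝ} {u : Phase} (hu : u ∈ phaseSpace a b)
    (hS : Rel ε₀ ε₁ lam S u) (h0 : S ≠ 0) (hd : ε₀ / S + 2 * ε₁ ^ 2 ≠ 0)
    (hT : T = scaledT ε₁ (ε₀ / S) u / (ε₀ / S + 2 * ε₁ ^ 2))
    (hp : p ^ 2 = a ^ 2 + b ^ 2) (hr : r ^ 2 = a ^ 2 - b ^ 2) :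
    hamH ε₀ ε₁ lam u = ε₀ * S + ε₀ / (2 * S) * (p ^ 2 - T) - ε₁ ^ 2 * T + lam ^ 2 / 2 ∧
    intK ε₀ ε₁ lam u =
      (ε₀ + 2 * ε₁ ^ 2 * S) ^ 2 * (r ^ 4 + T * (T + 4 * S ^ 2 - 2 * p ^ 2)) / (4 * S ^ 2) ∧
    intG ε₀ ε₁ lam u = ε₀ * (p ^ 4 - r ^ 4 + 2 * p ^ 2 * S ^ 2) / (4 * S)
      - 1 / 2 * S * (ε₀ + 2 * ε₁ ^ 2 * S) * T := by
  obtain ⟨hA, hB, hX, hY, hZ⟩ := hS.normRel h0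
  obtain ⟨h1, h2, h3⟩ := mem_phaseSpace_iff.1 hu
  obtain ⟨δ, hδ⟩ : ∃ δ, δ = ε₀ / S := ⟨_, rfl⟩
  rw [← hδ] at hd hT hX hY hZ
  obtain rfl : ε₀ = S * δ := by rw [hδ]; field_simp
  have hτ : scaledT ε₁ δ u = (δ + 2 * ε₁ ^ 2) * T := by rw [hT]; field_simp
  have eH := defectH_eq ε₁ lam S δ u
  have eG := defectG_eq ε₁ lam S δ u
  have eK := defect_combination ε₁ lam S δ u
  have eH0 : defectH ε₁ lam S δ u = 0 := by rw [eH, hZ]; ring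
  have eG0 : defectG ε₁ lam S δ u = 0 := by rw [eG, hX, hY, hZ, hA, hB]; ring
  have eK0 : defectK ε₁ lam S δ u = 0 := by
    rw [hX, hY, hA, hB, eH0, eG0] at eK
    linear_combination eK
  simp only [defectH, defectG, defectK, h1, h2, h3, hτ] at eH0 eG0 eK0
  have hr4 : r ^ 4 = (a ^ 2 - b ^ 2) ^ 2 := by rw [← hr]; ring
  have hp4 : p ^ 4 = (a ^ 2 + b ^ 2) ^ 2 := by rw [← hp]; ring
  refine ⟨?_, ?_, ?_⟩
  · rw [hp]
    field_simp
    linear_combination eH0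
  · rw [hp, hr4]
    field_simp
    linear_combination eK0
  · rw [hp, hp4, hr4]
    field_simp
    linear_combination 4 * eG0

theorem dHam_gyroField (ε₀ ε₁ lam : ℝ) (u : Phase) :
    dHam ε₀ ε₁ lam u (gyroField ε₀ ε₁ lam u) = 0 := by
  rw [gyroField_eq]
  simp only [dHam, cross_apply, mom, fa, fb,
    Matrix.cons_val_zero, Matrix.cons_val_one, Matrix.cons_val]
  ring

end GTFG

/-! ### Linear differential inequalities and invariance of closures -/

/-- A solution of a linear differential inequality that vanishes at one time vanishes
identically. -/
theorem eq_zero_of_norm_deriv_le {E : Type*} [NormedAddCommGroup E] [NormedSpace ℝ E]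
    {I : Set ℝ} (hI : I.OrdConnected) {h h' : ℝ → E} {K : ℝ → ℝ} (hK : ContinuousOn K I)
    (hd : ∀ t ∈ I, HasDerivWithinAt h (h' t) I t) (hb : ∀ t ∈ I, ‖h' t‖ ≤ K t * ‖h t‖)
    {t₀ : ℝ} (ht₀ : t₀ ∈ I) (h0 : h t₀ = 0) : ∀ t ∈ I, h t = 0 := by
  have forward : ∀ {J : Set ℝ} {g g' : ℝ → E} {k : ℝ → ℝ} {s s' : ℝ}, s ≤ s' →
      Set.Icc s s' ⊆ J → ContinuousOn k J → (∀ t ∈ J, HasDerivWithinAt g (g' t) J t) →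
      (∀ t ∈ J, ‖g' t‖ ≤ k t * ‖g t‖) → g s = 0 → g s' = 0 := by
    intro J g g' k s s' hs hJ hk hg hgb hg0
    obtain ⟨C, hC⟩ := isCompact_Icc.exists_bound_of_continuousOn (hk.mono hJ)
    refine eq_zero_of_abs_deriv_le_mul_abs_self_of_eq_zero_right (f' := g') (K := C)
      (fun t ht => ((hg t (hJ ht)).continuousWithinAt).mono hJ) ?_ hg0 ?_ s' ⟨hs, le_rfl⟩
    · intro x hx
      have h1 := (hg x (hJ ⟨hx.1, hx.2.le⟩)).mono hJ
      refine h1.mono_of_mem_nhdsWithin ?_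
      exact Filter.mem_of_superset (Icc_mem_nhdsGE hx.2) (Set.Icc_subset_Icc_left hx.1)
    · intro x hx
      have hx' : x ∈ Set.Icc s s' := ⟨hx.1, hx.2.le⟩
      refine (hgb x (hJ hx')).trans ?_
      gcongr
      exact (le_abs_self _).trans (hC x hx')
  intro t ht
  rcases le_total t₀ t with hle | hle
  · exact forward hle (hI.out ht₀ ht) hK hd hb h0
  -- Times before t₀ are reached by reversing time.
  · have hneg : Set.Icc (-t₀) (-t) ⊆ Neg.neg ⁻¹' I := fun x hx =>
      hI.out ht ht₀ ⟨by linarith [hx.2], by linarith [hx.1]⟩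
    have := forward (J := Neg.neg ⁻¹' I) (g := fun x => h (-x)) (g' := fun x => -h' (-x))
      (k := fun x => K (-x)) (neg_le_neg hle) hneg
      (hK.comp continuous_neg.continuousOn (fun _ hx => hx)) ?_ ?_ (by simpa using h0)
    · simpa using this
    · intro x hx
      have := (hd (-x) hx).scomp x (hasDerivAt_neg x).hasDerivWithinAt (Set.mapsTo_preimage _ _)
      rw [neg_one_smul] at this
      exact this
    · intro x hx
      simpa using hb (-x) hx

/-- A solution of a homogeneous linear system that vanishes at one time vanishes identically. -/
theorem eq_zero_of_linear_system {n : ℕ} {I : Set ℝ} (hI : I.OrdConnected)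
    {h : ℝ → Fin n → ℝ} {A : ℝ → Matrix (Fin n) (Fin n) ℝ}
    (hA : ContinuousOn A I)
    (hd : ∀ t ∈ I, ∀ i, HasDerivWithinAt (fun s => h s i) ((A t *ᵥ h t) i) I t)
    {t₀ : ℝ} (ht₀ : t₀ ∈ I) (h0 : h t₀ = 0) : ∀ t ∈ I, h t = 0 := by
  have hent : ∀ i j, ContinuousOn (fun t => A t i j) I := fun i j =>
    (continuous_apply_apply i j).comp_continuousOn hA
  refine eq_zero_of_norm_deriv_le hI (h' := fun t => A t *ᵥ h t)
    (K := fun t => ∑ i, ∑ j, |A t i j|) ?_ (fun t ht => hasDerivWithinAt_pi.2 (hd t ht)) ?_ ht₀ h0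
  · exact continuousOn_finsetSum _ fun i _ => continuousOn_finsetSum _ fun j _ =>
      (hent i j).abs
  · intro t _
    refine (pi_norm_le_iff_of_nonneg (by positivity)).2 fun i => ?_
    calc ‖(A t *ᵥ h t) i‖ ≤ ∑ j, ‖A t i j * h t j‖ := by
          simpa only [Matrix.mulVec, dotProduct] using norm_sum_le _ _
      _ ≤ ∑ j, |A t i j| * ‖h t‖ := by
          refine Finset.sum_le_sum fun j _ => ?_
          rw [norm_mul]
          exact mul_le_mul_of_nonneg_left (norm_le_pi_norm _ _) (norm_nonneg _)
      _ = (∑ j, |A t i j|) * ‖h t‖ := by rw [Finset.sum_mul]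
      _ ≤ _ := by
          refine mul_le_mul_of_nonneg_right ?_ (norm_nonneg _)
          exact Finset.single_le_sum (f := fun i => ∑ j, |A t i j|)
            (fun i _ => by positivity) (Finset.mem_univ i)

theorem eq_of_deriv_eq_zero {I : Set ℝ} (hI : I.OrdConnected) {h : ℝ → ℝ}
    (hd : ∀ t ∈ I, HasDerivWithinAt h 0 I t) {t₀ t : ℝ} (ht₀ : t₀ ∈ I) (ht : t ∈ I) :
    h t = h t₀ := by
  have := eq_zero_of_norm_deriv_le hI (h := fun s => h s - h t₀) (h' := fun _ => 0)
    (K := fun _ => 0) continuousOn_const (fun s hs => (hd s hs).sub_const _) (by simp) ht₀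
    (sub_self _) t ht
  linarith

theorem IsTrajectoryOn.mono {E : Type*} [NormedAddCommGroup E] [NormedSpace ℝ E]
    {X : E → E} {I J : Set ℝ} {γ : ℝ → E} (h : IsTrajectoryOn X I γ) (hJ : J ⊆ I) :
    IsTrajectoryOn X J γ := fun t ht => (h t (hJ ht)).mono hJ

theorem IsTrajectoryOn.continuousOn {E : Type*} [NormedAddCommGroup E] [NormedSpace ℝ E]
    {X : E → E} {I : Set ℝ} {γ : ℝ → E} (h : IsTrajectoryOn X I γ) : ContinuousOn γ I :=
  fun t ht => (h t ht).continuousWithinAt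

/-- Uniqueness of trajectories of a continuously differentiable field. -/
theorem IsTrajectoryOn.eq_of_compact {E : Type*} [NormedAddCommGroup E] [NormedSpace ℝ E]
    [FiniteDimensional ℝ E] {X : E → E} (hX : ContDiff ℝ 1 X) {I : Set ℝ} (hI : I.OrdConnected)
    (hc : IsCompact I) {γ γ' : ℝ → E} (h : IsTrajectoryOn X I γ) (h' : IsTrajectoryOn X I γ')
    {t₀ : ℝ} (ht₀ : t₀ ∈ I) (h0 : γ t₀ = γ' t₀) : ∀ t ∈ I, γ t = γ' t := by
  have : ProperSpace E := FiniteDimensional.proper ℝ E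
  obtain ⟨R, hR⟩ := hc.exists_bound_of_continuousOn h.continuousOn
  obtain ⟨R', hR'⟩ := hc.exists_bound_of_continuousOn h'.continuousOn
  set B := Metric.closedBall (0 : E) (max R R')
  obtain ⟨C, hC⟩ := (isCompact_closedBall (0 : E) (max R R')).exists_bound_of_continuousOn
    ((hX.continuous_fderiv (by simp)).continuousOn)
  have hlip : ∀ x ∈ B, ∀ y ∈ B, ‖X x - X y‖ ≤ C * ‖x - y‖ := fun x hx y hy =>
    (convex_closedBall (0 : E) (max R R')).norm_image_sub_le_of_norm_fderiv_le
      (fun z _ => hX.differentiable (by simp) z) hC hy hx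
  intro t ht
  have := eq_zero_of_norm_deriv_le hI (h := fun s => γ s - γ' s)
    (h' := fun s => X (γ s) - X (γ' s)) (K := fun _ => C) continuousOn_const
    (fun s hs => (h s hs).sub (h' s hs)) (fun s hs => hlip _ ?_ _ ?_) ht₀ (sub_eq_zero.2 h0) t ht
  · exact sub_eq_zero.1 this
  · exact mem_closedBall_zero_iff.2 ((hR s hs).trans (le_max_left _ _))
  · exact mem_closedBall_zero_iff.2 ((hR' s hs).trans (le_max_right _ _))

/-- If trajectories that start in `N` stay in the closure of `N`, then the closure is invariant. -/
theorem isInvariantSet_closure {E : Type*} [NormedAddCommGroup E] [NormedSpace ℝ E]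
    [FiniteDimensional ℝ E] {X : E → E} (hX : ContDiff ℝ 1 X) {N : Set E}
    (hN : ∀ (I : Set ℝ) (γ : ℝ → E), I.OrdConnected → IsTrajectoryOn X I γ →
      ∀ t₀ ∈ I, γ t₀ ∈ N → ∀ t ∈ I, γ t ∈ closure N) :
    IsInvariantSet X (closure N) := by
  have : CompleteSpace E := FiniteDimensional.complete ℝ E
  intro I γ hI hγ t₀ ht₀ h0 t ht
  set J := Set.uIcc t₀ t with hJ
  have hJI : J ⊆ I := hI.uIcc_subset ht₀ ht
  have hγJ := hγ.mono hJI
  -- The times spent in the closure form a clopen subset of a connected interval. Openness uses the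
  -- local flow, which depends continuously on the initial point.
  have hclopen : IsClopen {s : J | γ s ∈ closure N} := by
    refine ⟨isClosed_closure.preimage (continuousOn_iff_continuous_domRestrict.1 hγJ.continuousOn),
      isOpen_iff_mem_nhds.2 ?_⟩
    rintro ⟨s, hs⟩ hsN
    obtain ⟨ε, hε, a, r, L, K, hr, hpl⟩ :=
      IsPicardLindelof.of_contDiffAt_one (hX.contDiffAt (x := γ s))
    obtain ⟨Φ, hΦ, L', hL'⟩ :=
      (hpl s).exists_forall_mem_closedBall_eq_hasDerivWithinAt_lipschitzOnWith
    have hmem : γ s ∈ Metric.closedBall (γ s) r := Metric.mem_closedBall_self r.2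
    have hnear : ∀ s' ∈ J ∩ Set.Icc (s - ε) (s + ε), γ s' ∈ closure N := by
      intro s' hs'
      have heq : γ s' = Φ (γ s) s' := by
        refine IsTrajectoryOn.eq_of_compact hX (I := J ∩ Set.Icc (s - ε) (s + ε))
          (Set.ordConnected_uIcc.inter Set.ordConnected_Icc)
          (isCompact_uIcc.inter isCompact_Icc)
          (hγJ.mono Set.inter_subset_left) ?_ (t₀ := s)
          ⟨hs, by linarith, by linarith⟩ (hΦ _ hmem).1.symm s' hs'
        exact fun x hx => ((hΦ _ hmem).2 x hx.2).mono Set.inter_subset_right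
      obtain ⟨v, hv, hvt⟩ := mem_closure_iff_seq_limit.1 hsN
      have hball : ∀ᶠ n in Filter.atTop, v n ∈ Metric.closedBall (γ s) r :=
        hvt.eventually (Metric.closedBall_mem_nhds _ hr)
      -- Trajectories through points of N converging to γ s converge to γ at nearby times, and each
      -- of them stays in the closure.
      have hlim : Filter.Tendsto (fun n => Φ (v n) s') Filter.atTop (nhds (Φ (γ s) s')) := by
        have hcont := ((hL' s' hs'.2).continuousOn (γ s) hmem)
        exact hcont.tendsto.comp (tendsto_nhdsWithin_iff.2 ⟨hvt, hball⟩)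
      rw [heq]
      refine isClosed_closure.mem_of_tendsto hlim (hball.mono fun n hn => ?_)
      exact hN (Set.Icc (s - ε) (s + ε)) (Φ (v n)) Set.ordConnected_Icc (hΦ _ hn).2 s
        ⟨by linarith, by linarith⟩ (by rw [(hΦ _ hn).1]; exact hv n) s' hs'.2
    have : Subtype.val ⁻¹' Set.Icc (s - ε) (s + ε) ∈ nhds (⟨s, hs⟩ : J) :=
      continuous_subtype_val.continuousAt (Icc_mem_nhds (by simpa using hε) (by simpa using hε))
    exact Filter.mem_of_superset this fun q hq => hnear q ⟨q.2, hq⟩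
  have : PreconnectedSpace J := Subtype.preconnectedSpace isPreconnected_uIcc
  have huniv := hclopen.eq_univ ⟨⟨t₀, Set.left_mem_uIcc⟩, h0⟩
  have : (⟨t, Set.right_mem_uIcc⟩ : J) ∈ {s : J | γ s ∈ closure N} := by
    rw [huniv]; trivial
  exact this

namespace GTFG

/-! ### The relations along trajectories -/

section Curves

variable {γ : ℝ → Phase} {v : Phase} {I : Set ℝ} {t : ℝ}

theorem hasDerivWithinAt_relA (S : ℝ) (h : HasDerivWithinAt γ v I t) :
    HasDerivWithinAt (fun s => relA S (γ s))
      (mom v 0 * fa (γ t) 0 + mom v 1 * fa (γ t) 1 + mom v 2 * fa (γ t) 2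
      + (mom (γ t) 0 * fa v 0 + mom (γ t) 1 * fa v 1 + mom (γ t) 2 * fa v 2)
      + S * mom v 0) I t :=
  (hasDerivWithinAt_momA h).add ((hasDerivWithinAt_mom h 0).const_mul S)

theorem hasDerivWithinAt_relB (S : ℝ) (h : HasDerivWithinAt γ v I t) :
    HasDerivWithinAt (fun s => relB S (γ s))
      (mom v 0 * fb (γ t) 0 + mom v 1 * fb (γ t) 1 + mom v 2 * fb (γ t) 2
      + (mom (γ t) 0 * fb v 0 + mom (γ t) 1 * fb v 1 + mom (γ t) 2 * fb v 2)
      + S * mom v 1) I t :=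
  (hasDerivWithinAt_momB h).add ((hasDerivWithinAt_mom h 1).const_mul S)

theorem hasDerivWithinAt_crossX (S : ℝ) (h : HasDerivWithinAt γ v I t) :
    HasDerivWithinAt (fun s => crossX S (γ s))
      (fa v 1 * fb (γ t) 2 + fa (γ t) 1 * fb v 2 - (fa v 2 * fb (γ t) 1 + fa (γ t) 2 * fb v 1)
        - S * fa v 2) I t := by
  have a := hasDerivWithinAt_fa h
  have b := hasDerivWithinAt_fb h
  exact (((a 1).mul (b 2)).sub ((a 2).mul (b 1))).sub ((a 2).const_mul S)

theorem hasDerivWithinAt_crossY (S : ℝ) (h : HasDerivWithinAt γ v I t) :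
    HasDerivWithinAt (fun s => crossY S (γ s))
      (fa v 2 * fb (γ t) 0 + fa (γ t) 2 * fb v 0 - (fa v 0 * fb (γ t) 2 + fa (γ t) 0 * fb v 2)
        - S * fb v 2) I t := by
  have a := hasDerivWithinAt_fa h
  have b := hasDerivWithinAt_fb h
  exact (((a 2).mul (b 0)).sub ((a 0).mul (b 2))).sub ((b 2).const_mul S)

theorem hasDerivWithinAt_crossZ (S : ℝ) (h : HasDerivWithinAt γ v I t) :
    HasDerivWithinAt (fun s => crossZ S (γ s))
      (fa v 0 * fb (γ t) 1 + fa (γ t) 0 * fb v 1 - (fa v 1 * fb (γ t) 0 + fa (γ t) 1 * fb v 0)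
        + S * (fa v 0 + fb v 1)) I t := by
  have a := hasDerivWithinAt_fa h
  have b := hasDerivWithinAt_fb h
  exact ((((a 0).mul (b 1)).sub ((a 1).mul (b 0))).add
    (((a 0).add (b 1)).const_mul S)).add_const (S ^ 2)

theorem hasDerivWithinAt_redMom (ε₁ lam : ℝ) (h : HasDerivWithinAt γ v I t) :
    HasDerivWithinAt (fun s => redMom ε₁ lam (γ s))
      (mom v 2 / 2 - ε₁ * (fa v 1 - fb v 0)) I t := by
  have m := hasDerivWithinAt_mom h
  have a := hasDerivWithinAt_fa h
  have b := hasDerivWithinAt_fb h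
  exact (((m 2).div_const 2).sub_const lam).sub (((a 1).sub (b 0)).const_mul ε₁)

theorem hasDerivWithinAt_relX (ε₁ lam c s S : ℝ) (h : HasDerivWithinAt γ v I t) :
    HasDerivWithinAt (fun q => relX ε₁ lam c s S (γ q))
      (c * (fa v 1 * fb (γ t) 2 + fa (γ t) 1 * fb v 2 - (fa v 2 * fb (γ t) 1 + fa (γ t) 2 * fb v 1)
        - S * fa v 2) - (s * (mom v 2 / 2 - ε₁ * (fa v 1 - fb v 0)) * mom (γ t) 0
        + s * redMom ε₁ lam (γ t) * mom v 0)) I t :=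
  ((hasDerivWithinAt_crossX S h).const_mul c).sub
    (((hasDerivWithinAt_redMom ε₁ lam h).const_mul s).mul (hasDerivWithinAt_mom h 0))

theorem hasDerivWithinAt_relY (ε₁ lam c s S : ℝ) (h : HasDerivWithinAt γ v I t) :
    HasDerivWithinAt (fun q => relY ε₁ lam c s S (γ q))
      (c * (fa v 2 * fb (γ t) 0 + fa (γ t) 2 * fb v 0 - (fa v 0 * fb (γ t) 2 + fa (γ t) 0 * fb v 2)
        - S * fb v 2) - (s * (mom v 2 / 2 - ε₁ * (fa v 1 - fb v 0)) * mom (γ t) 1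
        + s * redMom ε₁ lam (γ t) * mom v 1)) I t :=
  ((hasDerivWithinAt_crossY S h).const_mul c).sub
    (((hasDerivWithinAt_redMom ε₁ lam h).const_mul s).mul (hasDerivWithinAt_mom h 1))

theorem hasDerivWithinAt_relZ (ε₁ lam c s S : ℝ) (h : HasDerivWithinAt γ v I t) :
    HasDerivWithinAt (fun q => relZ ε₁ lam c s S (γ q))
      (c * (fa v 0 * fb (γ t) 1 + fa (γ t) 0 * fb v 1 - (fa v 1 * fb (γ t) 0 + fa (γ t) 1 * fb v 0)
        + S * (fa v 0 + fb v 1)) - (s * (mom v 2 / 2 - ε₁ * (fa v 1 - fb v 0)) * mom (γ t) 2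
        + s * redMom ε₁ lam (γ t) * mom v 2)) I t :=
  ((hasDerivWithinAt_crossZ S h).const_mul c).sub
    (((hasDerivWithinAt_redMom ε₁ lam h).const_mul s).mul (hasDerivWithinAt_mom h 2))

theorem hasDerivWithinAt_sqA (h : HasDerivWithinAt γ v I t) :
    HasDerivWithinAt (fun s => sqA (γ s))
      (2 * fa (γ t) 0 * fa v 0 + 2 * fa (γ t) 1 * fa v 1 + 2 * fa (γ t) 2 * fa v 2) I t := by
  have a := hasDerivWithinAt_fa h
  exact ((((a 0).pow 2).add ((a 1).pow 2)).add ((a 2).pow 2)).congr_deriv (by norm_num)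

theorem hasDerivWithinAt_sqB (h : HasDerivWithinAt γ v I t) :
    HasDerivWithinAt (fun s => sqB (γ s))
      (2 * fb (γ t) 0 * fb v 0 + 2 * fb (γ t) 1 * fb v 1 + 2 * fb (γ t) 2 * fb v 2) I t := by
  have b := hasDerivWithinAt_fb h
  exact ((((b 0).pow 2).add ((b 1).pow 2)).add ((b 2).pow 2)).congr_deriv (by norm_num)

theorem hasDerivWithinAt_dotAB (h : HasDerivWithinAt γ v I t) :
    HasDerivWithinAt (fun s => dotAB (γ s))
      (fa v 0 * fb (γ t) 0 + fa (γ t) 0 * fb v 0 + (fa v 1 * fb (γ t) 1 + fa (γ t) 1 * fb v 1)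
        + (fa v 2 * fb (γ t) 2 + fa (γ t) 2 * fb v 2)) I t := by
  have a := hasDerivWithinAt_fa h
  have b := hasDerivWithinAt_fb h
  exact (((a 0).mul (b 0)).add ((a 1).mul (b 1))).add ((a 2).mul (b 2))

end Curves

/-- The matrix of the linear system satisfied by the relations along trajectories. -/
def relMatrix (ε₀ ε₁ lam S : ℝ) (u : Phase) : Matrix (Fin 5) (Fin 5) ℝ :=
  let o₀ := mom u 0 / 2 - ε₁ * fb u 2
  let o₁ := mom u 1 / 2 + ε₁ * fa u 2
  let o₂ := mom u 2 - lam - ε₁ * (fa u 1 - fb u 0)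
  !![-ε₁ * fb u 1, ε₁ * fa u 1, 0, -1, 0;
    ε₁ * fb u 0, -ε₁ * fa u 0, 1, 0, 0;
    -S * ε₁ * redMom ε₁ lam u, S * ε₀ / 2, -S * ε₁, o₂, -o₁;
    -(S * ε₀ / 2), -S * ε₁ * redMom ε₁ lam u, -o₂, -S * ε₁, o₀;
    0, 0, o₁, -o₀, 0]

theorem continuous_relMatrix (ε₀ ε₁ lam S : ℝ) : Continuous (relMatrix ε₀ ε₁ lam S) := by
  refine continuous_pi fun i => continuous_pi fun j => ?_
  fin_cases i <;> fin_cases j <;> simp [relMatrix, redMom, mom, fa, fb] <;> fun_prop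

/-- The matrix of the linear system for `(M₁, M₂, α₃, β₃)`. -/
def axisMatrix (ε₀ ε₁ lam : ℝ) (u : Phase) : Matrix (Fin 4) (Fin 4) ℝ :=
  !![-ε₁ * fb u 1, mom u 2 / 2 - lam + ε₁ * fb u 0, 0, ε₀;
    lam - mom u 2 / 2 + ε₁ * fa u 1, -ε₁ * fa u 0, -ε₀, 0;
    -fa u 1 / 2, fa u 0 / 2, ε₁ * fa u 0, ε₁ * fa u 1;
    -fb u 1 / 2, fb u 0 / 2, ε₁ * fb u 0, ε₁ * fb u 1]

theorem continuous_axisMatrix (ε₀ ε₁ lam : ℝ) : Continuous (axisMatrix ε₀ ε₁ lam) := by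
  refine continuous_pi fun i => continuous_pi fun j => ?_
  fin_cases i <;> fin_cases j <;> simp [axisMatrix, mom, fa, fb] <;> fun_prop

/-- The matrix of the linear system for `(M₁, M₂)` at `ε₀ = 0`. -/
def planarMatrix (ε₁ lam : ℝ) (u : Phase) : Matrix (Fin 2) (Fin 2) ℝ :=
  !![-ε₁ * fb u 1, mom u 2 / 2 - lam + ε₁ * fb u 0;
    lam - mom u 2 / 2 + ε₁ * fa u 1, -ε₁ * fa u 0]

theorem continuous_planarMatrix (ε₁ lam : ℝ) : Continuous (planarMatrix ε₁ lam) := by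
  refine continuous_pi fun i => continuous_pi fun j => ?_
  fin_cases i <;> fin_cases j <;> simp [planarMatrix, mom, fa, fb] <;> fun_prop

section Flow

variable {ε₀ ε₁ lam : ℝ} {γ : ℝ → Phase} {I : Set ℝ}

/-- With S frozen, the derivatives of the five relations are combinations of the relations
themselves, with coefficients continuous in time. Uniqueness for homogeneous linear systems does the
rest. -/
theorem rel_of_trajectory (hI : I.OrdConnected)
    (h : IsTrajectoryOn (gyroField ε₀ ε₁ lam) I γ) {S t₀ : ℝ} (ht₀ : t₀ ∈ I)
    (h0 : Rel ε₀ ε₁ lam S (γ t₀)) : ∀ t ∈ I, Rel ε₀ ε₁ lam S (γ t) := by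
  have key := eq_zero_of_linear_system hI
    (h := fun s => ![relA S (γ s), relB S (γ s), relX ε₁ lam ε₀ S S (γ s),
      relY ε₁ lam ε₀ S S (γ s), relZ ε₁ lam ε₀ S S (γ s)])
    (A := fun s => relMatrix ε₀ ε₁ lam S (γ s))
    ((continuous_relMatrix ε₀ ε₁ lam S).comp_continuousOn h.continuousOn) ?_ ht₀ ?_
  · intro t ht
    have := key t ht
    exact ⟨congrFun this 0, congrFun this 1, congrFun this 2, congrFun this 3, congrFun this 4⟩
  · intro t ht i
    have hγ := h t ht
    fin_cases i
    · refine (hasDerivWithinAt_relA S hγ).congr_deriv ?_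
      rw [gyroField_eq]
      simp [relMatrix, Matrix.mulVec, dotProduct, Fin.sum_univ_succ, relA, relB, relX, relY, relZ,
        crossX, crossY, crossZ, redMom, cross_apply]
      ring
    · refine (hasDerivWithinAt_relB S hγ).congr_deriv ?_
      rw [gyroField_eq]
      simp [relMatrix, Matrix.mulVec, dotProduct, Fin.sum_univ_succ, relA, relB, relX, relY, relZ,
        crossX, crossY, crossZ, redMom, cross_apply]
      ring
    · refine (hasDerivWithinAt_relX ε₁ lam ε₀ S S hγ).congr_deriv ?_
      rw [gyroField_eq]
      simp [relMatrix, Matrix.mulVec, dotProduct, Fin.sum_univ_succ, relA, relB, relX, relY, relZ,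
        crossX, crossY, crossZ, redMom, cross_apply]
      ring
    · refine (hasDerivWithinAt_relY ε₁ lam ε₀ S S hγ).congr_deriv ?_
      rw [gyroField_eq]
      simp [relMatrix, Matrix.mulVec, dotProduct, Fin.sum_univ_succ, relA, relB, relX, relY, relZ,
        crossX, crossY, crossZ, redMom, cross_apply]
      ring
    · refine (hasDerivWithinAt_relZ ε₁ lam ε₀ S S hγ).congr_deriv ?_
      rw [gyroField_eq]
      simp [relMatrix, Matrix.mulVec, dotProduct, Fin.sum_univ_succ, relA, relB, relX, relY, relZ,
        crossX, crossY, crossZ, redMom, cross_apply]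
      ring
  · obtain ⟨ha, hb, hx, hy, hz⟩ := h0
    ext i
    fin_cases i <;> simp [ha, hb, hx, hy, hz]

theorem mem_phaseSpace_of_trajectory (hI : I.OrdConnected)
    (h : IsTrajectoryOn (gyroField ε₀ ε₁ lam) I γ) {a b t₀ : ℝ} (ht₀ : t₀ ∈ I)
    (h0 : γ t₀ ∈ phaseSpace a b) : ∀ t ∈ I, γ t ∈ phaseSpace a b := by
  intro t ht
  rw [mem_phaseSpace_iff] at h0 ⊢
  refine ⟨?_, ?_, ?_⟩
  · rw [← h0.1]
    refine eq_of_deriv_eq_zero hI (fun s hs => (hasDerivWithinAt_sqA (h s hs)).congr_deriv ?_)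
      ht₀ ht
    rw [gyroField_eq]
    simp [cross_apply]
    ring
  · rw [← h0.2.1]
    refine eq_of_deriv_eq_zero hI (fun s hs => (hasDerivWithinAt_sqB (h s hs)).congr_deriv ?_)
      ht₀ ht
    rw [gyroField_eq]
    simp [cross_apply]
    ring
  · rw [← h0.2.2]
    refine eq_of_deriv_eq_zero hI (fun s hs => (hasDerivWithinAt_dotAB (h s hs)).congr_deriv ?_)
      ht₀ ht
    rw [gyroField_eq]
    simp [cross_apply]
    ring

theorem hamH_const_of_trajectory (hI : I.OrdConnected)
    (h : IsTrajectoryOn (gyroField ε₀ ε₁ lam) I γ) {t₀ t : ℝ} (ht₀ : t₀ ∈ I) (ht : t ∈ I) :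
    hamH ε₀ ε₁ lam (γ t) = hamH ε₀ ε₁ lam (γ t₀) :=
  eq_of_deriv_eq_zero hI (fun s hs => (hasDerivWithinAt_hamH ε₀ ε₁ lam (h s hs)).congr_deriv
    (dHam_gyroField ε₀ ε₁ lam (γ s))) ht₀ ht

/-- The right-hand sides for M₁, M₂, α₃, β₃ are linear and homogeneous in these four quantities, so
their common zero set is invariant. -/
theorem axis_of_trajectory (hI : I.OrdConnected)
    (h : IsTrajectoryOn (gyroField ε₀ ε₁ lam) I γ) {t₀ : ℝ} (ht₀ : t₀ ∈ I)
    (h0 : mom (γ t₀) 0 = 0) (h1 : mom (γ t₀) 1 = 0) (h2 : fa (γ t₀) 2 = 0)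
    (h3 : fb (γ t₀) 2 = 0) : ∀ t ∈ I, mom (γ t) 0 = 0 ∧ mom (γ t) 1 = 0 := by
  have key := eq_zero_of_linear_system hI
    (h := fun s => ![mom (γ s) 0, mom (γ s) 1, fa (γ s) 2, fb (γ s) 2])
    (A := fun s => axisMatrix ε₀ ε₁ lam (γ s))
    ((continuous_axisMatrix ε₀ ε₁ lam).comp_continuousOn h.continuousOn) ?_ ht₀ ?_
  · exact fun t ht => ⟨congrFun (key t ht) 0, congrFun (key t ht) 1⟩
  · intro t ht i
    have hγ := h t ht
    fin_cases i
    · refine (hasDerivWithinAt_mom hγ 0).congr_deriv ?_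
      rw [gyroField_eq]
      simp [axisMatrix, Matrix.mulVec, dotProduct, Fin.sum_univ_succ]
      ring
    · refine (hasDerivWithinAt_mom hγ 1).congr_deriv ?_
      rw [gyroField_eq]
      simp [axisMatrix, Matrix.mulVec, dotProduct, Fin.sum_univ_succ]
      ring
    · refine (hasDerivWithinAt_fa hγ 2).congr_deriv ?_
      rw [gyroField_eq]
      simp [axisMatrix, Matrix.mulVec, dotProduct, Fin.sum_univ_succ, cross_apply]
      ring
    · refine (hasDerivWithinAt_fb hγ 2).congr_deriv ?_
      rw [gyroField_eq]
      simp [axisMatrix, Matrix.mulVec, dotProduct, Fin.sum_univ_succ, cross_apply]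
      ring
  · ext i
    fin_cases i <;> simp [h0, h1, h2, h3]

/-- Without the ε₀ torque the equations for M₁ and M₂ alone are linear and homogeneous. -/
theorem planar_of_trajectory (hI : I.OrdConnected)
    (h : IsTrajectoryOn (gyroField 0 ε₁ lam) I γ) {t₀ : ℝ} (ht₀ : t₀ ∈ I)
    (h0 : mom (γ t₀) 0 = 0) (h1 : mom (γ t₀) 1 = 0) :
    ∀ t ∈ I, mom (γ t) 0 = 0 ∧ mom (γ t) 1 = 0 := by
  have key := eq_zero_of_linear_system hI
    (h := fun s => ![mom (γ s) 0, mom (γ s) 1])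
    (A := fun s => planarMatrix ε₁ lam (γ s))
    ((continuous_planarMatrix ε₁ lam).comp_continuousOn h.continuousOn) ?_ ht₀ ?_
  · exact fun t ht => ⟨congrFun (key t ht) 0, congrFun (key t ht) 1⟩
  · intro t ht i
    have hγ := h t ht
    fin_cases i
    · refine (hasDerivWithinAt_mom hγ 0).congr_deriv ?_
      rw [gyroField_eq]
      simp [planarMatrix, Matrix.mulVec, dotProduct, Fin.sum_univ_succ]
      ring
    · refine (hasDerivWithinAt_mom hγ 1).congr_deriv ?_
      rw [gyroField_eq]
      simp [planarMatrix, Matrix.mulVec, dotProduct, Fin.sum_univ_succ]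
      ring
  · ext i
    fin_cases i <;> simp [h0, h1]

end Flow


/-! ### Invariance and partial integrals -/

section Flow

variable {ε₀ ε₁ lam a b : ℝ} {γ : ℝ → Phase} {I : Set ℝ}

theorem planarSq_eq_zero_iff (u : Phase) : planarSq u = 0 ↔ mom u 0 = 0 ∧ mom u 1 = 0 := by
  simp only [planarSq]
  constructor
  · intro h
    constructor <;> nlinarith [sq_nonneg (mom u 0), sq_nonneg (mom u 1)]
  · rintro ⟨h0, h1⟩
    rw [h0, h1]; ring

theorem mem_closure_diff_singleton (hI : I.OrdConnected) {t₀ t : ℝ} (ht₀ : t₀ ∈ I) (ht : t ∈ I)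
    (hne : t ≠ t₀) : t ∈ closure (I \ {t}) := by
  rcases lt_or_gt_of_ne hne with h | h
  · refine closure_mono (s := Set.Ioo t t₀) (t := I \ {t}) (fun s hs =>
      ⟨hI.out ht ht₀ ⟨hs.1.le, hs.2.le⟩, hs.1.ne'⟩) ?_
    rw [closure_Ioo h.ne]
    exact ⟨le_rfl, h.le⟩
  · refine closure_mono (s := Set.Ioo t₀ t) (t := I \ {t}) (fun s hs =>
      ⟨hI.out ht₀ ht ⟨hs.1.le, hs.2.le⟩, hs.2.ne⟩) ?_
    rw [closure_Ioo h.ne]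
    exact ⟨h.le, le_rfl⟩

/-- The relations and the Casimir values persist, so only times with M₁ = M₂ = 0 need care. Such
times are isolated, hence the trajectory is there a limit of its own points in the relation set. -/
theorem trajectory_mem_setM₃ (hI : I.OrdConnected)
    (h : IsTrajectoryOn (gyroField ε₀ ε₁ lam) I γ) {t₀ : ℝ} (ht₀ : t₀ ∈ I)
    (h0 : γ t₀ ∈ relationSet ε₀ ε₁ lam a b) : ∀ t ∈ I, γ t ∈ setM₃ ε₀ ε₁ lam a b := by
  obtain ⟨hp, hW, S, hS⟩ := mem_relationSet_iff.1 h0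
  have hmem : ∀ t ∈ I, planarSq (γ t) ≠ 0 → γ t ∈ relationSet ε₀ ε₁ lam a b := fun t ht hWt =>
    mem_relationSet_iff.2 ⟨mem_phaseSpace_of_trajectory hI h ht₀ hp t ht, hWt, S,
      rel_of_trajectory hI h ht₀ hS t ht⟩
  intro t ht
  by_cases hWt : planarSq (γ t) = 0
  · obtain ⟨hm0, hm1⟩ := (planarSq_eq_zero_iff _).1 hWt
    have hne : t ≠ t₀ := by rintro rfl; exact hW hWt
    have hnb := mem_closure_iff_nhdsWithin_neBot.1 (mem_closure_diff_singleton hI ht₀ ht hne)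
    have hev : ∀ᶠ s in nhdsWithin t (I \ {t}), planarSq (γ s) ≠ 0 := by
      have hX := gyroField_eq ε₀ ε₁ lam (γ t)
      -- At M₁ = M₂ = 0 the velocities of M₁, M₂ are ε₀ β₃ and -ε₀ α₃. If one is non-zero, the zero
      -- is isolated; if both vanish, M₁ and M₂ vanish at all times, contrary to the situation at
      -- t₀.
      by_cases hd0 : mom (gyroField ε₀ ε₁ lam (γ t)) 0 = 0
      · by_cases hd1 : mom (gyroField ε₀ ε₁ lam (γ t)) 1 = 0
        · exfalso
          rw [hX] at hd0 hd1
          simp only [mom_mk, Matrix.cons_val_zero, Matrix.cons_val_one, hm0, hm1] at hd0 hd1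
          by_cases hε : ε₀ = 0
          · subst hε
            exact hW ((planarSq_eq_zero_iff _).2 (planar_of_trajectory hI h ht hm0 hm1 t₀ ht₀))
          · refine hW ((planarSq_eq_zero_iff _).2
              (axis_of_trajectory hI h ht hm0 hm1 ?_ ?_ t₀ ht₀))
            · have : ε₀ * fa (γ t) 2 = 0 := by linear_combination -hd1
              exact (mul_eq_zero.1 this).resolve_left hε
            · have : ε₀ * fb (γ t) 2 = 0 := by linear_combination hd0
              exact (mul_eq_zero.1 this).resolve_left hε
        · filter_upwards [(hasDerivWithinAt_mom (h t ht) 1).eventually_ne (c := 0) hd1] with s hs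
          exact fun hc => hs ((planarSq_eq_zero_iff _).1 hc).2
      · filter_upwards [(hasDerivWithinAt_mom (h t ht) 0).eventually_ne (c := 0) hd0] with s hs
        exact fun hc => hs ((planarSq_eq_zero_iff _).1 hc).1
    have hcont : ContinuousWithinAt γ (I \ {t}) t :=
      (h t ht).continuousWithinAt.mono Set.sdiff_subset
    refine mem_closure_of_tendsto hcont.tendsto ?_
    filter_upwards [hev, self_mem_nhdsWithin] with s hs hsI
    exact hmem s hsI.1 hs
  · exact subset_closure (hmem t ht hWt)

theorem contDiff_gyroField (ε₀ ε₁ lam : ℝ) : ContDiff ℝ 1 (gyroField ε₀ ε₁ lam) := by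
  have : gyroField ε₀ ε₁ lam = fun u => gyroField ε₀ ε₁ lam u := rfl
  rw [this]
  simp only [gyroField_eq, cross_apply, Matrix.cons_val_zero, Matrix.cons_val_one, Matrix.cons_val]
  refine ContDiff.prodMk ?_ (ContDiff.prodMk ?_ ?_) <;> refine contDiff_pi.2 fun i => ?_ <;>
    fin_cases i <;> simp [mom, fa, fb] <;> fun_prop

theorem isInvariantSet_setM₃ (ε₀ ε₁ lam a b : ℝ) :
    IsInvariantSet (gyroField ε₀ ε₁ lam) (setM₃ ε₀ ε₁ lam a b) :=
  isInvariantSet_closure (contDiff_gyroField ε₀ ε₁ lam) fun _ _ hI h _ ht₀ h0 =>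
    trajectory_mem_setM₃ hI h ht₀ h0

/-- The same number S serves the whole trajectory. For fixed S, T is an affine function of H and the
Casimir functions, all of which are conserved. -/
theorem partial_integrals_const (ha : a ≠ 0) (hb : b ≠ 0) (hI : I.OrdConnected)
    (h : IsTrajectoryOn (gyroField ε₀ ε₁ lam) I γ) {t₁ t₂ : ℝ} (ht₁ : t₁ ∈ I) (ht₂ : t₂ ∈ I)
    (h1 : γ t₁ ∈ setM₃ ε₀ ε₁ lam a b) (hw1 : w₁ (γ t₁) * w₂ (γ t₁) ≠ 0)
    (hw2 : w₁ (γ t₂) * w₂ (γ t₂) ≠ 0) :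
    intS (γ t₁) = intS (γ t₂) ∧
      (denT ε₀ ε₁ (γ t₁) ≠ 0 → intT ε₀ ε₁ (γ t₁) = intT ε₀ ε₁ (γ t₂)) := by
  rw [w₁_mul_w₂_ne_zero_iff] at hw1 hw2
  obtain ⟨hp, -, S, hS⟩ := mem_relationSet_iff.1 (mem_relationSet_of_mem_setM₃ h1 hw1)
  have hS2 := rel_of_trajectory hI h ht₁ hS t₂ ht₂
  have hp2 := mem_phaseSpace_of_trajectory hI h ht₁ hp t₂ ht₂
  have e1 := intS_eq_of_rel hw1 hS.a hS.b
  have e2 := intS_eq_of_rel hw2 hS2.a hS2.b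
  refine ⟨by rw [e1, e2], fun hd => ?_⟩
  -- S = 0 forces ε₀ = 0, and then the denominator of T vanishes.
  have h0 : S ≠ 0 := by
    by_cases hε : ε₀ = 0
    · rintro rfl
      apply hd
      rw [denT, e1, hε]
      simp
    · exact hS.S_ne_zero hp ha hb hε
  have hd2 : denT ε₀ ε₁ (γ t₂) ≠ 0 := by
    rw [denT, e2, ← e1]; exact hd
  rw [(intT_eq e1 h0 hd).2, (intT_eq e2 h0 hd2).2]
  have eH1 := defectH_eq ε₁ lam S (ε₀ / S) (γ t₁)
  have eH2 := defectH_eq ε₁ lam S (ε₀ / S) (γ t₂)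
  rw [(hS.normRel h0).z] at eH1
  rw [(hS2.normRel h0).z] at eH2
  have hε : S * (ε₀ / S) = ε₀ := by field_simp
  have hH := hamH_const_of_trajectory hI h ht₁ ht₂
  obtain ⟨a1, b1, -⟩ := mem_phaseSpace_iff.1 hp
  obtain ⟨a2, b2, -⟩ := mem_phaseSpace_iff.1 hp2
  simp only [defectH, hε, a1, b1, a2, b2, hH] at eH1 eH2
  have : scaledT ε₁ (ε₀ / S) (γ t₁) = scaledT ε₁ (ε₀ / S) (γ t₂) := by
    linear_combination eH1 - eH2
  rw [this]

end Flow

/-! ### Critical points of the integral map -/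

/-- The integral map together with the Casimir functions. -/
def fullMap (ε₀ ε₁ lam : ℝ) (u : Phase) : (ℝ × ℝ × ℝ) × (ℝ × ℝ × ℝ) :=
  (integralMap ε₀ ε₁ lam u, casimir u)

theorem contDiff_integralMap (ε₀ ε₁ lam : ℝ) : ContDiff ℝ ∞ (integralMap ε₀ ε₁ lam) :=
  (contDiff_hamH ε₀ ε₁ lam).prodMk ((contDiff_intK ε₀ ε₁ lam).prodMk (contDiff_intG ε₀ ε₁ lam))

theorem contDiff_fullMap (ε₀ ε₁ lam : ℝ) : ContDiff ℝ ∞ (fullMap ε₀ ε₁ lam) :=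
  (contDiff_integralMap ε₀ ε₁ lam).prodMk contDiff_casimir

theorem fderiv_fullMap (ε₀ ε₁ lam : ℝ) (u v : Phase) :
    fderiv ℝ (fullMap ε₀ ε₁ lam) u v =
      (fderiv ℝ (integralMap ε₀ ε₁ lam) u v, fderiv ℝ casimir u v) := by
  have h1 := (contDiff_integralMap ε₀ ε₁ lam).differentiable (by simp) u
  have h2 := contDiff_casimir.differentiable (by simp) u
  have := h1.hasFDerivAt.prodMk h2.hasFDerivAt
  rw [HasFDerivAt.fderiv (f := fullMap ε₀ ε₁ lam) this]
  rfl

theorem fderiv_casimir (u v : Phase) :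
    fderiv ℝ casimir u v =
      (2 * fa u 0 * fa v 0 + 2 * fa u 1 * fa v 1 + 2 * fa u 2 * fa v 2,
        2 * fb u 0 * fb v 0 + 2 * fb u 1 * fb v 1 + 2 * fb u 2 * fb v 2,
        fa v 0 * fb u 0 + fa u 0 * fb v 0 + (fa v 1 * fb u 1 + fa u 1 * fb v 1)
        + (fa v 2 * fb u 2 + fa u 2 * fb v 2)) := by
  refine fderiv_apply_of_line (contDiff_casimir.differentiable (by simp) u) ?_
  have h0 := hasDerivWithinAt_line u v 0
  have := (hasDerivWithinAt_sqA h0).prodMk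
    ((hasDerivWithinAt_sqB h0).prodMk (hasDerivWithinAt_dotAB h0))
  simp only [zero_smul, add_zero] at this
  simpa only [casimir_eq] using this

theorem fderiv_casimir_surjective {a b : ℝ} (ha : a ≠ 0) (hb : b ≠ 0) {u : Phase}
    (hu : u ∈ phaseSpace a b) : Function.Surjective (fderiv ℝ casimir u) := by
  rintro ⟨p, q, r⟩
  obtain ⟨h1, h2, h3⟩ := mem_phaseSpace_iff.1 hu
  simp only [sqA, sqB, dotAB] at h1 h2 h3
  -- Radial variations of α and β change their squared lengths; since α·β = 0, adding a multiple of
  -- β to α changes only α·β to first order.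
  refine ⟨(0, fun i => p / (2 * a ^ 2) * fa u i + r / b ^ 2 * fb u i,
    fun i => q / (2 * b ^ 2) * fb u i), ?_⟩
  rw [fderiv_casimir]
  simp only [fa_mk, fb_mk, Prod.mk.injEq]
  refine ⟨?_, ?_, ?_⟩
  · field_simp
    linear_combination p * b ^ 2 * h1 + 2 * r * a ^ 2 * h3
  · field_simp
    linear_combination q * h2
  · field_simp
    linear_combination (2 * r * a ^ 2) * h2 + (p * b ^ 2 + q * a ^ 2) * h3

/-- The Casimir differential is onto, so rank 3 on its kernel would make the joint differential
onto. The joint form avoids tangent spaces that vary with the point. -/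
theorem isCriticalPoint_of_not_surjective {ε₀ ε₁ lam a b : ℝ} (ha : a ≠ 0) (hb : b ≠ 0)
    {u : Phase} (hu : u ∈ phaseSpace a b)
    (h : ¬ Function.Surjective (fderiv ℝ (fullMap ε₀ ε₁ lam) u)) :
    IsCriticalPoint ε₀ ε₁ lam u := by
  by_contra hcrit
  apply h
  set V := (tangentSpace u).map
    (fderiv ℝ (integralMap ε₀ ε₁ lam) u : Phase →ₗ[ℝ] ℝ × ℝ × ℝ) with hV
  have hV3 : 3 ≤ Module.finrank ℝ V := not_lt.1 hcrit
  have htop : V = ⊤ := by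
    apply Submodule.eq_top_of_finrank_eq
    refine le_antisymm (Submodule.finrank_le _) ?_
    simpa using hV3
  rintro ⟨y, z⟩
  obtain ⟨v₀, hv₀⟩ := fderiv_casimir_surjective ha hb hu z
  have : y - fderiv ℝ (integralMap ε₀ ε₁ lam) u v₀ ∈ V := by rw [htop]; trivial
  obtain ⟨v₁, hv₁, hv₁'⟩ := this
  refine ⟨v₀ + v₁, ?_⟩
  have hk : fderiv ℝ casimir u v₁ = 0 := hv₁
  have hj : fderiv ℝ (integralMap ε₀ ε₁ lam) u v₁ = y - fderiv ℝ (integralMap ε₀ ε₁ lam) u v₀ :=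
    hv₁'
  rw [fderiv_fullMap, map_add, map_add, hk, hj, hv₀]
  simp

theorem contDiff_scaledT (ε₁ δ : ℝ) : ContDiff ℝ ∞ (scaledT ε₁ δ) := by
  unfold scaledT planarSq mom fa fb; fun_prop

theorem hasDerivAt_line_of_contDiff {f : Phase → ℝ} (hf : ContDiff ℝ ∞ f) (u v : Phase) :
    HasDerivAt (fun s : ℝ => f (u + s • v)) (fderiv ℝ f u v) 0 := by
  have h0 : HasFDerivAt f (fderiv ℝ f u) (u + (0 : ℝ) • v) := by
    simpa using (hf.differentiable (by simp) u).hasFDerivAt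
  exact h0.comp_hasDerivAt (0 : ℝ) ((hasDerivWithinAt_line u v 0).hasDerivAt Filter.univ_mem)

theorem contDiff_relA (S : ℝ) : ContDiff ℝ ∞ (relA S) := by
  unfold relA mom fa; fun_prop

theorem contDiff_relB (S : ℝ) : ContDiff ℝ ∞ (relB S) := by
  unfold relB mom fb; fun_prop

theorem contDiff_relX (ε₁ lam c s S : ℝ) : ContDiff ℝ ∞ (relX ε₁ lam c s S) := by
  unfold relX crossX redMom mom fa fb; fun_prop

theorem contDiff_relY (ε₁ lam c s S : ℝ) : ContDiff ℝ ∞ (relY ε₁ lam c s S) := by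
  unfold relY crossY redMom mom fa fb; fun_prop

theorem contDiff_sqA : ContDiff ℝ ∞ sqA := by
  unfold sqA fa; fun_prop

theorem contDiff_sqB : ContDiff ℝ ∞ sqB := by
  unfold sqB fb; fun_prop

theorem contDiff_dotAB : ContDiff ℝ ∞ dotAB := by
  unfold dotAB fa fb; fun_prop

/-- At points satisfying the relations the differentials of the integrals are dependent modulo
the differentials of the Casimir functions. -/
theorem differential_combination {ε₁ lam S δ : ℝ} {u : Phase} (h : NormRel ε₁ lam S δ u)
    {v : Phase} (hv : fderiv ℝ casimir u v = 0) :
    4 * fderiv ℝ (intK (S * δ) ε₁ lam) u v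
      + 8 * (δ + 2 * ε₁ ^ 2) * fderiv ℝ (intG (S * δ) ε₁ lam) u v
      + 4 * (scaledT ε₁ δ u - (δ + 2 * ε₁ ^ 2) * (sqA u + sqB u))
        * fderiv ℝ (hamH (S * δ) ε₁ lam) u v = 0 := by
  obtain ⟨ha, hb, hx, hy, hz⟩ := h
  have hH0 : defectH ε₁ lam S δ u = 0 := by rw [defectH_eq, hz]; ring
  rw [fderiv_casimir] at hv
  obtain ⟨hv1, hv2, hv3⟩ : _ ∧ _ ∧ _ := by simpa only [Prod.mk_eq_zero] using hv
  have line := hasDerivWithinAt_line u v 0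
  have dA := (hasDerivWithinAt_sqA line).hasDerivAt Filter.univ_mem
  have dB := (hasDerivWithinAt_sqB line).hasDerivAt Filter.univ_mem
  have dAB := (hasDerivWithinAt_dotAB line).hasDerivAt Filter.univ_mem
  simp only [zero_smul, add_zero] at dA dB dAB
  rw [hv1] at dA
  rw [hv2] at dB
  rw [hv3] at dAB
  have dK := hasDerivAt_line_of_contDiff (contDiff_intK (S * δ) ε₁ lam) u v
  have dG := hasDerivAt_line_of_contDiff (contDiff_intG (S * δ) ε₁ lam) u v
  have dH := hasDerivAt_line_of_contDiff (contDiff_hamH (S * δ) ε₁ lam) u v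
  have dT := hasDerivAt_line_of_contDiff (contDiff_scaledT ε₁ δ) u v
  have dra := hasDerivAt_line_of_contDiff (contDiff_relA S) u v
  have drb := hasDerivAt_line_of_contDiff (contDiff_relB S) u v
  have drx := hasDerivAt_line_of_contDiff (contDiff_relX ε₁ lam δ 1 S) u v
  have dry := hasDerivAt_line_of_contDiff (contDiff_relY ε₁ lam δ 1 S) u v
  have ddH := ((((dH.sub_const (lam ^ 2 / 2)).const_mul 2).sub_const (2 * S ^ 2 * δ)).sub
    ((dA.add dB).const_mul δ)).add dT
  have ddG := (((dG.const_mul 2).sub (((dA.mul dB).sub (dAB.pow 2)).const_mul (2 * δ))).sub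
    ((dA.add dB).const_mul (S ^ 2 * δ))).add (dT.const_mul (S ^ 2))
  have ddK := (((dK.const_mul 4).sub (dT.pow 2)).sub ((dT.const_mul (δ + 2 * ε₁ ^ 2)).mul
    (((dA.add dB).const_mul 2).const_sub (4 * S ^ 2)))).sub
    ((((dA.sub dB).pow 2).add ((dAB.pow 2).const_mul 4)).const_mul ((δ + 2 * ε₁ ^ 2) ^ 2))
  have dL := (ddK.add (ddG.const_mul (4 * (δ + 2 * ε₁ ^ 2)))).add
    (((dT.sub ((dA.add dB).const_mul (δ + 2 * ε₁ ^ 2))).const_mul 2).mul ddH)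
  have dR := ((((drx.pow 2).add (dry.pow 2)).const_mul (-4)).add
    (((dra.pow 2).add (drb.pow 2)).const_mul (2 * δ))).add
    (((dra.mul dry).sub (drb.mul drx)).const_mul (8 * ε₁))
  have heq := dL.unique (dR.congr_of_eventuallyEq
    (Filter.Eventually.of_forall fun s => defect_combination ε₁ lam S δ (u + s • v)))
  -- The right side is quadratic in relations that vanish at u, so its derivative is zero. On the
  -- left, the derivative of the coefficient of `defectH` is multiplied by `defectH` = 0.
  simp only [Pi.add_apply, Pi.sub_apply, zero_smul, add_zero,
    ha, hb, hx, hy] at heq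
  simp only [defectH] at hH0
  norm_num at heq
  linear_combination heq - 2 * fderiv ℝ (scaledT ε₁ δ) u v * hH0

theorem fderiv_integralMap (ε₀ ε₁ lam : ℝ) (u v : Phase) :
    fderiv ℝ (integralMap ε₀ ε₁ lam) u v = (fderiv ℝ (hamH ε₀ ε₁ lam) u v,
      fderiv ℝ (intK ε₀ ε₁ lam) u v, fderiv ℝ (intG ε₀ ε₁ lam) u v) := by
  have h1 := (contDiff_hamH ε₀ ε₁ lam).differentiable (by simp) u
  have h2 := (contDiff_intK ε₀ ε₁ lam).differentiable (by simp) u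
  have h3 := (contDiff_intG ε₀ ε₁ lam).differentiable (by simp) u
  have := h1.hasFDerivAt.prodMk (h2.hasFDerivAt.prodMk h3.hasFDerivAt)
  rw [HasFDerivAt.fderiv (f := integralMap ε₀ ε₁ lam) this]
  rfl

/-- No vector can have dK = 1 while dH, dG and the Casimir differentials vanish: dK enters the
linear dependence with coefficient 4. -/
theorem not_surjective_of_mem_relationSet {ε₀ ε₁ lam a b : ℝ} (ha : a ≠ 0) (hb : b ≠ 0)
    {u : Phase} (hu : u ∈ relationSet ε₀ ε₁ lam a b) :
    ¬ Function.Surjective (fderiv ℝ (fullMap ε₀ ε₁ lam) u) := by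
  intro hs
  obtain ⟨S, δ, rfl, hN⟩ := exists_normRel ha hb hu
  obtain ⟨v, hv⟩ := hs ((0, 1, 0), 0)
  rw [fderiv_fullMap, fderiv_integralMap] at hv
  simp only [Prod.mk.injEq] at hv
  obtain ⟨⟨h1, h2, h3⟩, h4⟩ := hv
  have := differential_combination hN h4
  rw [h1, h2, h3] at this
  norm_num at this

/-- Surjectivity is maximality of the rank, and rank is lower semicontinuous. -/
theorem isOpen_surjective_fderiv {E F : Type*} [NormedAddCommGroup E] [NormedSpace ℝ E]
    [NormedAddCommGroup F] [NormedSpace ℝ F] [FiniteDimensional ℝ F] {f : E → F} {U : Set E}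
    (hU : IsOpen U) (hf : ContDiffOn ℝ ∞ f U) :
    IsOpen {u | u ∈ U ∧ Function.Surjective (fderiv ℝ f u)} := by
  have hset : {f' : E →L[ℝ] F | Function.Surjective f'} =
      {f' : E →L[ℝ] F | (Module.finrank ℝ F : Cardinal) ≤ (f' : E →ₗ[ℝ] F).rank} := by
    ext f'
    change Function.Surjective f' ↔ (Module.finrank ℝ F : Cardinal) ≤ (f' : E →ₗ[ℝ] F).rank
    have h1 : (f' : E →ₗ[ℝ] F).rank
        = (Module.finrank ℝ (LinearMap.range (f' : E →ₗ[ℝ] F)) : Cardinal) := by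
      rw [LinearMap.rank, Module.finrank_eq_rank]
    rw [h1, Nat.cast_le]
    constructor
    · intro h
      have : LinearMap.range (f' : E →ₗ[ℝ] F) = ⊤ := LinearMap.range_eq_top.2 h
      rw [this, finrank_top]
    · intro h
      exact LinearMap.range_eq_top.1
        (Submodule.eq_top_of_finrank_eq (le_antisymm (Submodule.finrank_le _) h))
  have hopen : IsOpen {f' : E →L[ℝ] F | Function.Surjective f'} := by
    rw [hset]
    exact isOpen_setOfPred_nat_le_rank _
  exact (hf.continuousOn_fderiv_of_isOpen hU (by simp)).isOpen_inter_preimage hU hopen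

theorem isCriticalPoint_of_mem_setM₃ {ε₀ ε₁ lam a b : ℝ} (ha : a ≠ 0) (hb : b ≠ 0)
    {u : Phase} (hu : u ∈ setM₃ ε₀ ε₁ lam a b) : IsCriticalPoint ε₀ ε₁ lam u := by
  refine isCriticalPoint_of_not_surjective ha hb (setM₃_subset_phaseSpace _ _ _ _ _ hu) ?_
  have hopen := isOpen_surjective_fderiv isOpen_univ (contDiff_fullMap ε₀ ε₁ lam).contDiffOn
  intro hs
  exact closure_minimal (t := {u | u ∈ Set.univ ∧
    Function.Surjective (fderiv ℝ (fullMap ε₀ ε₁ lam) u)}ᶜ)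
    (fun v hv hv' => not_surjective_of_mem_relationSet ha hb hv hv'.2) hopen.isClosed_compl hu
    ⟨trivial, hs⟩


/-! ### Smooth points -/

/-- The differential of `relA S` for constant `S`. -/
def dRelA (S : ℝ) (u v : Phase) : ℝ :=
  mom v 0 * fa u 0 + mom v 1 * fa u 1 + mom v 2 * fa u 2
    + (mom u 0 * fa v 0 + mom u 1 * fa v 1 + mom u 2 * fa v 2) + S * mom v 0

/-- The differential of `relB S` for constant `S`. -/
def dRelB (S : ℝ) (u v : Phase) : ℝ :=
  mom v 0 * fb u 0 + mom v 1 * fb u 1 + mom v 2 * fb u 2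
    + (mom u 0 * fb v 0 + mom u 1 * fb v 1 + mom u 2 * fb v 2) + S * mom v 1

/-- The differential of `redMom`. -/
def dRedMom (ε₁ : ℝ) (v : Phase) : ℝ := mom v 2 / 2 - ε₁ * (fa v 1 - fb v 0)

/-- The differential of `crossX S` for constant `S`. -/
def dCrossX (S : ℝ) (u v : Phase) : ℝ :=
  fa v 1 * fb u 2 + fa u 1 * fb v 2 - (fa v 2 * fb u 1 + fa u 2 * fb v 1) - S * fa v 2

/-- The differential of `crossY S` for constant `S`. -/
def dCrossY (S : ℝ) (u v : Phase) : ℝ :=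
  fa v 2 * fb u 0 + fa u 2 * fb v 0 - (fa v 0 * fb u 2 + fa u 0 * fb v 2) - S * fb v 2

/-- The differential of `polyS`. -/
def dPolyS (u v : Phase) : ℝ :=
  mom v 0 * (mom u 0 * fa u 0 + mom u 1 * fa u 1 + mom u 2 * fa u 2)
    + mom u 0 * (mom v 0 * fa u 0 + mom v 1 * fa u 1 + mom v 2 * fa u 2
      + (mom u 0 * fa v 0 + mom u 1 * fa v 1 + mom u 2 * fa v 2))
    + (mom v 1 * (mom u 0 * fb u 0 + mom u 1 * fb u 1 + mom u 2 * fb u 2)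
    + mom u 1 * (mom v 0 * fb u 0 + mom v 1 * fb u 1 + mom v 2 * fb u 2
      + (mom u 0 * fb v 0 + mom u 1 * fb v 1 + mom u 2 * fb v 2)))

/-- The differential of `polyV`. -/
def dPolyV (ε₀ ε₁ lam : ℝ) (u v : Phase) : ℝ :=
  ε₀ * ((2 * mom u 0 * mom v 0 + 2 * mom u 1 * mom v 1)
      * (mom u 0 * crossX 0 u + mom u 1 * crossY 0 u)
    + planarSq u * (mom v 0 * crossX 0 u + mom u 0 * dCrossX 0 u v
      + (mom v 1 * crossY 0 u + mom u 1 * dCrossY 0 u v)))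
  + ε₀ * (dPolyS u v * (mom u 0 * fa u 2 + mom u 1 * fb u 2)
    + polyS u * (mom v 0 * fa u 2 + mom u 0 * fa v 2 + (mom v 1 * fb u 2 + mom u 1 * fb v 2)))
  + (((2 * mom u 0 * mom v 0 + 2 * mom u 1 * mom v 1) * polyS u + planarSq u * dPolyS u v)
      * redMom ε₁ lam u + planarSq u * polyS u * dRedMom ε₁ v)

section Curves

variable {γ : ℝ → Phase} {v : Phase} {I : Set ℝ} {t : ℝ}

theorem hasDerivWithinAt_polyS (h : HasDerivWithinAt γ v I t) :
    HasDerivWithinAt (fun s => polyS (γ s)) (dPolyS (γ t) v) I t := by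
  have m := hasDerivWithinAt_mom h
  exact ((m 0).mul (hasDerivWithinAt_momA h)).add ((m 1).mul (hasDerivWithinAt_momB h))

theorem hasDerivWithinAt_polyV (ε₀ ε₁ lam : ℝ) (h : HasDerivWithinAt γ v I t) :
    HasDerivWithinAt (fun s => polyV ε₀ ε₁ lam (γ s)) (dPolyV ε₀ ε₁ lam (γ t) v) I t := by
  have m := hasDerivWithinAt_mom h
  have a := hasDerivWithinAt_fa h
  have b := hasDerivWithinAt_fb h
  have W := hasDerivWithinAt_planarSq h
  have s := hasDerivWithinAt_polyS h
  have e := ((((W.const_mul ε₀).mul (((m 0).mul (hasDerivWithinAt_crossX 0 h)).add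
    ((m 1).mul (hasDerivWithinAt_crossY 0 h)))).add
    ((s.const_mul ε₀).mul (((m 0).mul (a 2)).add ((m 1).mul (b 2))))).add
    ((W.mul s).mul (hasDerivWithinAt_redMom ε₁ lam h)))
  refine e.congr_deriv ?_
  simp only [dPolyV, dCrossX, dCrossY, dRedMom, Pi.add_apply, Pi.mul_apply]
  ring

end Curves

/-- The map whose zero set is locally the closure of the relation set. -/
def definingMap (ε₀ ε₁ lam a b : ℝ) (u : Phase) : Fin 5 → ℝ :=
  ![sqA u - a ^ 2, sqB u - b ^ 2, dotAB u, polyU u, polyV ε₀ ε₁ lam u]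

theorem contDiff_definingMap (ε₀ ε₁ lam a b : ℝ) : ContDiff ℝ ∞ (definingMap ε₀ ε₁ lam a b) := by
  refine contDiff_pi.2 fun i => ?_
  fin_cases i
  · exact contDiff_sqA.sub contDiff_const
  · exact contDiff_sqB.sub contDiff_const
  · exact contDiff_dotAB
  · exact contDiff_polyU
  · exact contDiff_polyV ε₀ ε₁ lam

theorem fderiv_definingMap (ε₀ ε₁ lam a b : ℝ) (u v : Phase) :
    fderiv ℝ (definingMap ε₀ ε₁ lam a b) u v =
      ![(fderiv ℝ casimir u v).1, (fderiv ℝ casimir u v).2.1, (fderiv ℝ casimir u v).2.2,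
        dPolyU u v, dPolyV ε₀ ε₁ lam u v] := by
  refine fderiv_apply_of_line
    ((contDiff_definingMap ε₀ ε₁ lam a b).differentiable (by simp) u) ?_
  have h0 := hasDerivWithinAt_line u v 0
  refine hasDerivWithinAt_pi.2 fun i => ?_
  rw [fderiv_casimir]
  fin_cases i
  · simpa [definingMap] using (hasDerivWithinAt_sqA h0).sub_const (a ^ 2)
  · simpa [definingMap] using (hasDerivWithinAt_sqB h0).sub_const (b ^ 2)
  · simpa [definingMap] using hasDerivWithinAt_dotAB h0
  · simpa [definingMap] using hasDerivWithinAt_polyU h0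
  · simpa [definingMap] using hasDerivWithinAt_polyV ε₀ ε₁ lam h0

/-- The differential is block triangular: the Casimir values are adjusted first, then `polyU` by v,
then `polyV` by w. -/
theorem fderiv_definingMap_surjective {ε₀ ε₁ lam a b : ℝ} (ha : a ≠ 0) (hb : b ≠ 0) {u : Phase}
    (hu : u ∈ phaseSpace a b) {v w : Phase} (hv : fderiv ℝ casimir u v = 0)
    (hw : fderiv ℝ casimir u w = 0) (hvU : dPolyU u v ≠ 0) (hwU : dPolyU u w = 0)
    (hwV : dPolyV ε₀ ε₁ lam u w ≠ 0) :
    Function.Surjective (fderiv ℝ (definingMap ε₀ ε₁ lam a b) u) := by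
  intro y
  obtain ⟨q, hq⟩ := fderiv_casimir_surjective ha hb hu (y 0, y 1, y 2)
  have eq := fderiv_definingMap ε₀ ε₁ lam a b u q
  have ev := fderiv_definingMap ε₀ ε₁ lam a b u v
  have ew := fderiv_definingMap ε₀ ε₁ lam a b u w
  rw [hq] at eq
  rw [hv] at ev
  rw [hw, hwU] at ew
  set x := (y 3 - dPolyU u q) / dPolyU u v with hx
  set z := (y 4 - dPolyV ε₀ ε₁ lam u q - x * dPolyV ε₀ ε₁ lam u v) / dPolyV ε₀ ε₁ lam u w with hz
  have hx' : x * dPolyU u v = y 3 - dPolyU u q := by rw [hx]; field_simp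
  have hz' : z * dPolyV ε₀ ε₁ lam u w
      = y 4 - dPolyV ε₀ ε₁ lam u q - x * dPolyV ε₀ ε₁ lam u v := by rw [hz]; field_simp
  refine ⟨q + (x • v + z • w), ?_⟩
  rw [map_add, map_add, map_smul, map_smul, eq, ev, ew]
  ext i
  fin_cases i
  · simp
  · simp
  · simp
  · simp [hx']
  · simp [hz']

/-- Off M₁ = M₂ = 0 the closure is exactly the zero set of `definingMap`; five equations in
dimension nine leave dimension four. -/
theorem isSmoothPoint_of_surjective {ε₀ ε₁ lam a b : ℝ} {u : Phase}
    (hu : u ∈ relationSet ε₀ ε₁ lam a b)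
    (hs : Function.Surjective (fderiv ℝ (definingMap ε₀ ε₁ lam a b) u)) :
    IsSmoothPoint (setM₃ ε₀ ε₁ lam a b) 4 u := by
  refine ⟨subset_closure hu, 5, {q | q ∈ {q : Phase | planarSq q ≠ 0} ∧
    Function.Surjective (fderiv ℝ (definingMap ε₀ ε₁ lam a b) q)}, definingMap ε₀ ε₁ lam a b,
    by simp, isOpen_surjective_fderiv isOpen_planarSq_ne_zero
      (contDiff_definingMap ε₀ ε₁ lam a b).contDiffOn, ?_,
    (contDiff_definingMap ε₀ ε₁ lam a b).contDiffOn, fun q hq => hq.2.2, ?_⟩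
  · exact ⟨(mem_relationSet_iff.1 hu).2.1, hs⟩
  · ext q
    constructor
    · rintro ⟨hq, hq'⟩
      refine ⟨hq', ?_⟩
      obtain ⟨h1, h2, h3⟩ := mem_phaseSpace_iff.1 (setM₃_subset_phaseSpace _ _ _ _ _ hq)
      obtain ⟨h4, h5⟩ := polyU_eq_zero_of_mem_setM₃ hq
      ext i
      fin_cases i <;> simp [definingMap, h1, h2, h3, h4, h5]
    · rintro ⟨hq', hq⟩
      refine ⟨subset_closure ?_, hq'⟩
      rw [mem_relationSet_iff, mem_phaseSpace_iff, rel_iff_poly hq'.1]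
      have e0 := congrFun hq 0
      have e1 := congrFun hq 1
      have e2 := congrFun hq 2
      have e3 := congrFun hq 3
      have e4 := congrFun hq 4
      simp [definingMap] at e0 e1 e2 e3 e4
      exact ⟨⟨by linarith, by linarith, e2⟩, hq'.1, e3, e4⟩

theorem dPolyU_eq {S : ℝ} {u : Phase} (ha : relA S u = 0) (hb : relB S u = 0) (v : Phase) :
    dPolyU u v = mom u 1 * dRelA S u v - mom u 0 * dRelB S u v := by
  simp only [dPolyU, dRelA, dRelB, relA, relB] at *
  linear_combination mom v 1 * ha - mom v 0 * hb

/-- σ is the variation of S that keeps both orthogonality relations to first order. The formula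
differentiates `planarSq` (M₁ `relX` + M₂ `relY`) with S varying at rate σ; terms containing an
undifferentiated relation vanish. -/
theorem dPolyV_eq {ε₀ ε₁ lam S σ : ℝ} {u : Phase} (h : Rel ε₀ ε₁ lam S u) {v : Phase}
    (hA : dRelA S u v + σ * mom u 0 = 0) (hB : dRelB S u v + σ * mom u 1 = 0) :
    dPolyV ε₀ ε₁ lam u v = planarSq u *
      (ε₀ * (mom u 0 * dCrossX S u v + mom u 1 * dCrossY S u v)
        - S * (dRedMom ε₁ v * planarSq u
          + redMom ε₁ lam u * (mom u 0 * mom v 0 + mom u 1 * mom v 1))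
        - σ * (ε₀ * (mom u 0 * fa u 2 + mom u 1 * fb u 2) + redMom ε₁ lam u * planarSq u)) := by
  obtain ⟨ha, hb, hx, hy, -⟩ := h
  have hs := (polyU_eq_of_rel ha hb).2
  have hds : dPolyS u v = -σ * planarSq u
      - S * (2 * mom u 0 * mom v 0 + 2 * mom u 1 * mom v 1) := by
    simp only [dPolyS, dRelA, dRelB, relA, relB, planarSq] at *
    linear_combination mom u 0 * hA + mom u 1 * hB + mom v 0 * ha + mom v 1 * hb
  simp only [dPolyV, hs, hds]
  simp only [relX, relY, crossX, crossY, dCrossX, dCrossY] at *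
  have hW : planarSq u = mom u 0 ^ 2 + mom u 1 ^ 2 := rfl
  rw [hW]
  linear_combination (2 * mom u 0 * mom v 0 + 2 * mom u 1 * mom v 1) * (mom u 0 * hx + mom u 1 * hy)
    + (mom u 0 ^ 2 + mom u 1 ^ 2) * (mom v 0 * hx + mom v 1 * hy)


/-- The tangent vector of the phase space with momentum part `m` and angular velocity `n`. -/
def tangentVec (m n : Fin 3 → ℝ) (u : Phase) : Phase :=
  (m, ![fa u 1 * n 2 - fa u 2 * n 1, fa u 2 * n 0 - fa u 0 * n 2, fa u 0 * n 1 - fa u 1 * n 0],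
    ![fb u 1 * n 2 - fb u 2 * n 1, fb u 2 * n 0 - fb u 0 * n 2, fb u 0 * n 1 - fb u 1 * n 0])

theorem fderiv_casimir_tangentVec (m n : Fin 3 → ℝ) (u : Phase) :
    fderiv ℝ casimir u (tangentVec m n u) = 0 := by
  rw [fderiv_casimir]
  simp only [tangentVec, fa_mk, fb_mk, Matrix.cons_val_zero, Matrix.cons_val_one, Matrix.cons_val,
    Prod.mk_eq_zero]
  refine ⟨?_, ?_, ?_⟩ <;> ring

/-- If all these derivatives vanished, the momentum variations and the rotation about e₃ would give
S = 0 and M₂ α = M₁ β. This is impossible for orthogonal non-zero fields and (M₁, M₂) ≠ 0. -/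
theorem exists_dPolyU_ne_zero {a b S : ℝ} (ha : a ≠ 0) (hb : b ≠ 0) {u : Phase}
    (hu : u ∈ phaseSpace a b) (hW : planarSq u ≠ 0) (hA : relA S u = 0) (hB : relB S u = 0) :
    ∃ v, fderiv ℝ casimir u v = 0 ∧ dPolyU u v ≠ 0 := by
  by_contra! h
  have key : ∀ m n : Fin 3 → ℝ, mom u 1 * dRelA S u (tangentVec m n u)
      - mom u 0 * dRelB S u (tangentVec m n u) = 0 := fun m n => by
    rw [← dPolyU_eq hA hB]; exact h _ (fderiv_casimir_tangentVec m n u)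
  have k0 := key ![1, 0, 0] 0
  have k1 := key ![0, 1, 0] 0
  have k2 := key ![0, 0, 1] 0
  have k3 := key 0 ![0, 0, 1]
  simp [dRelA, dRelB, tangentVec] at k0 k1 k2 k3
  obtain ⟨h1, h2, h3⟩ := mem_phaseSpace_iff.1 hu
  simp only [sqA, sqB, dotAB, planarSq, relA, relB] at *
  have hS : S = 0 := by
    have : S * (mom u 0 ^ 2 + mom u 1 ^ 2) = 0 := by
      linear_combination mom u 1 * k0 - mom u 0 * k1 + k3
    exact (mul_eq_zero.1 this).resolve_right hW
  subst hS
  have hz : mom u 1 ^ 2 * a ^ 2 + mom u 0 ^ 2 * b ^ 2 = 0 := by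
    linear_combination (mom u 1 * fa u 0 - mom u 0 * fb u 0) * k0
      + (mom u 1 * fa u 1 - mom u 0 * fb u 1) * k1 + (mom u 1 * fa u 2 - mom u 0 * fb u 2) * k2
      - mom u 1 ^ 2 * h1 - mom u 0 ^ 2 * h2 + 2 * mom u 0 * mom u 1 * h3
  have e1 : (mom u 1 * a) ^ 2 = 0 := by nlinarith [sq_nonneg (mom u 1 * a), sq_nonneg (mom u 0 * b)]
  have e0 : (mom u 0 * b) ^ 2 = 0 := by nlinarith [sq_nonneg (mom u 1 * a), sq_nonneg (mom u 0 * b)]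
  simp only [ne_eq, OfNat.ofNat_ne_zero, not_false_eq_true, pow_eq_zero_iff, mul_eq_zero, ha, hb,
    or_false] at e0 e1
  exact hW (by rw [e0, e1]; ring)

/-! ### Tangent vectors that certify smooth points -/

section Criteria

variable {ε₀ ε₁ lam a b S : ℝ} {u : Phase}

/-- A sufficient condition for a smooth point, in terms of one tangent vector. -/
theorem isSmoothPoint_of_tangentVec (ha : a ≠ 0) (hb : b ≠ 0)
    (hu : u ∈ relationSet ε₀ ε₁ lam a b) (h : Rel ε₀ ε₁ lam S u) (m n : Fin 3 → ℝ) (σ : ℝ)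
    (hA : dRelA S u (tangentVec m n u) + σ * mom u 0 = 0)
    (hB : dRelB S u (tangentVec m n u) + σ * mom u 1 = 0)
    (hV : ε₀ * (mom u 0 * dCrossX S u (tangentVec m n u)
          + mom u 1 * dCrossY S u (tangentVec m n u))
        - S * (dRedMom ε₁ (tangentVec m n u) * planarSq u
          + redMom ε₁ lam u * (mom u 0 * m 0 + mom u 1 * m 1))
        - σ * (ε₀ * (mom u 0 * fa u 2 + mom u 1 * fb u 2) + redMom ε₁ lam u * planarSq u) ≠ 0) :
    IsSmoothPoint (setM₃ ε₀ ε₁ lam a b) 4 u := by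
  obtain ⟨hp, hW, -⟩ := mem_relationSet_iff.1 hu
  obtain ⟨v, hv, hvU⟩ := exists_dPolyU_ne_zero ha hb hp hW h.a h.b
  refine isSmoothPoint_of_surjective hu (fderiv_definingMap_surjective ha hb hp hv
    (fderiv_casimir_tangentVec m n u) hvU ?_ ?_)
  · rw [dPolyU_eq h.a h.b]
    linear_combination mom u 1 * hA - mom u 0 * hB
  · rw [dPolyV_eq h hA hB]
    exact mul_ne_zero hW hV

/-- Scaling M keeps the homogeneous orthogonality relations and changes the vector relation at the
rate M₃/2 + D, up to a non-zero factor. -/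
theorem isSmoothPoint_of_radial (ha : a ≠ 0) (hb : b ≠ 0)
    (hu : u ∈ relationSet ε₀ ε₁ lam a b) (h : Rel ε₀ ε₁ lam S u) (hS : S ≠ 0)
    (hM : mom u 2 / 2 + redMom ε₁ lam u ≠ 0) :
    IsSmoothPoint (setM₃ ε₀ ε₁ lam a b) 4 u := by
  obtain ⟨hp, hW, -⟩ := mem_relationSet_iff.1 hu
  have h1 := h.a
  have h2 := h.b
  refine isSmoothPoint_of_tangentVec ha hb hu h (mom u) 0 0 ?_ ?_ ?_
  · simp only [relA, dRelA, tangentVec] at *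
    simp
    linear_combination h1
  · simp only [relB, dRelB, tangentVec] at *
    simp
    linear_combination h2
  · have e : ε₀ * (mom u 0 * dCrossX S u (tangentVec (mom u) 0 u)
          + mom u 1 * dCrossY S u (tangentVec (mom u) 0 u))
        - S * (dRedMom ε₁ (tangentVec (mom u) 0 u) * planarSq u
          + redMom ε₁ lam u * (mom u 0 * mom u 0 + mom u 1 * mom u 1))
        - 0 * (ε₀ * (mom u 0 * fa u 2 + mom u 1 * fb u 2) + redMom ε₁ lam u * planarSq u)
        = -(S * planarSq u * (mom u 2 / 2 + redMom ε₁ lam u)) := by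
      simp [dCrossX, dCrossY, dRedMom, tangentVec, planarSq]
      ring
    rw [e, neg_ne_zero]
    exact mul_ne_zero (mul_ne_zero hS hW) hM

/-- Here S varies with fixed fields. The momentum variation is the S-derivative of (α + S e₁) × (β +
S e₂), and σ = S D / ε₀ is the ratio of this product to M. -/
theorem isSmoothPoint_of_trace (ha : a ≠ 0) (hb : b ≠ 0)
    (hu : u ∈ relationSet ε₀ ε₁ lam a b) (h : Rel ε₀ ε₁ lam S u) (hS : S ≠ 0) (hε : ε₀ ≠ 0)
    (hM : ε₀ * (fa u 0 + fb u 1 + 2 * S) + 2 * redMom ε₁ lam u ^ 2 ≠ 0) :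
    IsSmoothPoint (setM₃ ε₀ ε₁ lam a b) 4 u := by
  obtain ⟨hp, hW, -⟩ := mem_relationSet_iff.1 hu
  have h1 := h.x
  have h2 := h.y
  obtain ⟨σ, hσ⟩ : ∃ σ, σ = S * redMom ε₁ lam u / ε₀ := ⟨_, rfl⟩
  have hσ' : ε₀ * σ = S * redMom ε₁ lam u := by rw [hσ]; field_simp
  refine isSmoothPoint_of_tangentVec ha hb hu h
    ![-fa u 2, -fb u 2, fa u 0 + fb u 1 + 2 * S] 0 σ ?_ ?_ ?_
  · have : ε₀ * (crossX S u - σ * mom u 0) = 0 := by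
      simp only [relX] at h1; linear_combination h1 - mom u 0 * hσ'
    have e := (mul_eq_zero.1 this).resolve_left hε
    simp only [crossX] at e
    simp [dRelA, tangentVec]
    linear_combination -e
  · have : ε₀ * (crossY S u - σ * mom u 1) = 0 := by
      simp only [relY] at h2; linear_combination h2 - mom u 1 * hσ'
    have e := (mul_eq_zero.1 this).resolve_left hε
    simp only [crossY] at e
    simp [dRelB, tangentVec]
    linear_combination -e
  · intro h0
    have e : ε₀ * (-(S * planarSq u * ((fa u 0 + fb u 1 + 2 * S) / 2)
        + σ * redMom ε₁ lam u * planarSq u)) = 0 := by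
      simp [dCrossX, dCrossY, dRedMom, tangentVec] at h0
      linear_combination ε₀ * h0 + ε₀ * (mom u 0 * fa u 2 + mom u 1 * fb u 2) * hσ'
    have e' : S * planarSq u * (ε₀ * (fa u 0 + fb u 1 + 2 * S) + 2 * redMom ε₁ lam u ^ 2) = 0 := by
      linear_combination (-2) * e - 2 * redMom ε₁ lam u * planarSq u * hσ'
    exact mul_ne_zero (mul_ne_zero hS hW) hM e'

/-- If `D = 0`, momentum variations orthogonal to both shifted fields are enough. -/
theorem isSmoothPoint_of_orthogonal (ha : a ≠ 0) (hb : b ≠ 0)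
    (hu : u ∈ relationSet ε₀ ε₁ lam a b) (h : Rel ε₀ ε₁ lam S u) (hS : S ≠ 0)
    (hD : redMom ε₁ lam u = 0) (m : Fin 3 → ℝ)
    (hA : m 0 * (fa u 0 + S) + m 1 * fa u 1 + m 2 * fa u 2 = 0)
    (hB : m 0 * fb u 0 + m 1 * (fb u 1 + S) + m 2 * fb u 2 = 0) (hm : m 2 ≠ 0) :
    IsSmoothPoint (setM₃ ε₀ ε₁ lam a b) 4 u := by
  obtain ⟨hp, hW, -⟩ := mem_relationSet_iff.1 hu
  refine isSmoothPoint_of_tangentVec ha hb hu h m 0 0 ?_ ?_ ?_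
  · simp [dRelA, tangentVec]
    linear_combination hA
  · simp [dRelB, tangentVec]
    linear_combination hB
  · rw [hD]
    simp [dCrossX, dCrossY, dRedMom, tangentVec, hS, hm, hW]

/-- For ε₀ = D = 0 only the variation of D survives in the second relation. On the kernel of the
first one, σ is recovered by projecting onto (M₁, M₂). -/
theorem isSmoothPoint_of_dRedMom (ha : a ≠ 0) (hb : b ≠ 0)
    (hu : u ∈ relationSet 0 ε₁ lam a b) (h : Rel 0 ε₁ lam S u) (hS : S ≠ 0)
    (hD : redMom ε₁ lam u = 0) (m n : Fin 3 → ℝ)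
    (hU : mom u 1 * dRelA S u (tangentVec m n u) - mom u 0 * dRelB S u (tangentVec m n u) = 0)
    (hm : dRedMom ε₁ (tangentVec m n u) ≠ 0) :
    IsSmoothPoint (setM₃ 0 ε₁ lam a b) 4 u := by
  obtain ⟨hp, hW, -⟩ := mem_relationSet_iff.1 hu
  refine isSmoothPoint_of_tangentVec ha hb hu h m n (-(mom u 0 * dRelA S u (tangentVec m n u)
    + mom u 1 * dRelB S u (tangentVec m n u)) / planarSq u) ?_ ?_ ?_
  · field_simp
    simp only [planarSq]
    linear_combination mom u 1 * hU
  · field_simp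
    simp only [planarSq]
    linear_combination -mom u 0 * hU
  · rw [hD]
    simp [hS, hm, hW]

/-- For `ε₀ = 0` the points with `S ≠ 0` are smooth. -/
theorem isSmoothPoint_of_S_ne_zero (ha : a ≠ 0) (hb : b ≠ 0)
    (hu : u ∈ relationSet 0 ε₁ lam a b) (h : Rel 0 ε₁ lam S u) (hS : S ≠ 0) :
    IsSmoothPoint (setM₃ 0 ε₁ lam a b) 4 u := by
  by_contra hns
  obtain ⟨hp, hW, -⟩ := mem_relationSet_iff.1 hu
  have hD : redMom ε₁ lam u = 0 := by
    have h1 := h.x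
    have h2 := h.y
    simp only [relX, relY] at h1 h2
    have : S * redMom ε₁ lam u * planarSq u = 0 := by
      simp only [planarSq]; linear_combination -mom u 0 * h1 - mom u 1 * h2
    simpa [hS, hW] using this
  have hM2 : mom u 2 = 0 := by
    by_contra hM
    exact hns (isSmoothPoint_of_radial ha hb hu h hS (by rw [hD]; simpa using hM))
  have key : ∀ m n : Fin 3 → ℝ, mom u 1 * dRelA S u (tangentVec m n u)
      - mom u 0 * dRelB S u (tangentVec m n u) = 0 → dRedMom ε₁ (tangentVec m n u) = 0 :=
    fun m n hU => by
      by_contra hm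
      exact hns (isSmoothPoint_of_dRedMom ha hb hu h hS hD m n hU hm)
  have hA := h.a
  have hB := h.b
  simp only [relA, relB, hM2] at hA hB
  -- The vector V = M₂(α + S e₁) - M₁(β + S e₂) is the momentum gradient of the first relation. If
  -- V₃ = 0, varying M₃ alone would be allowed and would change D.
  have hV2 : mom u 1 * fa u 2 - mom u 0 * fb u 2 ≠ 0 := by
    intro hV
    have := key ![0, 0, 1] 0 (by simp [dRelA, dRelB, tangentVec]; linear_combination hV)
    simp [dRedMom, tangentVec] at this
  set V0 := mom u 1 * (fa u 0 + S) - mom u 0 * fb u 0 with hV0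
  set V1 := mom u 1 * fa u 1 - mom u 0 * (fb u 1 + S) with hV1
  set V2 := mom u 1 * fa u 2 - mom u 0 * fb u 2 with hV2'
  -- The test vector is orthogonal to V, and its third component is the squared length of the
  -- horizontal part of V.
  have hVh : V0 ^ 2 + V1 ^ 2 = 0 := by
    have := key ![-V0 * V2, -V1 * V2, V0 ^ 2 + V1 ^ 2] 0 (by
      simp [dRelA, dRelB, tangentVec]
      rw [hV0, hV1, hV2']; ring)
    simpa [dRedMom, tangentVec] using this
  have hV0z : V0 = 0 := by nlinarith [sq_nonneg V0, sq_nonneg V1]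
  have hV1z : V1 = 0 := by nlinarith [sq_nonneg V0, sq_nonneg V1]
  rw [hV0] at hV0z
  rw [hV1] at hV1z
  have hY : fa u 0 + fb u 1 + 2 * S = 0 := by
    have : planarSq u * (fa u 0 + fb u 1 + 2 * S) = 0 := by
      simp only [planarSq]
      linear_combination mom u 0 * hA + mom u 1 * hB - mom u 0 * hV1z + mom u 1 * hV0z
    exact (mul_eq_zero.1 this).resolve_left hW
  -- Rotations about the three axes, each compensated in the momentum so as to stay in the kernel of
  -- the first relation.
  have k1 := key ![0, 0, -mom u 1] ![1, 0, 0] (by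
    simp [dRelA, dRelB, tangentVec, hM2])
  have k2 := key ![0, 0, mom u 0] ![0, 1, 0] (by
    simp [dRelA, dRelB, tangentVec, hM2])
  have k3 := key ![mom u 1, -mom u 0, -S * planarSq u / V2] ![0, 0, 1] (by
    simp [dRelA, dRelB, tangentVec, hM2]
    have : S * planarSq u / V2 * V2 = S * planarSq u := by field_simp
    rw [hV2'] at this
    simp only [planarSq] at *
    linear_combination -this)
  simp [dRedMom, tangentVec] at k1 k2 k3
  have hWe : planarSq u = -2 * ε₁ * V2 := by
    simp only [planarSq]
    rw [hV2']
    linear_combination -2 * mom u 1 * k1 + 2 * mom u 0 * k2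
  have hε : ε₁ ≠ 0 := by
    rintro rfl
    exact hW (by rw [hWe]; ring)
  have : ε₁ * (fa u 0 + fb u 1 + S) = 0 := by
    rw [hWe] at k3
    field_simp at k3
    linear_combination k3
  have h5 := (mul_eq_zero.1 this).resolve_left hε
  exact hS (by linear_combination hY - h5)

/-- With ε₀ = S = 0 only the term -σ D `planarSq` survives. A momentum variation in the span of α
and β produces σ = a²b². -/
theorem isSmoothPoint_of_S_eq_zero (ha : a ≠ 0) (hb : b ≠ 0)
    (hu : u ∈ relationSet 0 ε₁ lam a b) (h : Rel 0 ε₁ lam 0 u) (hD : redMom ε₁ lam u ≠ 0) :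
    IsSmoothPoint (setM₃ 0 ε₁ lam a b) 4 u := by
  obtain ⟨hp, hW, -⟩ := mem_relationSet_iff.1 hu
  obtain ⟨h1, h2, h3⟩ := mem_phaseSpace_iff.1 hp
  simp only [sqA, sqB, dotAB] at h1 h2 h3
  refine isSmoothPoint_of_tangentVec ha hb hu h
    (fun i => -(mom u 0 * b ^ 2 * fa u i + mom u 1 * a ^ 2 * fb u i)) 0 (a ^ 2 * b ^ 2) ?_ ?_ ?_
  · simp [dRelA, tangentVec]
    linear_combination -mom u 0 * b ^ 2 * h1 - mom u 1 * a ^ 2 * h3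
  · simp [dRelB, tangentVec]
    linear_combination -mom u 1 * a ^ 2 * h2 - mom u 0 * b ^ 2 * h3
  · simp [ha, hb, hD, hW]

/-- For `ε₀ ≠ 0` and `D = 0` the points that are not smooth form a small explicit family. -/
theorem isSmoothPoint_or_axis (hb : 0 < b) (hab : b < a) (hε : ε₀ ≠ 0)
    (hu : u ∈ relationSet ε₀ ε₁ lam a b) (h : Rel ε₀ ε₁ lam S u) (hD : redMom ε₁ lam u = 0) :
    IsSmoothPoint (setM₃ ε₀ ε₁ lam a b) 4 u ∨ (lam = 0 ∧ mom u 0 = 0 ∧ mom u 2 = 0 ∧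
      fa u 0 = -S ∧ fa u 1 = 0 ∧ fb u 0 = 0 ∧ fb u 1 = -S ∧ fb u 2 = 0) := by
  have hb0 : b ≠ 0 := hb.ne'
  have ha0 : a ≠ 0 := (hb.trans hab).ne'
  by_contra! hcon
  obtain ⟨hns, hcon⟩ := hcon
  obtain ⟨hp, hW, -⟩ := mem_relationSet_iff.1 hu
  obtain ⟨h1, h2, h3⟩ := mem_phaseSpace_iff.1 hp
  have hS := h.S_ne_zero hp ha0 hb0 hε
  have hM2 : mom u 2 = 0 := by
    by_contra hM
    exact hns (isSmoothPoint_of_radial ha0 hb0 hu h hS (by rw [hD]; simpa using hM))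
  have hx : crossX S u = 0 := by simpa [relX, hD, hε] using h.x
  have hy : crossY S u = 0 := by simpa [relY, hD, hε] using h.y
  simp only [crossX, crossY, sqA, sqB, dotAB] at *
  -- Since two components of the product of the shifted fields vanish, the test vector is orthogonal
  -- to both of them. It has non-zero third component unless α + S e₁ is vertical; the same argument
  -- then treats β + S e₂.
  have eA : (fa u 0 + S) ^ 2 + fa u 1 ^ 2 = 0 := by
    by_contra hne
    refine hns (isSmoothPoint_of_orthogonal ha0 hb0 hu h hS hD
      ![-(fa u 0 + S) * fa u 2, -fa u 1 * fa u 2, (fa u 0 + S) ^ 2 + fa u 1 ^ 2] ?_ ?_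
      (by simpa using hne))
    · simp; ring
    · simp; linear_combination -(fa u 0 + S) * hy + fa u 1 * hx
  have eB : fb u 0 ^ 2 + (fb u 1 + S) ^ 2 = 0 := by
    by_contra hne
    refine hns (isSmoothPoint_of_orthogonal ha0 hb0 hu h hS hD
      ![-fb u 0 * fb u 2, -(fb u 1 + S) * fb u 2, fb u 0 ^ 2 + (fb u 1 + S) ^ 2] ?_ ?_
      (by simpa using hne))
    · simp; linear_combination fb u 0 * hy - (fb u 1 + S) * hx
    · simp; ring
  have a0 : fa u 0 = -S := by nlinarith [sq_nonneg (fa u 0 + S), sq_nonneg (fa u 1)]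
  have a1 : fa u 1 = 0 := by nlinarith [sq_nonneg (fa u 0 + S), sq_nonneg (fa u 1)]
  have b1 : fb u 1 = -S := by nlinarith [sq_nonneg (fb u 1 + S), sq_nonneg (fb u 0)]
  have b0 : fb u 0 = 0 := by nlinarith [sq_nonneg (fb u 1 + S), sq_nonneg (fb u 0)]
  -- Orthogonality gives α₃ β₃ = 0. If β₃ ≠ 0, then a² = S² < S² + β₃² = b², against b < a.
  have b2 : fb u 2 = 0 := by
    by_contra hne
    have : fa u 2 = 0 := by
      rw [a1, b0] at h3
      have : fa u 2 * fb u 2 = 0 := by linear_combination h3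
      exact (mul_eq_zero.1 this).resolve_right hne
    rw [a0, a1, this] at h1
    rw [b0, b1] at h2
    nlinarith [sq_nonneg (fb u 2)]
  have hl : lam = 0 := by
    simp only [redMom, hM2, a1, b0] at hD
    linear_combination -hD
  by_cases hM0 : mom u 0 = 0
  · exact hcon hl hM0 hM2 a0 a1 b0 b1 b2
  -- A rotation about e₂ compensated by δM₃ = M₁ keeps the orthogonality relations and changes D by
  -- M₁/2.
  · refine hns (isSmoothPoint_of_tangentVec ha0 hb0 hu h ![0, 0, mom u 0] ![0, 1, 0] 0 ?_ ?_ ?_)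
    · simp [dRelA, tangentVec, hM2]
    · simp [dRelB, tangentVec, hM2, b2]
    · rw [hD]
      simp [dCrossX, dCrossY, dRedMom, tangentVec, a0, a1, b0, b1, b2, hS, hW, hM0]

/-- The points of the relation set that are not known to be smooth. -/
theorem isSmoothPoint_or (hb : 0 < b) (hab : b < a)
    (hu : u ∈ relationSet ε₀ ε₁ lam a b) (h : Rel ε₀ ε₁ lam S u) :
    IsSmoothPoint (setM₃ ε₀ ε₁ lam a b) 4 u ∨
    (ε₀ ≠ 0 ∧ redMom ε₁ lam u ≠ 0 ∧ mom u 2 = -2 * redMom ε₁ lam u ∧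
      ε₀ * (fa u 0 + fb u 1 + 2 * S) = -2 * redMom ε₁ lam u ^ 2) ∨
    (ε₀ ≠ 0 ∧ lam = 0 ∧ mom u 0 = 0 ∧ mom u 2 = 0 ∧
      fa u 0 = -S ∧ fa u 1 = 0 ∧ fb u 0 = 0 ∧ fb u 1 = -S ∧ fb u 2 = 0) ∨
    (ε₀ = 0 ∧ S = 0 ∧ redMom ε₁ lam u = 0) := by
  have hb0 : b ≠ 0 := hb.ne'
  have ha0 : a ≠ 0 := (hb.trans hab).ne'
  by_cases hε : ε₀ = 0
  · subst hε
    by_cases hS : S = 0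
    · subst hS
      by_cases hD : redMom ε₁ lam u = 0
      · exact Or.inr (Or.inr (Or.inr ⟨rfl, rfl, hD⟩))
      · exact Or.inl (isSmoothPoint_of_S_eq_zero ha0 hb0 hu h hD)
    · exact Or.inl (isSmoothPoint_of_S_ne_zero ha0 hb0 hu h hS)
  · by_cases hD : redMom ε₁ lam u = 0
    · rcases isSmoothPoint_or_axis hb hab hε hu h hD with h1 | h1
      · exact Or.inl h1
      · exact Or.inr (Or.inr (Or.inl ⟨hε, h1⟩))
    · have hS := h.S_ne_zero (mem_relationSet_iff.1 hu).1 ha0 hb0 hε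
      by_cases h1 : mom u 2 / 2 + redMom ε₁ lam u = 0
      · by_cases h2 : ε₀ * (fa u 0 + fb u 1 + 2 * S) + 2 * redMom ε₁ lam u ^ 2 = 0
        · exact Or.inr (Or.inl ⟨hε, hD, by linear_combination 2 * h1, by linear_combination h2⟩)
        · exact Or.inl (isSmoothPoint_of_trace ha0 hb0 hu h hS hε h2)
      · exact Or.inl (isSmoothPoint_of_radial ha0 hb0 hu h hS h1)

end Criteria


/-! ### Density of the smooth points -/

/-- The rotation of `v` with the Cayley parameters `t n`, where `ρ (1 + t² n·n) = 2 t`. -/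
def cayley (ρ t : ℝ) (n v : Fin 3 → ℝ) : Fin 3 → ℝ :=
  ![v 0 + ρ * (n 1 * v 2 - n 2 * v 1
      + t * (n 0 * (n 0 * v 0 + n 1 * v 1 + n 2 * v 2) - (n 0 ^ 2 + n 1 ^ 2 + n 2 ^ 2) * v 0)),
    v 1 + ρ * (n 2 * v 0 - n 0 * v 2
      + t * (n 1 * (n 0 * v 0 + n 1 * v 1 + n 2 * v 2) - (n 0 ^ 2 + n 1 ^ 2 + n 2 ^ 2) * v 1)),
    v 2 + ρ * (n 0 * v 1 - n 1 * v 0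
      + t * (n 2 * (n 0 * v 0 + n 1 * v 1 + n 2 * v 2) - (n 0 ^ 2 + n 1 ^ 2 + n 2 ^ 2) * v 2))]

/-- Rodrigues' formula with a rational parameter: orthogonality becomes a polynomial consequence of
the single equation for ρ. -/
theorem cayley_dot {ρ t : ℝ} {n : Fin 3 → ℝ}
    (hρ : ρ * (1 + t ^ 2 * (n 0 ^ 2 + n 1 ^ 2 + n 2 ^ 2)) = 2 * t) (v w : Fin 3 → ℝ) :
    cayley ρ t n v 0 * cayley ρ t n w 0 + cayley ρ t n v 1 * cayley ρ t n w 1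
      + cayley ρ t n v 2 * cayley ρ t n w 2 = v 0 * w 0 + v 1 * w 1 + v 2 * w 2 := by
  simp only [cayley, Matrix.cons_val_zero, Matrix.cons_val_one, Matrix.cons_val]
  linear_combination ρ * ((n 0 ^ 2 + n 1 ^ 2 + n 2 ^ 2) * (v 0 * w 0 + v 1 * w 1 + v 2 * w 2)
    - (n 0 * v 0 + n 1 * v 1 + n 2 * v 2) * (n 0 * w 0 + n 1 * w 1 + n 2 * w 2)) * hρ

theorem cayley_cross {ρ t : ℝ} {n : Fin 3 → ℝ}
    (hρ : ρ * (1 + t ^ 2 * (n 0 ^ 2 + n 1 ^ 2 + n 2 ^ 2)) = 2 * t) (v w : Fin 3 → ℝ) :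
    cayley ρ t n v 0 * cayley ρ t n w 1 - cayley ρ t n v 1 * cayley ρ t n w 0 =
      cayley ρ t n ![v 1 * w 2 - v 2 * w 1, v 2 * w 0 - v 0 * w 2, v 0 * w 1 - v 1 * w 0] 2 := by
  simp only [cayley, Matrix.cons_val_zero, Matrix.cons_val_one, Matrix.cons_val]
  linear_combination ρ * (n 0 * (v 1 * w 2 - v 2 * w 1) + n 1 * (v 2 * w 0 - v 0 * w 2)
    + n 2 * (v 0 * w 1 - v 1 * w 0)) * n 2 * hρ

/-- The coefficient `ρ` of the Cayley rotation. -/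
def cayleyCoeff (n : Fin 3 → ℝ) (t : ℝ) : ℝ :=
  2 * t / (1 + t ^ 2 * (n 0 ^ 2 + n 1 ^ 2 + n 2 ^ 2))

theorem cayley_denom_pos (n : Fin 3 → ℝ) (t : ℝ) :
    0 < 1 + t ^ 2 * (n 0 ^ 2 + n 1 ^ 2 + n 2 ^ 2) := by positivity

theorem cayleyCoeff_mul (n : Fin 3 → ℝ) (t : ℝ) :
    cayleyCoeff n t * (1 + t ^ 2 * (n 0 ^ 2 + n 1 ^ 2 + n 2 ^ 2)) = 2 * t :=
  div_mul_cancel₀ _ (cayley_denom_pos n t).ne'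

theorem cayleyCoeff_pos (n : Fin 3 → ℝ) {t : ℝ} (ht : 0 < t) : 0 < cayleyCoeff n t :=
  div_pos (by linarith) (cayley_denom_pos n t)

theorem cayleyCoeff_zero (n : Fin 3 → ℝ) : cayleyCoeff n 0 = 0 := by simp [cayleyCoeff]

theorem continuous_cayleyCoeff (n : Fin 3 → ℝ) : Continuous (cayleyCoeff n) := by
  unfold cayleyCoeff
  exact Continuous.div (by fun_prop) (by fun_prop) fun t => (cayley_denom_pos n t).ne'

theorem continuous_cayley (n v : Fin 3 → ℝ) :
    Continuous fun t => cayley (cayleyCoeff n t) t n v := by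
  have := continuous_cayleyCoeff n
  refine continuous_pi fun i => ?_
  fin_cases i <;> simp [cayley] <;> fun_prop

theorem cayley_zero (t : ℝ) (n v : Fin 3 → ℝ) : cayley 0 t n v = v := by
  ext i
  fin_cases i <;> simp [cayley]

/-- Cayley rotation of the fields. -/
def rotFields (n : Fin 3 → ℝ) (t : ℝ) (u : Phase) : Phase :=
  (mom u, cayley (cayleyCoeff n t) t n (fa u), cayley (cayleyCoeff n t) t n (fb u))

/-- Cayley rotation of all three vectors. -/
def rotAll (n : Fin 3 → ℝ) (t : ℝ) (u : Phase) : Phase :=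
  (cayley (cayleyCoeff n t) t n (mom u), cayley (cayleyCoeff n t) t n (fa u),
    cayley (cayleyCoeff n t) t n (fb u))

theorem continuous_rotFields (n : Fin 3 → ℝ) (u : Phase) : Continuous fun t => rotFields n t u :=
  continuous_const.prodMk ((continuous_cayley n _).prodMk (continuous_cayley n _))

theorem continuous_rotAll (n : Fin 3 → ℝ) (u : Phase) : Continuous fun t => rotAll n t u :=
  (continuous_cayley n _).prodMk ((continuous_cayley n _).prodMk (continuous_cayley n _))

theorem rotFields_zero (n : Fin 3 → ℝ) (u : Phase) : rotFields n 0 u = u := by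
  simp [rotFields, cayleyCoeff_zero, cayley_zero]

theorem rotAll_zero (n : Fin 3 → ℝ) (u : Phase) : rotAll n 0 u = u := by
  simp [rotAll, cayleyCoeff_zero, cayley_zero]

theorem rotFields_mem_phaseSpace {a b : ℝ} {u : Phase} (hu : u ∈ phaseSpace a b)
    (n : Fin 3 → ℝ) (t : ℝ) : rotFields n t u ∈ phaseSpace a b := by
  rw [mem_phaseSpace_iff] at hu ⊢
  obtain ⟨h1, h2, h3⟩ := hu
  have e1 := cayley_dot (cayleyCoeff_mul n t) (fa u) (fa u)
  have e2 := cayley_dot (cayleyCoeff_mul n t) (fb u) (fb u)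
  have e3 := cayley_dot (cayleyCoeff_mul n t) (fa u) (fb u)
  simp only [sqA, sqB, dotAB, rotFields, fa_mk, fb_mk] at *
  exact ⟨by linear_combination e1 + h1, by linear_combination e2 + h2,
    by linear_combination e3 + h3⟩

theorem rotAll_mem_phaseSpace {a b : ℝ} {u : Phase} (hu : u ∈ phaseSpace a b)
    (n : Fin 3 → ℝ) (t : ℝ) : rotAll n t u ∈ phaseSpace a b := by
  have := rotFields_mem_phaseSpace hu n t
  rw [mem_phaseSpace_iff] at this ⊢
  exact this

/-! ### Fold points: the momentum as a root for given fields and S -/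

/-- The quantity `λ + ε₁ (α₂ - β₁)`. -/
def coupling (ε₁ lam : ℝ) (u : Phase) : ℝ := lam + ε₁ * (fa u 1 - fb u 0)

/-- The discriminant of the equation for the factor `ν` in `M = (α + S e₁) × (β + S e₂) / ν`. -/
def relDisc (ε₀ ε₁ lam S : ℝ) (u : Phase) : ℝ :=
  S ^ 2 * coupling ε₁ lam u ^ 2 + 2 * ε₀ * S * crossZ S u

/-- The larger root of the equation for the factor `ν`. -/
def relRoot (ε₀ ε₁ lam S : ℝ) (u : Phase) : ℝ :=
  (-S * coupling ε₁ lam u + √(relDisc ε₀ ε₁ lam S u)) / (2 * ε₀)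

/-- The point with given fields and `S` whose momentum is determined by the relations. -/
def relPoint (ε₀ ε₁ lam S : ℝ) (u : Phase) : Phase :=
  (![crossX S u / relRoot ε₀ ε₁ lam S u, crossY S u / relRoot ε₀ ε₁ lam S u,
    crossZ S u / relRoot ε₀ ε₁ lam S u], fa u, fb u)

section Points

variable {ε₀ ε₁ lam a b S : ℝ} {u : Phase}

theorem relRoot_eq (hε : ε₀ ≠ 0) (hd : 0 ≤ relDisc ε₀ ε₁ lam S u) :
    2 * ε₀ * relRoot ε₀ ε₁ lam S u ^ 2 + 2 * S * coupling ε₁ lam u * relRoot ε₀ ε₁ lam S u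
      - S * crossZ S u = 0 := by
  have hs := Real.sq_sqrt hd
  set r := √(relDisc ε₀ ε₁ lam S u) with hr
  have e : relRoot ε₀ ε₁ lam S u = (-S * coupling ε₁ lam u + r) / (2 * ε₀) := rfl
  rw [e]
  simp only [relDisc] at hs
  field_simp
  linear_combination hs

/-- Orthogonality is automatic for M = (α + S e₁) × (β + S e₂) / ν. The vector relation becomes S D
= ε₀ ν, which is quadratic in ν because M₃ enters D. -/
theorem relPoint_rel (hε : ε₀ ≠ 0) (hd : 0 ≤ relDisc ε₀ ε₁ lam S u)
    (hν : relRoot ε₀ ε₁ lam S u ≠ 0) : Rel ε₀ ε₁ lam S (relPoint ε₀ ε₁ lam S u) := by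
  have h := relRoot_eq hε hd
  have hD : S * redMom ε₁ lam (relPoint ε₀ ε₁ lam S u) = ε₀ * relRoot ε₀ ε₁ lam S u := by
    simp only [redMom, relPoint, mom_mk, fa_mk, fb_mk, Matrix.cons_val]
    simp only [coupling] at h
    field_simp
    linear_combination -h
  refine ⟨?_, ?_, ?_, ?_, ?_⟩
  · simp only [relA, relPoint, mom_mk, fa_mk, Matrix.cons_val_zero, Matrix.cons_val_one,
      Matrix.cons_val, crossX, crossY, crossZ]
    field_simp
    ring
  · simp only [relB, relPoint, mom_mk, fb_mk, Matrix.cons_val_zero, Matrix.cons_val_one,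
      Matrix.cons_val, crossX, crossY, crossZ]
    field_simp
    ring
  · rw [relX, hD]
    simp only [relPoint, mom_mk, fa_mk, fb_mk, Matrix.cons_val_zero, crossX]
    field_simp
    ring
  · rw [relY, hD]
    simp only [relPoint, mom_mk, fa_mk, fb_mk, Matrix.cons_val_zero, Matrix.cons_val_one, crossY]
    field_simp
    ring
  · rw [relZ, hD]
    simp only [relPoint, mom_mk, fa_mk, fb_mk, Matrix.cons_val, crossZ]
    field_simp
    ring

/-- By the quadratic equation, failure of the radial criterion would make ν a double root, hence the
discriminant zero. -/
theorem relPoint_isSmoothPoint (ha : a ≠ 0) (hb : b ≠ 0) (hε : ε₀ ≠ 0) (hS : S ≠ 0)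
    (hu : u ∈ phaseSpace a b) (hd : 0 < relDisc ε₀ ε₁ lam S u)
    (hν : relRoot ε₀ ε₁ lam S u ≠ 0) (hW : planarSq (relPoint ε₀ ε₁ lam S u) ≠ 0) :
    IsSmoothPoint (setM₃ ε₀ ε₁ lam a b) 4 (relPoint ε₀ ε₁ lam S u) := by
  have hR := relPoint_rel hε hd.le hν
  refine isSmoothPoint_of_radial ha hb
    (mem_relationSet_iff.2 ⟨by rwa [mem_phaseSpace_iff] at hu ⊢, hW, S, hR⟩) hR hS ?_
  intro h0
  have h := relRoot_eq hε hd.le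
  have e : 2 * ε₀ * relRoot ε₀ ε₁ lam S u + S * coupling ε₁ lam u
      = √(relDisc ε₀ ε₁ lam S u) := by
    rw [relRoot]; field_simp; ring
  have : √(relDisc ε₀ ε₁ lam S u) = 0 := by
    rw [← e]
    simp only [redMom, relPoint, mom_mk, fa_mk, fb_mk, Matrix.cons_val] at h0
    simp only [coupling] at h ⊢
    field_simp at h0
    have h2 : relRoot ε₀ ε₁ lam S u * (2 * ε₀ * relRoot ε₀ ε₁ lam S u
        + S * (lam + ε₁ * (fa u 1 - fb u 0))) = 0 := by
      linear_combination h + S * h0 / 2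
    exact (mul_eq_zero.1 h2).resolve_left hν
  exact (Real.sqrt_pos.2 hd).ne' this

theorem continuous_relDisc (ε₀ ε₁ lam : ℝ) :
    Continuous fun q : ℝ × Phase => relDisc ε₀ ε₁ lam q.1 q.2 := by
  unfold relDisc coupling crossZ fa fb; fun_prop

theorem continuous_relRoot (ε₀ ε₁ lam : ℝ) :
    Continuous fun q : ℝ × Phase => relRoot ε₀ ε₁ lam q.1 q.2 := by
  have := continuous_relDisc ε₀ ε₁ lam
  unfold relRoot coupling fa fb; fun_prop

theorem continuousAt_relPoint (ε₀ ε₁ lam : ℝ) {q : ℝ × Phase}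
    (hq : relRoot ε₀ ε₁ lam q.1 q.2 ≠ 0) :
    ContinuousAt (fun q : ℝ × Phase => relPoint ε₀ ε₁ lam q.1 q.2) q := by
  have hr := (continuous_relRoot ε₀ ε₁ lam).continuousAt (x := q)
  have hx : Continuous fun q : ℝ × Phase => crossX q.1 q.2 := by unfold crossX fa fb; fun_prop
  have hy : Continuous fun q : ℝ × Phase => crossY q.1 q.2 := by unfold crossY fa fb; fun_prop
  have hz : Continuous fun q : ℝ × Phase => crossZ q.1 q.2 := by unfold crossZ fa fb; fun_prop
  refine ContinuousAt.prodMk (continuousAt_pi.2 fun i => ?_) (by fun_prop)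
  fin_cases i
  · exact hx.continuousAt.div hr hq
  · exact hy.continuousAt.div hr hq
  · exact hz.continuousAt.div hr hq

/-- A fold point is a limit of smooth points if the discriminant is positive along some
deformation of the fields and of `S`. -/
theorem mem_closure_of_relDisc_pos (ha : a ≠ 0) (hb : b ≠ 0) (hε : ε₀ ≠ 0) (hS : S ≠ 0)
    (hW : planarSq u ≠ 0) (hR : Rel ε₀ ε₁ lam S u) (hD : redMom ε₁ lam u ≠ 0)
    (hM : mom u 2 = -2 * redMom ε₁ lam u) {l : Filter ℝ} [l.NeBot] {F : ℝ → Phase} {s : ℝ → ℝ}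
    (hF : Filter.Tendsto F l (nhds u)) (hs : Filter.Tendsto s l (nhds S))
    (hp : ∀ᶠ t in l, F t ∈ phaseSpace a b) (hd : ∀ᶠ t in l, 0 < relDisc ε₀ ε₁ lam (s t) (F t)) :
    u ∈ closure {u | IsSmoothPoint (setM₃ ε₀ ε₁ lam a b) 4 u} := by
  have hc : coupling ε₁ lam u = -2 * redMom ε₁ lam u := by
    simp only [redMom, coupling] at *; linear_combination hM / 2
  have hx := hR.x
  have hy := hR.y
  have hz := hR.z
  simp only [relX, relY, relZ] at hx hy hz
  -- M₃ = -2D is exactly the double-root condition, so u is itself the point reconstructed from its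
  -- fields and S.
  have hd0 : relDisc ε₀ ε₁ lam S u = 0 := by
    rw [relDisc, hc]
    linear_combination 2 * S * hz + 2 * S ^ 2 * redMom ε₁ lam u * hM
  have hν : ε₀ * relRoot ε₀ ε₁ lam S u = S * redMom ε₁ lam u := by
    rw [relRoot, hd0, hc, Real.sqrt_zero]; field_simp; ring
  have hν0 : relRoot ε₀ ε₁ lam S u ≠ 0 := by
    intro h0
    rw [h0, mul_zero] at hν
    exact mul_ne_zero hS hD hν.symm
  have hpt : relPoint ε₀ ε₁ lam S u = u := by
    have cancel : ∀ x y : ℝ, ε₀ * x - S * redMom ε₁ lam u * y = 0 →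
        x / relRoot ε₀ ε₁ lam S u = y := by
      intro x y hxy
      rw [← hν] at hxy
      rw [div_eq_iff hν0]
      have : ε₀ * (x - y * relRoot ε₀ ε₁ lam S u) = 0 := by linear_combination hxy
      linear_combination (mul_eq_zero.1 this).resolve_left hε
    refine Prod.ext ?_ rfl
    ext i
    fin_cases i
    · exact cancel _ _ hx
    · exact cancel _ _ hy
    · exact cancel _ _ hz
  have hsF : Filter.Tendsto (fun t => (s t, F t)) l (nhds (S, u)) := hs.prodMk_nhds hF
  have hlim : Filter.Tendsto (fun t => relPoint ε₀ ε₁ lam (s t) (F t)) l (nhds u) := by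
    have := (continuousAt_relPoint ε₀ ε₁ lam (q := (S, u)) hν0).tendsto.comp hsF
    rwa [hpt] at this
  refine mem_closure_of_tendsto hlim ?_
  have ev1 : ∀ᶠ t in l, relRoot ε₀ ε₁ lam (s t) (F t) ≠ 0 :=
    ((continuous_relRoot ε₀ ε₁ lam).continuousAt.tendsto.comp hsF).eventually_ne hν0
  have ev2 : ∀ᶠ t in l, planarSq (relPoint ε₀ ε₁ lam (s t) (F t)) ≠ 0 :=
    (contDiff_planarSq.continuous.continuousAt.tendsto.comp hlim).eventually_ne hW
  filter_upwards [ev1, ev2, hs.eventually_ne hS, hp, hd] with t h1 h2 h3 h4 h5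
  exact relPoint_isSmoothPoint ha hb hε h3 h4 h5 h1 h2

/-- The increment of `α₂ - β₁` under a Cayley rotation, divided by `ρ`. -/
def couplingIncr (n : Fin 3 → ℝ) (t : ℝ) (u : Phase) : ℝ :=
  n 2 * (fa u 0 + fb u 1) - n 0 * fa u 2 - n 1 * fb u 2
    + t * (n 1 * (n 0 * fa u 0 + n 1 * fa u 1 + n 2 * fa u 2)
      - n 0 * (n 0 * fb u 0 + n 1 * fb u 1 + n 2 * fb u 2)
      - (n 0 ^ 2 + n 1 ^ 2 + n 2 ^ 2) * (fa u 1 - fb u 0))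

/-- Minus the gradient of `(α × β)₃ + S (α₁ + β₂) + κ (α₂ - β₁)` with respect to rotations. -/
def foldTorque (S κ : ℝ) (u : Phase) : Fin 3 → ℝ :=
  ![-crossY 0 u + S * fb u 2 + κ * fa u 2, crossX 0 u - S * fa u 2 + κ * fb u 2,
    S * (fa u 1 - fb u 0) - κ * (fa u 0 + fb u 1)]

/-- The second order term of `(α × β)₃ + S (α₁ + β₂) + κ (α₂ - β₁)` under a Cayley rotation. -/
def foldHessian (S κ : ℝ) (n : Fin 3 → ℝ) (u : Phase) : ℝ :=
  n 2 * (n 0 * crossX 0 u + n 1 * crossY 0 u + n 2 * crossZ 0 u)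
    + (S * n 0 + κ * n 1) * (n 0 * fa u 0 + n 1 * fa u 1 + n 2 * fa u 2)
    + (S * n 1 - κ * n 0) * (n 0 * fb u 0 + n 1 * fb u 1 + n 2 * fb u 2)
    - (n 0 ^ 2 + n 1 ^ 2 + n 2 ^ 2)
      * (crossZ 0 u + S * (fa u 0 + fb u 1) + κ * (fa u 1 - fb u 0))

/-- The discriminant along a rotation of the fields. -/
theorem relDisc_rotFields {D κ : ℝ} (hκ : ε₀ * κ = S * (-2 * D) * ε₁)
    (hL : lam + ε₁ * (fa u 1 - fb u 0) = -2 * D) (hz : ε₀ * crossZ S u + 2 * S * D ^ 2 = 0)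
    (n : Fin 3 → ℝ) (t : ℝ) : relDisc ε₀ ε₁ lam S (rotFields n t u) =
      S * cayleyCoeff n t * (2 * ε₀ * (t * foldHessian S κ n u - (n 0 * foldTorque S κ u 0
          + n 1 * foldTorque S κ u 1 + n 2 * foldTorque S κ u 2))
        + S * ε₁ ^ 2 * cayleyCoeff n t * couplingIncr n t u ^ 2) := by
  obtain rfl : lam = -2 * D - ε₁ * (fa u 1 - fb u 0) := by linear_combination hL
  have hc := cayley_cross (cayleyCoeff_mul n t) (fa u) (fb u)
  simp only [relDisc, coupling, rotFields, fa_mk, fb_mk]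
  simp only [crossZ] at hz ⊢
  simp only [fa_mk, fb_mk, hc]
  generalize cayleyCoeff n t = ρ
  simp only [cayley, foldTorque, foldHessian, couplingIncr, crossX, crossY, crossZ,
    Matrix.cons_val_zero, Matrix.cons_val_one, Matrix.cons_val]
  linear_combination 2 * S * hz - 2 * S * ρ *
    (n 2 * (fa u 0 + fb u 1) - n 0 * fa u 2 - n 1 * fb u 2
            + t * (n 1 * (n 0 * fa u 0 + n 1 * fa u 1 + n 2 * fa u 2)
              - n 0 * (n 0 * fb u 0 + n 1 * fb u 1 + n 2 * fb u 2)
              - (n 0 ^ 2 + n 1 ^ 2 + n 2 ^ 2) * (fa u 1 - fb u 0))) * hκ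

/-- κ linearizes the squared coupling in the discriminant. Rotating along the torque, minus the
gradient, changes the discriminant to first order by -2 ε₀ S ρ |n|², which is positive since S < 0.
-/
theorem relDisc_pos_of_foldTorque_ne {D κ : ℝ} (hε : 0 < ε₀) (hS : S < 0)
    (hκ : ε₀ * κ = S * (-2 * D) * ε₁)
    (hL : lam + ε₁ * (fa u 1 - fb u 0) = -2 * D) (hz : ε₀ * crossZ S u + 2 * S * D ^ 2 = 0)
    (hT : foldTorque S κ u 0 ^ 2 + foldTorque S κ u 1 ^ 2 + foldTorque S κ u 2 ^ 2 ≠ 0) :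
    ∀ᶠ t in nhdsWithin 0 (Set.Ioi 0),
      0 < relDisc ε₀ ε₁ lam S (rotFields (foldTorque S κ u) t u) := by
  have disc := relDisc_rotFields hκ hL hz (foldTorque S κ u)
  generalize foldTorque S κ u = n at *
  have hTpos : 0 < n 0 ^ 2 + n 1 ^ 2 + n 2 ^ 2 := lt_of_le_of_ne (by positivity) (Ne.symm hT)
  have hgc : Continuous fun t : ℝ => 2 * ε₀ * (t * foldHessian S κ n u
      - (n 0 * n 0 + n 1 * n 1 + n 2 * n 2))
      + S * ε₁ ^ 2 * cayleyCoeff n t * couplingIncr n t u ^ 2 := by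
    have := continuous_cayleyCoeff n
    unfold couplingIncr
    fun_prop
  have hg0 : 2 * ε₀ * (0 * foldHessian S κ n u
      - (n 0 * n 0 + n 1 * n 1 + n 2 * n 2))
      + S * ε₁ ^ 2 * cayleyCoeff n 0 * couplingIncr n 0 u ^ 2 < 0 := by
    rw [cayleyCoeff_zero]
    nlinarith
  filter_upwards [((hgc.tendsto 0).mono_left nhdsWithin_le_nhds).eventually_lt_const hg0,
    self_mem_nhdsWithin] with t ht htpos
  rw [disc]
  exact mul_pos_of_neg_of_neg (mul_neg_of_neg_of_pos hS (cayleyCoeff_pos n htpos)) ht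

/-- The torque equations say that the matrix with rows (α₁ + S, β₁ - κ) and (α₂ + κ, β₂ + S)
annihilates (β₃, -α₃) ≠ 0. Its zero determinant evaluates the last bracket of the second-order term
as -(S² + κ²); the remaining terms then cancel. -/
theorem foldHessian_eq_zero {κ : ℝ} (hu : u ∈ phaseSpace a b)
    (t0 : -crossY 0 u + S * fb u 2 + κ * fa u 2 = 0)
    (t1 : crossX 0 u - S * fa u 2 + κ * fb u 2 = 0) (hζ : fa u 2 ^ 2 + fb u 2 ^ 2 ≠ 0) :
    foldHessian S κ ![-crossY 0 u, crossX 0 u, 0] u = 0 := by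
  obtain ⟨h1, h2, h3⟩ := mem_phaseSpace_iff.1 hu
  have hl : crossZ 0 u + S * (fa u 0 + fb u 1) + κ * (fa u 1 - fb u 0) = -(S ^ 2 + κ ^ 2) := by
    have : (fa u 2 ^ 2 + fb u 2 ^ 2) * (crossZ 0 u + S * (fa u 0 + fb u 1)
        + κ * (fa u 1 - fb u 0) + (S ^ 2 + κ ^ 2)) = 0 := by
      have r1 : fb u 2 * (fa u 1 + κ) - fa u 2 * (fb u 1 + S) = 0 := by
        simp only [crossX] at t1; linear_combination t1
      have r2 : fa u 2 * (fb u 0 - κ) - fb u 2 * (fa u 0 + S) = 0 := by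
        simp only [crossY] at t0; linear_combination -t0
      simp only [crossZ]
      linear_combination (-fa u 2 * (fa u 0 + S) - fb u 2 * (fb u 0 - κ)) * r1
        - (fa u 2 * (fa u 1 + κ) + fb u 2 * (fb u 1 + S)) * r2
    linear_combination (mul_eq_zero.1 this).resolve_left hζ
  have hp : -crossY 0 u * fa u 0 + crossX 0 u * fa u 1 = a ^ 2 * fb u 2 := by
    simp only [crossX, crossY, sqA, dotAB] at *
    linear_combination fb u 2 * h1 - fa u 2 * h3
  have hq : -crossY 0 u * fb u 0 + crossX 0 u * fb u 1 = -b ^ 2 * fa u 2 := by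
    simp only [crossX, crossY, sqB, dotAB] at *
    linear_combination fb u 2 * h3 - fa u 2 * h2
  have hN : crossX 0 u ^ 2 + crossY 0 u ^ 2 = a ^ 2 * fb u 2 ^ 2 + b ^ 2 * fa u 2 ^ 2 := by
    have e : crossX 0 u ^ 2 + crossY 0 u ^ 2 =
      fb u 2 * (-crossY 0 u * fa u 0 + crossX 0 u * fa u 1)
        - fa u 2 * (-crossY 0 u * fb u 0 + crossX 0 u * fb u 1) := by
      simp only [crossX, crossY]; ring
    rw [e, hp, hq]; ring
  simp only [foldHessian, Matrix.cons_val_zero, Matrix.cons_val_one, Matrix.cons_val]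
  rw [hl]
  linear_combination (S * -crossY 0 u + κ * crossX 0 u) * hp
    + (S * crossX 0 u + κ * crossY 0 u) * hq + (S ^ 2 + κ ^ 2) * hN
    + (S * a ^ 2 * fb u 2 + κ * b ^ 2 * fa u 2) * t0
    + (κ * a ^ 2 * fb u 2 - S * b ^ 2 * fa u 2) * t1

/-- At a critical position of the fields, the axis along e₃ × (α × β) kills the second-order term as
well. What is left of the discriminant is the square (S ε₁ ρ `couplingIncr`)². -/
theorem relDisc_pos_of_foldTorque_eq {D κ : ℝ} (hε : 0 < ε₀)
    (hu : u ∈ phaseSpace a b) (hW : planarSq u ≠ 0) (hR : Rel ε₀ ε₁ lam S u)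
    (hD : redMom ε₁ lam u ≠ 0) (hS : S ≠ 0) (hκ : ε₀ * κ = S * (-2 * D) * ε₁)
    (hL : lam + ε₁ * (fa u 1 - fb u 0) = -2 * D) (hz : ε₀ * crossZ S u + 2 * S * D ^ 2 = 0)
    (t0 : -crossY 0 u + S * fb u 2 + κ * fa u 2 = 0)
    (t1 : crossX 0 u - S * fa u 2 + κ * fb u 2 = 0)
    (t2 : S * (fa u 1 - fb u 0) - κ * (fa u 0 + fb u 1) = 0) :
    ∀ᶠ t in nhdsWithin 0 (Set.Ioi 0),
      0 < relDisc ε₀ ε₁ lam S (rotFields ![-crossY 0 u, crossX 0 u, 0] t u) := by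
  have hx := hR.x
  have hy := hR.y
  simp only [relX, relY] at hx hy
  have cX : crossX S u = crossX 0 u - S * fa u 2 := by simp only [crossX]; ring
  have cY : crossY S u = crossY 0 u - S * fb u 2 := by simp only [crossY]; ring
  -- With zero torque, S D (M₁, M₂) = ε₀ κ (-β₃, α₃), and the left side is non-zero.
  have hζκ : κ ^ 2 * (fa u 2 ^ 2 + fb u 2 ^ 2) ≠ 0 := by
    intro h0
    have e : (S * redMom ε₁ lam u) ^ 2 * planarSq u = 0 := by
      have ex : S * redMom ε₁ lam u * mom u 0 = -ε₀ * κ * fb u 2 := by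
        linear_combination -hx + ε₀ * t1 + ε₀ * cX
      have ey : S * redMom ε₁ lam u * mom u 1 = ε₀ * κ * fa u 2 := by
        linear_combination -hy - ε₀ * t0 + ε₀ * cY
      simp only [planarSq]
      linear_combination (S * redMom ε₁ lam u * mom u 0 - ε₀ * κ * fb u 2) * ex
        + (S * redMom ε₁ lam u * mom u 1 + ε₀ * κ * fa u 2) * ey + ε₀ ^ 2 * h0
    exact mul_ne_zero (pow_ne_zero 2 (mul_ne_zero hS hD)) hW e
  have hκ0 : κ ≠ 0 := by rintro rfl; simp at hζκ
  have hζ : fa u 2 ^ 2 + fb u 2 ^ 2 ≠ 0 := right_ne_zero_of_mul hζκ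
  have hε₁ : ε₁ ≠ 0 := by
    rintro rfl
    rw [mul_zero] at hκ
    exact mul_ne_zero hε.ne' hκ0 hκ
  have hX := foldHessian_eq_zero hu t0 t1 hζ
  have disc := relDisc_rotFields hκ hL hz ![-crossY 0 u, crossX 0 u, 0]
  have tz : foldTorque S κ u = 0 := by
    ext i
    fin_cases i
    · exact t0
    · exact t1
    · exact t2
  have hI : couplingIncr ![-crossY 0 u, crossX 0 u, 0] 0 u = κ * (fa u 2 ^ 2 + fb u 2 ^ 2) := by
    simp only [couplingIncr, Matrix.cons_val_zero, Matrix.cons_val_one, Matrix.cons_val]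
    linear_combination -fa u 2 * t0 - fb u 2 * t1
  generalize (![-crossY 0 u, crossX 0 u, 0] : Fin 3 → ℝ) = n at *
  have hcont : Continuous fun t : ℝ => couplingIncr n t u := by unfold couplingIncr; fun_prop
  have hne : ∀ᶠ t in nhdsWithin (0 : ℝ) (Set.Ioi 0), couplingIncr n t u ≠ 0 := by
    refine ((hcont.tendsto 0).mono_left nhdsWithin_le_nhds).eventually_ne ?_
    rw [hI]
    exact mul_ne_zero hκ0 hζ
  filter_upwards [hne, self_mem_nhdsWithin] with t ht htpos
  have hρ := (cayleyCoeff_pos n htpos).ne'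
  have e : relDisc ε₀ ε₁ lam S (rotFields n t u)
      = (S * ε₁ * cayleyCoeff n t * couplingIncr n t u) ^ 2 := by
    rw [disc, tz, hX]
    simp only [Pi.zero_apply]
    ring
  rw [e]
  positivity

theorem mem_closure_of_fold_of_neg (ha : a ≠ 0) (hb : b ≠ 0) (hε : 0 < ε₀)
    (hu : u ∈ phaseSpace a b) (hW : planarSq u ≠ 0) (hR : Rel ε₀ ε₁ lam S u)
    (hD : redMom ε₁ lam u ≠ 0) (hM : mom u 2 = -2 * redMom ε₁ lam u) (hS : S < 0) {D κ : ℝ}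
    (hκ : ε₀ * κ = S * (-2 * D) * ε₁)
    (hL : lam + ε₁ * (fa u 1 - fb u 0) = -2 * D) (hz : ε₀ * crossZ S u + 2 * S * D ^ 2 = 0) :
    u ∈ closure {u | IsSmoothPoint (setM₃ ε₀ ε₁ lam a b) 4 u} := by
  have close : ∀ n : Fin 3 → ℝ, (∀ᶠ t in nhdsWithin 0 (Set.Ioi 0),
      0 < relDisc ε₀ ε₁ lam S (rotFields n t u)) →
      u ∈ closure {u | IsSmoothPoint (setM₃ ε₀ ε₁ lam a b) 4 u} := fun n hn => by
    refine mem_closure_of_relDisc_pos ha hb hε.ne' hS.ne hW hR hD hM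
      (l := nhdsWithin 0 (Set.Ioi 0)) (F := fun t => rotFields n t u) ?_ tendsto_const_nhds
      (Filter.Eventually.of_forall fun t => rotFields_mem_phaseSpace hu n t) hn
    have := (continuous_rotFields n u).tendsto 0
    rw [rotFields_zero] at this
    exact this.mono_left nhdsWithin_le_nhds
  by_cases hT : foldTorque S κ u 0 ^ 2 + foldTorque S κ u 1 ^ 2 + foldTorque S κ u 2 ^ 2 = 0
  · refine close _ (relDisc_pos_of_foldTorque_eq hε hu hW hR hD hS.ne hκ hL hz ?_ ?_ ?_)
    · change foldTorque S κ u 0 = 0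
      nlinarith [sq_nonneg (foldTorque S κ u 0), sq_nonneg (foldTorque S κ u 1),
        sq_nonneg (foldTorque S κ u 2)]
    · change foldTorque S κ u 1 = 0
      nlinarith [sq_nonneg (foldTorque S κ u 0), sq_nonneg (foldTorque S κ u 1),
        sq_nonneg (foldTorque S κ u 2)]
    · change foldTorque S κ u 2 = 0
      nlinarith [sq_nonneg (foldTorque S κ u 0), sq_nonneg (foldTorque S κ u 1),
        sq_nonneg (foldTorque S κ u 2)]
  · exact close _ (relDisc_pos_of_foldTorque_ne hε hS hκ hL hz hT)

/-- The discriminant vanishes at the fold and must be made positive nearby. Changing S suffices when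
S > 0; for S < 0 that change has the wrong sign and the fields are rotated instead. -/
theorem mem_closure_of_fold (ha : a ≠ 0) (hb : b ≠ 0) (hε : 0 < ε₀)
    (hu : u ∈ phaseSpace a b) (hW : planarSq u ≠ 0) (hR : Rel ε₀ ε₁ lam S u)
    (hD : redMom ε₁ lam u ≠ 0) (hM : mom u 2 = -2 * redMom ε₁ lam u)
    (hY : ε₀ * (fa u 0 + fb u 1 + 2 * S) = -2 * redMom ε₁ lam u ^ 2) :
    u ∈ closure {u | IsSmoothPoint (setM₃ ε₀ ε₁ lam a b) 4 u} := by
  have hS := hR.S_ne_zero hu ha hb hε.ne'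
  have hx := hR.x
  have hy := hR.y
  have hz := hR.z
  simp only [relX, relY, relZ] at hx hy hz
  obtain ⟨D, hDD⟩ : ∃ D, D = redMom ε₁ lam u := ⟨_, rfl⟩
  have hL : lam + ε₁ * (fa u 1 - fb u 0) = -2 * D := by
    rw [hDD]; simp only [redMom] at *; linear_combination hM / 2
  have hz' : ε₀ * crossZ S u + 2 * S * D ^ 2 = 0 := by
    rw [hM, ← hDD] at hz
    linear_combination hz
  rcases lt_or_gt_of_ne hS with hneg | hpos
  · -- deform the fields by rotations
    obtain ⟨κ, hκ⟩ : ∃ κ, κ = S * (-2 * D) * ε₁ / ε₀ := ⟨_, rfl⟩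
    have hκ' : ε₀ * κ = S * (-2 * D) * ε₁ := by rw [hκ]; field_simp
    exact mem_closure_of_fold_of_neg ha hb hε hu hW hR hD hM hneg hκ' hL hz'
  · -- deform the value of `S`
    refine mem_closure_of_relDisc_pos ha hb hε.ne' hS hW hR hD hM (l := nhdsWithin 0 (Set.Ioi 0))
      (F := fun _ => u) (s := fun t => S + t) tendsto_const_nhds ?_
      (Filter.Eventually.of_forall fun _ => hu) ?_
    · have : Continuous fun t : ℝ => S + t := by fun_prop
      simpa using (this.tendsto 0).mono_left nhdsWithin_le_nhds
    · filter_upwards [self_mem_nhdsWithin] with t ht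
      -- The fold equation removes the constant term in t and the trace condition `hY` removes the
      -- linear one.
      have e : relDisc ε₀ ε₁ lam (S + t) u = 2 * ε₀ * (S + t) * t ^ 2 := by
        rw [← hDD] at hY
        simp only [relDisc, coupling, hL]
        simp only [crossZ] at *
        linear_combination 2 * (S + t) * hz' + 2 * (S + t) * t * hY
      rw [e]
      have : 0 < t := ht
      positivity

/-- Here α + S e₁ is vertical, β + S e₂ = 0 and M is horizontal, so M₁ can be changed freely within
the relations; M₁ ≠ 0 already leaves the exceptional family. -/
theorem mem_closure_of_axis (hb : 0 < b) (hab : b < a) (hε : ε₀ ≠ 0) (hu : u ∈ phaseSpace a b)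
    (hW : planarSq u ≠ 0) (hl : lam = 0) (h0 : mom u 0 = 0) (h2 : mom u 2 = 0)
    (a0 : fa u 0 = -S) (a1 : fa u 1 = 0) (b0 : fb u 0 = 0) (b1 : fb u 1 = -S) (b2 : fb u 2 = 0) :
    u ∈ closure {u | IsSmoothPoint (setM₃ ε₀ ε₁ lam a b) 4 u} := by
  have h1 : mom u 1 ≠ 0 := fun h => hW ((planarSq_eq_zero_iff u).2 ⟨h0, h⟩)
  set F : ℝ → Phase := fun t => (![t, mom u 1, 0], fa u, fb u) with hF
  have hFc : Continuous F := by
    refine Continuous.prodMk (continuous_pi fun i => ?_) continuous_const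
    fin_cases i <;> simp <;> fun_prop
  have hF0 : F 0 = u := by
    refine Prod.ext ?_ rfl
    ext i
    fin_cases i
    · exact h0.symm
    · rfl
    · exact h2.symm
  have hlim : Filter.Tendsto F (nhdsWithin 0 (Set.Ioi 0)) (nhds u) := by
    have := hFc.tendsto 0
    rw [hF0] at this
    exact this.mono_left nhdsWithin_le_nhds
  refine mem_closure_of_tendsto hlim ?_
  filter_upwards [self_mem_nhdsWithin] with t ht
  have ht0 : t ≠ 0 := ne_of_gt ht
  have m0 : mom (F t) 0 = t := rfl
  have m1 : mom (F t) 1 = mom u 1 := rfl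
  have m2 : mom (F t) 2 = 0 := rfl
  have hfa : fa (F t) = fa u := rfl
  have hfb : fb (F t) = fb u := rfl
  have hD : redMom ε₁ lam (F t) = 0 := by
    simp only [redMom, m2, hfa, hfb, hl, a1, b0]; ring
  have hR : Rel ε₀ ε₁ lam S (F t) := by
    refine ⟨?_, ?_, ?_, ?_, ?_⟩
    · simp only [relA, m0, m1, m2, hfa, a0, a1]; ring
    · simp only [relB, m0, m1, m2, hfb, b0, b1]; ring
    · simp only [relX, hD, crossX, hfa, hfb, a1, b1]; ring
    · simp only [relY, hD, crossY, hfa, hfb, b0, b2]; ring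
    · simp only [relZ, hD, crossZ, hfa, hfb, a0, a1, b1]; ring
  have hm : F t ∈ relationSet ε₀ ε₁ lam a b := by
    refine mem_relationSet_iff.2 ⟨?_, ?_, S, hR⟩
    · rw [mem_phaseSpace_iff] at hu ⊢; exact hu
    · intro hc
      exact ht0 ((planarSq_eq_zero_iff _).1 hc).1
  rcases isSmoothPoint_or_axis hb hab hε hm hR hD with h | h
  · exact h
  · exact absurd h.2.1 ht0

theorem rel_zero_of_orthogonal (hA : relA 0 u = 0) (hB : relB 0 u = 0) : Rel 0 ε₁ lam 0 u :=
  ⟨hA, hB, by simp [relX], by simp [relY], by simp [relZ]⟩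

/-- Scaling M keeps M orthogonal to both fields and changes D at the rate M₃/2, so D becomes
non-zero. -/
theorem mem_closure_of_orthogonal_of_ne (ha : a ≠ 0) (hb : b ≠ 0) (hu : u ∈ phaseSpace a b)
    (hW : planarSq u ≠ 0) (hA : relA 0 u = 0) (hB : relB 0 u = 0) (h2 : mom u 2 ≠ 0) :
    u ∈ closure {u | IsSmoothPoint (setM₃ 0 ε₁ lam a b) 4 u} := by
  by_cases hD : redMom ε₁ lam u = 0
  · set F : ℝ → Phase := fun t => ((1 + t) • mom u, fa u, fb u) with hF
    have hFc : Continuous F := by fun_prop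
    have hlim : Filter.Tendsto F (nhdsWithin 0 (Set.Ioi 0)) (nhds u) := by
      have := hFc.tendsto 0
      rw [show F 0 = u by simp [hF]] at this
      exact this.mono_left nhdsWithin_le_nhds
    refine mem_closure_of_tendsto hlim ?_
    filter_upwards [self_mem_nhdsWithin] with t ht
    have ht0 : 0 < t := ht
    have hm : ∀ i, mom (F t) i = (1 + t) * mom u i := fun i => rfl
    have hfa : fa (F t) = fa u := rfl
    have hfb : fb (F t) = fb u := rfl
    have hR : Rel 0 ε₁ lam 0 (F t) := by
      refine rel_zero_of_orthogonal ?_ ?_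
      · simp only [relA, hm, hfa] at hA ⊢; linear_combination (1 + t) * hA
      · simp only [relB, hm, hfb] at hB ⊢; linear_combination (1 + t) * hB
    have hWt : planarSq (F t) = (1 + t) ^ 2 * planarSq u := by
      simp only [planarSq, hm]; ring
    refine isSmoothPoint_of_S_eq_zero ha hb (mem_relationSet_iff.2 ⟨?_, ?_, 0, hR⟩) hR ?_
    · rw [mem_phaseSpace_iff] at hu ⊢; exact hu
    · rw [hWt]; positivity
    · have : redMom ε₁ lam (F t) = redMom ε₁ lam u + t * mom u 2 / 2 := by
        simp only [redMom, hm, hfa, hfb]; ring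
      rw [this, hD]
      have := ht0.ne'
      simp [this, h2]
  · have hR := rel_zero_of_orthogonal (ε₁ := ε₁) (lam := lam) hA hB
    exact subset_closure (isSmoothPoint_of_S_eq_zero ha hb
      (mem_relationSet_iff.2 ⟨hu, hW, 0, hR⟩) hR hD)

/-- When M₃ = 0, rotating all three vectors about the horizontal axis perpendicular to M preserves
orthogonality and makes M₃ non-zero. -/
theorem mem_closure_of_orthogonal (ha : a ≠ 0) (hb : b ≠ 0) (hu : u ∈ phaseSpace a b)
    (hW : planarSq u ≠ 0) (hA : relA 0 u = 0) (hB : relB 0 u = 0) :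
    u ∈ closure {u | IsSmoothPoint (setM₃ 0 ε₁ lam a b) 4 u} := by
  by_cases h2 : mom u 2 = 0
  · set n : Fin 3 → ℝ := ![mom u 1, -mom u 0, 0] with hn
    have hlim : Filter.Tendsto (fun t => rotAll n t u) (nhdsWithin 0 (Set.Ioi 0)) (nhds u) := by
      have := (continuous_rotAll n u).tendsto 0
      rw [rotAll_zero] at this
      exact this.mono_left nhdsWithin_le_nhds
    refine isClosed_closure.mem_of_tendsto hlim ?_
    have hWt : ∀ᶠ t in nhdsWithin (0 : ℝ) (Set.Ioi 0), planarSq (rotAll n t u) ≠ 0 :=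
      (contDiff_planarSq.continuous.continuousAt.tendsto.comp hlim).eventually_ne hW
    filter_upwards [hWt, self_mem_nhdsWithin] with t ht htpos
    have e1 := cayley_dot (cayleyCoeff_mul n t) (mom u) (fa u)
    have e2 := cayley_dot (cayleyCoeff_mul n t) (mom u) (fb u)
    refine mem_closure_of_orthogonal_of_ne ha hb (rotAll_mem_phaseSpace hu n t) ht ?_ ?_ ?_
    · simp only [relA, rotAll, mom_mk, fa_mk] at *
      linear_combination e1 + hA
    · simp only [relB, rotAll, mom_mk, fb_mk] at *
      linear_combination e2 + hB
    · have e : mom (rotAll n t u) 2 = cayleyCoeff n t * planarSq u := by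
        simp [rotAll, cayley, planarSq, h2, hn]
        ring_nf
        simp
      rw [e]
      exact mul_ne_zero (cayleyCoeff_pos n htpos).ne' hW
  · exact mem_closure_of_orthogonal_of_ne ha hb hu hW hA hB h2

/-- The smooth points are dense. -/
theorem setM₃_subset_closure (hε : 0 ≤ ε₀) (hb : 0 < b) (hab : b < a) :
    setM₃ ε₀ ε₁ lam a b ⊆ closure {u | IsSmoothPoint (setM₃ ε₀ ε₁ lam a b) 4 u} := by
  have hb0 : b ≠ 0 := hb.ne'
  have ha0 : a ≠ 0 := (hb.trans hab).ne'
  refine closure_minimal (fun u hu => ?_) isClosed_closure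
  obtain ⟨hp, hW, S, hS⟩ := mem_relationSet_iff.1 hu
  rcases isSmoothPoint_or hb hab hu hS with h | ⟨h0, h1, h2, h3⟩ | ⟨h0, h1, h2, h3, h4, h5, h6, h7⟩
    | ⟨rfl, rfl, -⟩
  · exact subset_closure h
  · exact mem_closure_of_fold ha0 hb0 (lt_of_le_of_ne hε (Ne.symm h0)) hp hW hS h1 h2 h3
  · exact mem_closure_of_axis hb hab h0 hp hW h1 h2 h3 h4 h5 h6 h7.1 h7.2
  · exact mem_closure_of_orthogonal ha0 hb0 hp hW hS.a hS.b

end Points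

end GTFG

/-! ### Sets of Hausdorff dimension at most three -/

/-- A set covered by the values of a map of a finite-dimensional space at points of
differentiability has at most the dimension of that space. -/
theorem dimH_le_finrank_of_param {E F : Type*} [NormedAddCommGroup E] [NormedSpace ℝ E]
    [FiniteDimensional ℝ E] [NormedAddCommGroup F] [NormedSpace ℝ F] {f : E → F} {Z : Set F}
    (h : ∀ u ∈ Z, ∃ x, ContDiffAt ℝ 1 f x ∧ f x = u) : dimH Z ≤ Module.finrank ℝ E := by
  have hsub : Z ⊆ f '' {x | ContDiffAt ℝ 1 f x} := fun u hu => by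
    obtain ⟨x, hx, rfl⟩ := h u hu
    exact ⟨x, hx, rfl⟩
  calc dimH Z ≤ dimH (f '' {x | ContDiffAt ℝ 1 f x}) := dimH_mono hsub
    _ ≤ dimH {x | ContDiffAt ℝ 1 f x} := dimH_image_le_of_locally_lipschitzOn fun x hx => by
        obtain ⟨C, t, ht, hC⟩ := ContDiffAt.exists_lipschitzOnWith (f := f) hx
        exact ⟨C, t, mem_nhdsWithin_of_mem_nhds ht, hC⟩
    _ ≤ dimH (Set.univ : Set E) := dimH_mono (Set.subset_univ _)
    _ = Module.finrank ℝ E := Real.dimH_univ_eq_finrank E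

theorem exists_polar {x y r : ℝ} (hr : 0 ≤ r) (h : x ^ 2 + y ^ 2 = r ^ 2) :
    ∃ θ, x = r * Real.cos θ ∧ y = r * Real.sin θ := by
  have hn : ‖(⟨x, y⟩ : ℂ)‖ = r := by
    rw [← sq_eq_sq₀ (norm_nonneg _) hr, ← Complex.normSq_eq_norm_sq, Complex.normSq_mk, ← h]
    ring
  refine ⟨Complex.arg ⟨x, y⟩, ?_, ?_⟩
  · rw [← hn, Complex.norm_mul_cos_arg]
  · rw [← hn, Complex.norm_mul_sin_arg]

namespace GTFG

/-- The dimension bound used for all exceptional sets. -/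
theorem dimH_le_three {f : ℝ × ℝ × ℝ → Phase} {Z : Set Phase}
    (h : ∀ u ∈ Z, ∃ x, ContDiffAt ℝ 1 f x ∧ f x = u) : dimH Z ≤ 3 := by
  have := dimH_le_finrank_of_param h
  simpa using this

/-- Pairs of orthogonal vectors of lengths `a` and `b` in terms of Euler angles. -/
def frameParam (a b : ℝ) (x : ℝ × ℝ × ℝ) : Phase :=
  (0, ![a * (Real.sin x.1 * Real.cos x.2.1), a * (Real.sin x.1 * Real.sin x.2.1),
      a * Real.cos x.1],
    ![b * (Real.cos x.2.2 * (Real.cos x.1 * Real.cos x.2.1) - Real.sin x.2.2 * Real.sin x.2.1),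
      b * (Real.cos x.2.2 * (Real.cos x.1 * Real.sin x.2.1) + Real.sin x.2.2 * Real.cos x.2.1),
      -(b * (Real.cos x.2.2 * Real.sin x.1))])

theorem contDiff_frameParam (a b : ℝ) : ContDiff ℝ 1 (frameParam a b) := by
  refine ContDiff.prodMk contDiff_const (ContDiff.prodMk ?_ ?_) <;>
    refine contDiff_pi.2 fun i => ?_ <;> fin_cases i <;> simp <;> fun_prop

/-- Spherical angles give α; the third angle places β on the circle of radius b in the plane
orthogonal to α. -/
theorem exists_frameParam {a b : ℝ} (ha : 0 < a) (hb : 0 < b) {u : Phase}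
    (hu : u ∈ phaseSpace a b) : ∃ x, frameParam a b x = (0, fa u, fb u) := by
  obtain ⟨h1, h2, h3⟩ := mem_phaseSpace_iff.1 hu
  simp only [sqA, sqB, dotAB] at h1 h2 h3
  obtain ⟨φ, hφ0, hφ1⟩ := exists_polar (Real.sqrt_nonneg (fa u 0 ^ 2 + fa u 1 ^ 2))
    (Real.sq_sqrt (by positivity : 0 ≤ fa u 0 ^ 2 + fa u 1 ^ 2)).symm
  obtain ⟨θ, hθ0, hθ1⟩ := exists_polar (x := fa u 2) (y := √(fa u 0 ^ 2 + fa u 1 ^ 2)) ha.le (by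
    rw [Real.sq_sqrt (by positivity), ← h1]; ring)
  rw [hθ1] at hφ0 hφ1
  have cθ := Real.sin_sq_add_cos_sq θ
  have cφ := Real.sin_sq_add_cos_sq φ
  have hdot : Real.sin θ * Real.cos φ * fb u 0 + Real.sin θ * Real.sin φ * fb u 1
      + Real.cos θ * fb u 2 = 0 := by
    have : a * (Real.sin θ * Real.cos φ * fb u 0 + Real.sin θ * Real.sin φ * fb u 1
      + Real.cos θ * fb u 2) = 0 := by
      rw [hφ0, hφ1, hθ0] at h3
      linear_combination h3
    exact (mul_eq_zero.1 this).resolve_left ha.ne'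
  obtain ⟨ψ, hψ0, hψ1⟩ := exists_polar
    (x := Real.cos θ * Real.cos φ * fb u 0 + Real.cos θ * Real.sin φ * fb u 1
      - Real.sin θ * fb u 2)
    (y := -Real.sin φ * fb u 0 + Real.cos φ * fb u 1) hb.le (by
      generalize Real.sin θ = s at *
      generalize Real.cos θ = c at *
      generalize Real.sin φ = s₁ at *
      generalize Real.cos φ = c₁ at *
      rw [← h2]
      linear_combination (-(s * c₁ * fb u 0 + s * s₁ * fb u 1 + c * fb u 2)) * hdot
        + ((c₁ * fb u 0 + s₁ * fb u 1) ^ 2 + fb u 2 ^ 2) * cθ + (fb u 0 ^ 2 + fb u 1 ^ 2) * cφ)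
  refine ⟨(θ, φ, ψ), Prod.ext rfl (Prod.ext ?_ ?_)⟩
  · ext i
    fin_cases i
    · simp [frameParam]; linear_combination -hφ0
    · simp [frameParam]; linear_combination -hφ1
    · simp [frameParam]; linear_combination -hθ0
  · ext i
    fin_cases i <;> simp [frameParam] <;> generalize Real.sin θ = s at * <;>
      generalize Real.cos θ = c at * <;> generalize Real.sin φ = s₁ at * <;>
      generalize Real.cos φ = c₁ at *
    · linear_combination -c * c₁ * hψ0 + s₁ * hψ1 - s * c₁ * hdot
        + c₁ * (c₁ * fb u 0 + s₁ * fb u 1) * cθ + fb u 0 * cφ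
    · linear_combination -c * s₁ * hψ0 - c₁ * hψ1 - s * s₁ * hdot
        + s₁ * (c₁ * fb u 0 + s₁ * fb u 1) * cθ + fb u 1 * cφ
    · linear_combination s * hψ0 - c * hdot + fb u 2 * cθ

/-- Sets on which the momentum is a smooth function of the fields. -/
theorem dimH_le_three_of_graph {a b : ℝ} (ha : 0 < a) (hb : 0 < b) {Z : Set Phase}
    (hZ : Z ⊆ phaseSpace a b) {m : Phase → Fin 3 → ℝ}
    (h : ∀ u ∈ Z, ContDiffAt ℝ 1 m (0, fa u, fb u) ∧ m (0, fa u, fb u) = mom u) :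
    dimH Z ≤ 3 := by
  refine dimH_le_three (f := fun x => (m (frameParam a b x), (frameParam a b x).2)) fun u hu => ?_
  obtain ⟨x, hx⟩ := exists_frameParam ha hb (hZ hu)
  obtain ⟨h1, h2⟩ := h u hu
  rw [← hx] at h1
  refine ⟨x, ContDiffAt.prodMk (h1.comp x (contDiff_frameParam a b).contDiffAt)
    (contDiff_snd.comp (contDiff_frameParam a b)).contDiffAt, ?_⟩
  rw [hx, h2]

/-! ### Three-parameter covers of the exceptional families -/

section Exceptional

variable {ε₀ ε₁ lam a b : ℝ}

theorem dimH_mom_eq_zero (ha : 0 < a) (hb : 0 < b) :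
    dimH {u | u ∈ phaseSpace a b ∧ mom u = 0} ≤ 3 :=
  dimH_le_three_of_graph ha hb (fun _ hu => hu.1) (m := fun _ => 0)
    fun _ hu => ⟨contDiffAt_const, hu.2.symm⟩

theorem dimH_redMom_eq_zero (ha : 0 < a) (hb : 0 < b) :
    dimH {u | u ∈ phaseSpace a b ∧ mom u 0 = 0 ∧ mom u 1 = 0 ∧ redMom ε₁ lam u = 0} ≤ 3 := by
  refine dimH_le_three_of_graph ha hb (fun _ hu => hu.1)
    (m := fun u => ![0, 0, 2 * (lam + ε₁ * (fa u 1 - fb u 0))]) fun u hu => ⟨?_, ?_⟩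
  · refine contDiffAt_pi.2 fun i => ?_
    fin_cases i <;> simp [fa, fb] <;> fun_prop
  · obtain ⟨-, h0, h1, hD⟩ := hu
    ext i
    fin_cases i
    · exact h0.symm
    · exact h1.symm
    · simp [redMom] at hD ⊢; linear_combination -2 * hD

/-- The fold condition gives D and the trace condition gives S as functions of the fields; then M is
ε₀ (α + S e₁) × (β + S e₂) / (S D). -/
theorem dimH_fold (ha : 0 < a) (hb : 0 < b) :
    dimH {u | u ∈ phaseSpace a b ∧ ∃ S, Rel ε₀ ε₁ lam S u ∧ ε₀ ≠ 0 ∧ redMom ε₁ lam u ≠ 0 ∧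
      mom u 2 = -2 * redMom ε₁ lam u ∧
      ε₀ * (fa u 0 + fb u 1 + 2 * S) = -2 * redMom ε₁ lam u ^ 2} ≤ 3 := by
  set D : Phase → ℝ := fun u => -(coupling ε₁ lam u / 2) with hDdef
  set s : Phase → ℝ := fun u => (-2 * D u ^ 2 / ε₀ - (fa u 0 + fb u 1)) / 2 with hsdef
  have hDc : ContDiff ℝ 1 D := by simp only [hDdef]; unfold coupling fa fb; fun_prop
  have hsc : ContDiff ℝ 1 s := by simp only [hsdef]; unfold fa fb; fun_prop
  refine dimH_le_three_of_graph ha hb (fun _ hu => hu.1)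
    (m := fun u => ![ε₀ * crossX (s u) u / (s u * D u), ε₀ * crossY (s u) u / (s u * D u),
      ε₀ * crossZ (s u) u / (s u * D u)]) fun u hu => ?_
  obtain ⟨hp, S, hR, hε, hD, hM, hY⟩ := hu
  have hS := hR.S_ne_zero hp ha.ne' hb.ne' hε
  have eD : D (0, fa u, fb u) = redMom ε₁ lam u := by
    simp only [hDdef, coupling, redMom] at *
    simp only [fa_mk, fb_mk]
    linear_combination -hM / 4
  have eS : s (0, fa u, fb u) = S := by
    simp only [hsdef, eD]
    simp only [fa_mk, fb_mk]
    field_simp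
    linear_combination -hY
  have hne : s (0, fa u, fb u) * D (0, fa u, fb u) ≠ 0 := by
    rw [eS, eD]; exact mul_ne_zero hS hD
  constructor
  · refine contDiffAt_pi.2 fun i => ?_
    fin_cases i
    · refine ContDiffAt.div ?_ (hsc.mul hDc).contDiffAt hne
      unfold crossX fa fb; fun_prop
    · refine ContDiffAt.div ?_ (hsc.mul hDc).contDiffAt hne
      unfold crossY fa fb; fun_prop
    · refine ContDiffAt.div ?_ (hsc.mul hDc).contDiffAt hne
      unfold crossZ fa fb; fun_prop
  · have hx := hR.x
    have hy := hR.y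
    have hz := hR.z
    simp only [relX, relY, relZ] at hx hy hz
    rw [eS, eD] at *
    ext i
    fin_cases i
    · change ε₀ * crossX S u / _ = mom u 0
      rw [div_eq_iff hne]; linear_combination hx
    · change ε₀ * crossY S u / _ = mom u 1
      rw [div_eq_iff hne]; linear_combination hy
    · change ε₀ * crossZ S u / _ = mom u 2
      rw [div_eq_iff hne]; linear_combination hz

theorem dimH_axis : dimH {u : Phase | ∃ S, mom u 0 = 0 ∧ mom u 2 = 0 ∧
      fa u 0 = -S ∧ fa u 1 = 0 ∧ fb u 0 = 0 ∧ fb u 1 = -S ∧ fb u 2 = 0} ≤ 3 := by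
  refine dimH_le_three (f := fun x => (![0, x.1, 0], ![-x.2.1, 0, x.2.2], ![0, -x.2.1, 0]))
    fun u hu => ?_
  obtain ⟨S, m0, m2, a0, a1, b0, b1, b2⟩ := hu
  refine ⟨(mom u 1, S, fa u 2), ContDiff.contDiffAt ?_, ?_⟩
  · refine ContDiff.prodMk ?_ (ContDiff.prodMk ?_ ?_) <;>
      refine contDiff_pi.2 fun i => ?_ <;> fin_cases i <;> simp <;> fun_prop
  · refine Prod.ext ?_ (Prod.ext ?_ ?_) <;> ext i <;> fin_cases i <;> simp [*]

/-- Both fields are horizontal and orthogonal, so β is α turned by a right angle and scaled by ±b/a.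
The parameters are M₃, α₁, α₂. -/
theorem dimH_vertical (ha : a ≠ 0) :
    dimH {u | u ∈ phaseSpace a b ∧ mom u 0 = 0 ∧ mom u 1 = 0 ∧ fa u 2 = 0 ∧ fb u 2 = 0} ≤ 3 := by
  have piece : ∀ k : ℝ, dimH {u | u ∈ phaseSpace a b ∧ mom u 0 = 0 ∧ mom u 1 = 0 ∧ fa u 2 = 0 ∧
      fb u 2 = 0 ∧ fb u 0 = -k * fa u 1 ∧ fb u 1 = k * fa u 0} ≤ 3 := fun k => by
    refine dimH_le_three (f := fun x =>
      (![0, 0, x.1], ![x.2.1, x.2.2, 0], ![-k * x.2.2, k * x.2.1, 0])) fun u hu => ?_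
    obtain ⟨-, m0, m1, a2, b2, b0, b1⟩ := hu
    refine ⟨(mom u 2, fa u 0, fa u 1), ContDiff.contDiffAt ?_, ?_⟩
    · refine ContDiff.prodMk ?_ (ContDiff.prodMk ?_ ?_) <;>
        refine contDiff_pi.2 fun i => ?_ <;> fin_cases i <;> simp <;> fun_prop
    · refine Prod.ext ?_ (Prod.ext ?_ ?_) <;> ext i <;> fin_cases i <;> simp [*]
  refine (dimH_mono (t := _ ∪ _) fun u hu => ?_).trans
    ((dimH_union _ _).trans_le (max_le (piece (b / a)) (piece (-(b / a)))))
  obtain ⟨hp, m0, m1, a2, b2⟩ := hu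
  obtain ⟨h1, h2, h3⟩ := mem_phaseSpace_iff.1 hp
  simp only [sqA, sqB, dotAB, a2, b2] at h1 h2 h3
  set k := (fa u 0 * fb u 1 - fa u 1 * fb u 0) / a ^ 2 with hk
  have e0 : fb u 0 = -k * fa u 1 := by
    rw [hk]; field_simp; linear_combination -fb u 0 * h1 + fa u 0 * h3
  have e1 : fb u 1 = k * fa u 0 := by
    rw [hk]; field_simp; linear_combination -fb u 1 * h1 + fa u 1 * h3
  have hk2 : (k - b / a) * (k + b / a) = 0 := by
    have : k ^ 2 * a ^ 2 = b ^ 2 := by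
      rw [e0, e1] at h2; linear_combination h2 - k ^ 2 * h1
    have : k ^ 2 = b ^ 2 / a ^ 2 := by rw [← this]; field_simp
    rw [← div_pow] at this
    linear_combination this
  rcases mul_eq_zero.1 hk2 with h | h
  · left
    rw [sub_eq_zero.1 h] at e0 e1
    exact ⟨hp, m0, m1, a2, b2, e0, e1⟩
  · right
    rw [eq_neg_of_add_eq_zero_left h] at e0 e1
    exact ⟨hp, m0, m1, a2, b2, e0, e1⟩

/-- The fields lie in the vertical plane orthogonal to M. The parameters are M₁, M₂ and the angle of
α in that plane; the sign k = ±b records the orientation. -/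
theorem dimH_horizontal (ha : 0 < a) :
    dimH {u | u ∈ phaseSpace a b ∧ planarSq u ≠ 0 ∧ mom u 2 = 0 ∧ relA 0 u = 0 ∧
      relB 0 u = 0} ≤ 3 := by
  set w : ℝ × ℝ × ℝ → ℝ := fun x => √(x.1 ^ 2 + x.2.1 ^ 2) with hw
  set f : ℝ → ℝ × ℝ × ℝ → Phase := fun k x =>
    (![x.1, x.2.1, 0],
      ![a * Real.sin x.2.2 * (-x.2.1 / w x), a * Real.sin x.2.2 * (x.1 / w x),
        a * Real.cos x.2.2],
      ![k * Real.cos x.2.2 * (-x.2.1 / w x), k * Real.cos x.2.2 * (x.1 / w x),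
        -(k * Real.sin x.2.2)]) with hf
  have hfc : ∀ k x, x.1 ^ 2 + x.2.1 ^ 2 ≠ 0 → ContDiffAt ℝ 1 (f k) x := fun k x hx => by
    have hwc : ContDiffAt ℝ 1 w x := ContDiffAt.sqrt (by fun_prop) hx
    have hw0 : w x ≠ 0 := (Real.sqrt_pos.2 (lt_of_le_of_ne (by positivity) hx.symm)).ne'
    have d1 : ContDiffAt ℝ 1 (fun x => -x.2.1 / w x) x := ContDiffAt.div (by fun_prop) hwc hw0
    have d2 : ContDiffAt ℝ 1 (fun x => x.1 / w x) x := ContDiffAt.div (by fun_prop) hwc hw0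
    refine ContDiffAt.prodMk ?_ (ContDiffAt.prodMk ?_ ?_) <;>
      refine contDiffAt_pi.2 fun i => ?_ <;> fin_cases i <;> simp <;> fun_prop
  have piece : ∀ k : ℝ, dimH {u | ∃ x, x.1 ^ 2 + x.2.1 ^ 2 ≠ 0 ∧ f k x = u} ≤ 3 := fun k =>
    dimH_le_three fun u ⟨x, hx, hu⟩ => ⟨x, hfc k x hx, hu⟩
  refine (dimH_mono (t := _ ∪ _) fun u hu => ?_).trans
    ((dimH_union _ _).trans_le (max_le (piece b) (piece (-b))))
  obtain ⟨hp, hW, hM, hA, hB⟩ := hu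
  obtain ⟨h1, h2, h3⟩ := mem_phaseSpace_iff.1 hp
  simp only [sqA, sqB, dotAB, relA, relB, hM] at h1 h2 h3 hA hB
  simp only [planarSq] at hW
  obtain ⟨v, hv⟩ : ∃ v, v = √(mom u 0 ^ 2 + mom u 1 ^ 2) := ⟨_, rfl⟩
  have hv0 : v ≠ 0 := by
    rw [hv]; exact (Real.sqrt_pos.2 (lt_of_le_of_ne (by positivity) hW.symm)).ne'
  have hv2 : mom u 0 ^ 2 + mom u 1 ^ 2 = v ^ 2 := by rw [hv, Real.sq_sqrt (by positivity)]
  obtain ⟨p, hp'⟩ : ∃ p, p = -mom u 1 / v := ⟨_, rfl⟩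
  obtain ⟨q, hq'⟩ : ∃ q, q = mom u 0 / v := ⟨_, rfl⟩
  have hpq : p ^ 2 + q ^ 2 = 1 := by rw [hp', hq']; field_simp; linear_combination hv2
  have eA : q * fa u 0 = p * fa u 1 := by
    rw [hp', hq']; field_simp; linear_combination hA
  have eB : q * fb u 0 = p * fb u 1 := by
    rw [hp', hq']; field_simp; linear_combination hB
  obtain ⟨t, ht⟩ : ∃ t, t = p * fa u 0 + q * fa u 1 := ⟨_, rfl⟩
  obtain ⟨r, hr⟩ : ∃ r, r = p * fb u 0 + q * fb u 1 := ⟨_, rfl⟩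
  have a0 : fa u 0 = t * p := by rw [ht]; linear_combination -fa u 0 * hpq + q * eA
  have a1 : fa u 1 = t * q := by rw [ht]; linear_combination -fa u 1 * hpq - p * eA
  have b0 : fb u 0 = r * p := by rw [hr]; linear_combination -fb u 0 * hpq + q * eB
  have b1 : fb u 1 = r * q := by rw [hr]; linear_combination -fb u 1 * hpq - p * eB
  obtain ⟨θ, hθ0, hθ1⟩ := exists_polar (x := fa u 2) (y := t) ha.le (by
    rw [a0, a1] at h1; linear_combination h1 - t ^ 2 * hpq)
  have cθ := Real.sin_sq_add_cos_sq θ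
  obtain ⟨k, hk⟩ : ∃ k, k = r * Real.cos θ - fb u 2 * Real.sin θ := ⟨_, rfl⟩
  have hort : r * Real.sin θ + fb u 2 * Real.cos θ = 0 := by
    have : a * (r * Real.sin θ + fb u 2 * Real.cos θ) = 0 := by
      rw [a0, a1, b0, b1, hθ0, hθ1] at h3
      linear_combination h3 - a * Real.sin θ * r * hpq
    exact (mul_eq_zero.1 this).resolve_left ha.ne'
  have er : r = k * Real.cos θ := by
    rw [hk]; linear_combination -r * cθ + Real.sin θ * hort
  have eb2 : fb u 2 = -(k * Real.sin θ) := by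
    rw [hk]; linear_combination -fb u 2 * cθ + Real.cos θ * hort
  have hk2 : (k - b) * (k + b) = 0 := by
    rw [b0, b1, eb2, er] at h2
    linear_combination h2 - k ^ 2 * Real.cos θ ^ 2 * hpq - k ^ 2 * cθ
  have hpt : f k (mom u 0, mom u 1, θ) = u := by
    have hwx : w (mom u 0, mom u 1, θ) = v := by rw [hv]
    simp only [hf, hwx]
    refine Prod.ext ?_ (Prod.ext ?_ ?_) <;> ext i <;> fin_cases i
    · rfl
    · rfl
    · exact hM.symm
    · change a * Real.sin θ * (-mom u 1 / v) = fa u 0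
      rw [← hp', a0, hθ1]
    · change a * Real.sin θ * (mom u 0 / v) = fa u 1
      rw [← hq', a1, hθ1]
    · exact hθ0.symm
    · change k * Real.cos θ * (-mom u 1 / v) = fb u 0
      rw [← hp', b0, er]
    · change k * Real.cos θ * (mom u 0 / v) = fb u 1
      rw [← hq', b1, er]
    · exact eb2.symm
  rcases mul_eq_zero.1 hk2 with h | h
  · left
    rw [sub_eq_zero.1 h] at hpt
    exact ⟨_, hW, hpt⟩
  · right
    rw [eq_neg_of_add_eq_zero_left h] at hpt
    exact ⟨_, hW, hpt⟩

/-- D = 0 fixes M₃ by the fields, and M is parallel to N = α × β. So M is a function of the fields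
when N₃ ≠ 0; otherwise M₃ = 0 and `dimH_horizontal` applies. -/
theorem dimH_orthogonal (ha : 0 < a) (hb : 0 < b) :
    dimH {u | u ∈ phaseSpace a b ∧ planarSq u ≠ 0 ∧ relA 0 u = 0 ∧ relB 0 u = 0 ∧
      redMom ε₁ lam u = 0} ≤ 3 := by
  have piece : dimH {u | u ∈ phaseSpace a b ∧ crossZ 0 u ≠ 0 ∧ relA 0 u = 0 ∧ relB 0 u = 0 ∧
      redMom ε₁ lam u = 0} ≤ 3 := by
    refine dimH_le_three_of_graph ha hb (fun _ hu => hu.1)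
      (m := fun u => ![2 * coupling ε₁ lam u * crossX 0 u / crossZ 0 u,
        2 * coupling ε₁ lam u * crossY 0 u / crossZ 0 u, 2 * coupling ε₁ lam u]) fun u hu => ?_
    obtain ⟨hp, hN, hA, hB, hD⟩ := hu
    obtain ⟨c1, c2, c3⟩ := cross_parallel 0 u
    rw [hA, hB] at c1 c2 c3
    have hM : mom u 2 = 2 * coupling ε₁ lam u := by
      simp only [redMom, coupling] at *; linear_combination 2 * hD
    have hcc : ContDiff ℝ 1 (coupling ε₁ lam) := by unfold coupling fa fb; fun_prop
    have hzc : ContDiff ℝ 1 (crossZ 0) := by unfold crossZ fa fb; fun_prop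
    have hxc : ContDiff ℝ 1 (crossX 0) := by unfold crossX fa fb; fun_prop
    have hyc : ContDiff ℝ 1 (crossY 0) := by unfold crossY fa fb; fun_prop
    constructor
    · refine contDiffAt_pi.2 fun i => ?_
      fin_cases i
      · exact ContDiffAt.div ((contDiff_const.mul hcc).mul hxc).contDiffAt hzc.contDiffAt hN
      · exact ContDiffAt.div ((contDiff_const.mul hcc).mul hyc).contDiffAt hzc.contDiffAt hN
      · exact (contDiff_const.mul hcc).contDiffAt
    · ext i
      fin_cases i
      · change 2 * coupling ε₁ lam u * crossX 0 u / crossZ 0 u = mom u 0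
        rw [div_eq_iff hN, ← hM]; linear_combination c3
      · change 2 * coupling ε₁ lam u * crossY 0 u / crossZ 0 u = mom u 1
        rw [div_eq_iff hN, ← hM]; linear_combination -c2
      · exact hM.symm
  refine (dimH_mono (t := _ ∪ _) fun u hu => ?_).trans
    ((dimH_union _ _).trans_le (max_le piece (dimH_horizontal (a := a) (b := b) ha)))
  obtain ⟨hp, hW, hA, hB, hD⟩ := hu
  by_cases hN : crossZ 0 u = 0
  · right
    refine ⟨hp, hW, ?_, hA, hB⟩
    obtain ⟨c1, c2, c3⟩ := cross_parallel 0 u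
    rw [hA, hB] at c1 c2 c3
    rw [hN] at c2 c3
    by_contra hM
    have hx : crossX 0 u = 0 := by
      have : mom u 2 * crossX 0 u = 0 := by linear_combination c3
      exact (mul_eq_zero.1 this).resolve_left hM
    have hy : crossY 0 u = 0 := by
      have : mom u 2 * crossY 0 u = 0 := by linear_combination -c2
      exact (mul_eq_zero.1 this).resolve_left hM
    have hc := cross_sq u
    obtain ⟨h1, h2, h3⟩ := mem_phaseSpace_iff.1 hp
    rw [hx, hy, hN, h1, h2, h3] at hc
    have : 0 < a ^ 2 * b ^ 2 := by positivity
    linarith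
  · left
    exact ⟨hp, hN, hA, hB, hD⟩

/-- The points of the closure with `w₁ w₂ = 0`. -/
theorem vertical_of_mem_setM₃ {u : Phase} (hu : u ∈ setM₃ ε₀ ε₁ lam a b) (hW : planarSq u = 0) :
    mom u = 0 ∨ (fa u 2 = 0 ∧ fb u 2 = 0) ∨ redMom ε₁ lam u = 0 := by
  obtain ⟨m0, m1⟩ := (planarSq_eq_zero_iff u).1 hW
  have concl : mom u 2 * fa u 2 = 0 → mom u 2 * fb u 2 = 0 →
      mom u = 0 ∨ (fa u 2 = 0 ∧ fb u 2 = 0) ∨ redMom ε₁ lam u = 0 := fun h1 h2 => by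
    by_cases hM : mom u 2 = 0
    · left
      ext i
      fin_cases i
      · exact m0
      · exact m1
      · exact hM
    · exact Or.inr (Or.inl ⟨(mul_eq_zero.1 h1).resolve_left hM, (mul_eq_zero.1 h2).resolve_left hM⟩)
  by_cases hε : ε₀ = 0
  · subst hε
    -- For ε₀ = 0 the relations give S D = 0, so each point has D = 0 or S = 0; this alternative is
    -- closed.
    have hc : IsClosed {u : Phase | redMom ε₁ lam u = 0 ∨ (relA 0 u = 0 ∧ relB 0 u = 0)} := by
      have h1 : Continuous (redMom ε₁ lam) := by unfold redMom mom fa fb; fun_prop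
      exact (isClosed_eq h1 continuous_const).union
        ((isClosed_eq (contDiff_relA 0).continuous continuous_const).inter
          (isClosed_eq (contDiff_relB 0).continuous continuous_const))
    have hmem : u ∈ {u : Phase | redMom ε₁ lam u = 0 ∨ (relA 0 u = 0 ∧ relB 0 u = 0)} := by
      refine closure_minimal (fun v hv => ?_) hc hu
      obtain ⟨-, hWv, S, hS⟩ := mem_relationSet_iff.1 hv
      by_cases h0 : S = 0
      · subst h0; exact Or.inr ⟨hS.a, hS.b⟩
      · left
        have h1 := hS.x
        have h2 := hS.y
        simp only [relX, relY] at h1 h2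
        have : S * redMom ε₁ lam v * planarSq v = 0 := by
          simp only [planarSq]; linear_combination -mom v 0 * h1 - mom v 1 * h2
        simpa [h0, hWv] using this
    rcases hmem with h | ⟨h1, h2⟩
    · exact Or.inr (Or.inr h)
    · simp only [relA, relB, m0, m1] at h1 h2
      exact concl (by linear_combination h1) (by linear_combination h2)
  -- For ε₀ ≠ 0 the third component of the vector relation is a monic quadratic equation for S. C
  -- bounds its roots continuously, so |M·α| ≤ C |M₁| and |M·β| ≤ C |M₂| pass to the limit.
  · set C : Phase → ℝ := fun u => 1 + |redMom ε₁ lam u * mom u 2 / ε₀ - (fa u 0 + fb u 1)|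
      + |crossZ 0 u| with hC
    have hCc : Continuous C := by
      simp only [hC]; unfold redMom crossZ mom fa fb; fun_prop
    have hc : IsClosed {u : Phase | |relA 0 u| ≤ C u * |mom u 0| ∧ |relB 0 u| ≤ C u * |mom u 1|} :=
      (isClosed_le (contDiff_relA 0).continuous.abs (hCc.mul (by unfold mom; fun_prop))).inter
        (isClosed_le (contDiff_relB 0).continuous.abs (hCc.mul (by unfold mom; fun_prop)))
    have hmem : u ∈ {u : Phase | |relA 0 u| ≤ C u * |mom u 0| ∧ |relB 0 u| ≤ C u * |mom u 1|} := by
      refine closure_minimal (fun v hv => ?_) hc hu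
      obtain ⟨-, hWv, S, hS⟩ := mem_relationSet_iff.1 hv
      have hSC : |S| ≤ C v := by
        have hz := hS.z
        simp only [relZ] at hz
        have e : S ^ 2 = S * (redMom ε₁ lam v * mom v 2 / ε₀ - (fa v 0 + fb v 1)) - crossZ 0 v := by
          simp only [crossZ] at *
          field_simp
          linear_combination hz
        simp only [hC]
        generalize redMom ε₁ lam v * mom v 2 / ε₀ - (fa v 0 + fb v 1) = X at *
        generalize crossZ 0 v = N at *
        by_contra! hlt
        have h1 : |S| ^ 2 ≤ |S| * |X| + |N| := by
          rw [sq_abs, e, ← abs_mul]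
          linarith [le_abs_self (S * X), neg_abs_le N]
        nlinarith [abs_nonneg S, abs_nonneg X, abs_nonneg N]
      have hA := hS.a
      have hB := hS.b
      have eA : relA 0 v = -S * mom v 0 := by simp only [relA] at *; linear_combination hA
      have eB : relB 0 v = -S * mom v 1 := by simp only [relB] at *; linear_combination hB
      constructor
      · rw [eA, abs_mul, abs_neg]; gcongr
      · rw [eB, abs_mul, abs_neg]; gcongr
    obtain ⟨h1, h2⟩ := hmem
    rw [m0, abs_zero, mul_zero] at h1
    rw [m1, abs_zero, mul_zero] at h2
    have e1 := abs_nonpos_iff.1 h1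
    have e2 := abs_nonpos_iff.1 h2
    simp only [relA, relB, m0, m1] at e1 e2
    exact concl (by linear_combination e1) (by linear_combination e2)

/-- The points that are not smooth form a set of dimension at most three. -/
theorem dimH_not_isSmoothPoint (hb : 0 < b) (hab : b < a) :
    dimH {u | u ∈ setM₃ ε₀ ε₁ lam a b ∧ ¬ IsSmoothPoint (setM₃ ε₀ ε₁ lam a b) 4 u} ≤ 3 := by
  have ha := hb.trans hab
  refine (dimH_mono (t := _ ∪ (_ ∪ (_ ∪ (_ ∪ (_ ∪ _))))) ?_).trans
    ((dimH_union _ _).trans_le (max_le (dimH_mom_eq_zero ha hb)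
    ((dimH_union _ _).trans_le (max_le (dimH_vertical (a := a) (b := b) ha.ne')
    ((dimH_union _ _).trans_le (max_le (dimH_redMom_eq_zero (ε₁ := ε₁) (lam := lam) ha hb)
    ((dimH_union _ _).trans_le (max_le (dimH_fold (ε₀ := ε₀) (ε₁ := ε₁) (lam := lam) ha hb)
    ((dimH_union _ _).trans_le (max_le dimH_axis
    (dimH_orthogonal (ε₁ := ε₁) (lam := lam) ha hb)))))))))))
  rintro u ⟨hu, hns⟩
  have hp := setM₃_subset_phaseSpace _ _ _ _ _ hu
  by_cases hW : planarSq u = 0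
  · obtain ⟨m0, m1⟩ := (planarSq_eq_zero_iff u).1 hW
    rcases vertical_of_mem_setM₃ hu hW with h | ⟨h1, h2⟩ | h
    · exact Or.inl ⟨hp, h⟩
    · exact Or.inr (Or.inl ⟨hp, m0, m1, h1, h2⟩)
    · exact Or.inr (Or.inr (Or.inl ⟨hp, m0, m1, h⟩))
  · have hr := mem_relationSet_of_mem_setM₃ hu hW
    obtain ⟨-, -, S, hS⟩ := mem_relationSet_iff.1 hr
    rcases isSmoothPoint_or hb hab hr hS with h | ⟨h0, h1, h2, h3⟩ | ⟨h0, h1, h2, h3⟩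
      | ⟨rfl, rfl, hD⟩
    · exact absurd h hns
    · exact Or.inr (Or.inr (Or.inr (Or.inl ⟨hp, S, hS, h0, h1, h2, h3⟩)))
    · exact Or.inr (Or.inr (Or.inr (Or.inr (Or.inl ⟨S, h2, h3⟩))))
    · exact Or.inr (Or.inr (Or.inr (Or.inr (Or.inr ⟨hp, hW, hS.a, hS.b, hD⟩))))

theorem hausdorffMeasure_not_isSmoothPoint (hb : 0 < b) (hab : b < a) :
    MeasureTheory.Measure.hausdorffMeasure 4
      {u | u ∈ setM₃ ε₀ ε₁ lam a b ∧ ¬ IsSmoothPoint (setM₃ ε₀ ε₁ lam a b) 4 u} = 0 := by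
  have h : dimH {u | u ∈ setM₃ ε₀ ε₁ lam a b ∧ ¬ IsSmoothPoint (setM₃ ε₀ ε₁ lam a b) 4 u}
      < ((4 : NNReal) : ENNReal) :=
    (dimH_not_isSmoothPoint hb hab).trans_lt (by norm_num)
  simpa using hausdorffMeasure_of_dimH_lt h

end Exceptional


/-! ### Existence of points -/

theorem relationSet_nonempty {ε₀ a b : ℝ} (ε₁ lam : ℝ) (hε : 0 ≤ ε₀) (ha : a ≠ 0) (hb : b ≠ 0) :
    (relationSet ε₀ ε₁ lam a b).Nonempty := by
  rcases hε.eq_or_lt with rfl | hpos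
  -- For ε₀ = 0 any M along α × β works, with S = 0.
  · refine ⟨(![a * b, 0, 0], ![0, a, 0], ![0, 0, b]),
      mem_relationSet_iff.2 ⟨mem_phaseSpace_iff.2 ?_, ?_, 0, rel_zero_of_orthogonal ?_ ?_⟩⟩
    · simp [sqA, sqB, dotAB]
    · simp [planarSq, ha, hb]
    · simp [relA]
    · simp [relB]
  -- For S = 1, α = a e₂, β = b e₃ the shifted fields have product (ab, -b, 1). Taking M = μ (ab,
  -- -b, 1) leaves ε₀ = μ (μ/2 - c), solvable because ε₀ > 0.
  · obtain ⟨c, hc⟩ : ∃ c, c = lam + ε₁ * a := ⟨_, rfl⟩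
    obtain ⟨μ, hμ⟩ : ∃ μ, μ = c + √(c ^ 2 + 2 * ε₀) := ⟨_, rfl⟩
    have hμ2 : μ ^ 2 = 2 * c * μ + 2 * ε₀ := by
      have := Real.sq_sqrt (by positivity : 0 ≤ c ^ 2 + 2 * ε₀)
      rw [hμ]; linear_combination this
    have hμ0 : μ ≠ 0 := by
      rintro rfl
      linarith
    set u : Phase := (![μ * (a * b), -(μ * b), μ], ![0, a, 0], ![0, 0, b]) with hu
    have m0 : mom u 0 = μ * (a * b) := rfl
    have m1 : mom u 1 = -(μ * b) := rfl
    have m2 : mom u 2 = μ := rfl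
    have a0 : fa u 0 = 0 := rfl
    have a1 : fa u 1 = a := rfl
    have a2 : fa u 2 = 0 := rfl
    have b0 : fb u 0 = 0 := rfl
    have b1 : fb u 1 = 0 := rfl
    have b2 : fb u 2 = b := rfl
    refine ⟨u, mem_relationSet_iff.2 ⟨mem_phaseSpace_iff.2 ?_, ?_, 1, ?_, ?_, ?_, ?_, ?_⟩⟩
    · simp only [sqA, sqB, dotAB, a0, a1, a2, b0, b1, b2]
      exact ⟨by ring, by ring, by ring⟩
    · simp only [planarSq, m0, m1]
      have : 0 < (μ * b) ^ 2 := by positivity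
      nlinarith [sq_nonneg (μ * (a * b))]
    · simp only [relA, m0, m1, m2, a0, a1, a2]; ring
    · simp only [relB, m0, m1, m2, b0, b1, b2]; ring
    · simp only [relX, crossX, redMom, m0, m2, a1, a2, b0, b1, b2]
      linear_combination -(a * b) * hμ2 / 2 - a * b * μ * hc
    · simp only [relY, crossY, redMom, m1, m2, a0, a1, a2, b0, b2]
      linear_combination b * hμ2 / 2 + b * μ * hc
    · simp only [relZ, crossZ, redMom, m2, a0, a1, b0, b1]
      linear_combination -hμ2 / 2 - μ * hc

/-- The integrals in terms of `S` and `T`. -/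
theorem integrals_eq_complex {ε₀ ε₁ lam a b p r : ℝ} (hp : p ^ 2 = a ^ 2 + b ^ 2)
    (hr : r ^ 2 = a ^ 2 - b ^ 2) {u : Phase} (hu : u ∈ setM₃ ε₀ ε₁ lam a b)
    (hw : w₁ u * w₂ u ≠ 0) (h0 : intS u ≠ 0) (hd : denT ε₀ ε₁ u ≠ 0) :
    (hamH ε₀ ε₁ lam u : ℂ) =
        ε₀ * intS u + ε₀ / (2 * intS u) * ((p : ℂ) ^ 2 - intT ε₀ ε₁ u)
          - (ε₁ : ℂ) ^ 2 * intT ε₀ ε₁ u + (lam : ℂ) ^ 2 / 2 ∧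
      (intK ε₀ ε₁ lam u : ℂ) =
        ((ε₀ : ℂ) + 2 * (ε₁ : ℂ) ^ 2 * intS u) ^ 2 *
          ((r : ℂ) ^ 4 + intT ε₀ ε₁ u *
            (intT ε₀ ε₁ u + 4 * intS u ^ 2 - 2 * (p : ℂ) ^ 2)) / (4 * intS u ^ 2) ∧
      (intG ε₀ ε₁ lam u : ℂ) =
        ε₀ * ((p : ℂ) ^ 4 - (r : ℂ) ^ 4 + 2 * (p : ℂ) ^ 2 * intS u ^ 2) / (4 * intS u)
          - 1 / 2 * intS u * ((ε₀ : ℂ) + 2 * (ε₁ : ℂ) ^ 2 * intS u)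
            * intT ε₀ ε₁ u := by
  have hW := (w₁_mul_w₂_ne_zero_iff u).1 hw
  obtain ⟨hps, -, S, hS⟩ := mem_relationSet_iff.1 (mem_relationSet_of_mem_setM₃ hu hW)
  have hSe := intS_eq_of_rel hW hS.a hS.b
  have hS0 : S ≠ 0 := by
    rintro rfl
    exact h0 (by rw [hSe]; simp)
  obtain ⟨hd', hT⟩ := intT_eq hSe hS0 hd
  obtain ⟨h1, h2, h3⟩ := integrals_eq hps hS hS0 hd' rfl hp hr
  rw [hT, hSe]
  refine ⟨?_, ?_, ?_⟩
  · rw [h1]; push_cast; ring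
  · rw [h2]; push_cast; ring
  · rw [h3]; push_cast; ring

end GTFG

end

open GTFG MeasureTheory in
theorem theorem3 (ε₀ ε₁ lam a b : ℝ) (hε₀ : 0 ≤ ε₀) (hb : 0 < b) (hab : b < a) :
    -- the closure is a non-empty invariant set of the system in the phase space
    (setM₃ ε₀ ε₁ lam a b).Nonempty ∧
    setM₃ ε₀ ε₁ lam a b ⊆ phaseSpace a b ∧
    IsInvariantSet (gyroField ε₀ ε₁ lam) (setM₃ ε₀ ε₁ lam a b) ∧
    -- it consists of critical points of the integral map
    (∀ u ∈ setM₃ ε₀ ε₁ lam a b, IsCriticalPoint ε₀ ε₁ lam u) ∧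
    -- it is almost everywhere a smooth 4-dimensional manifold
    (setM₃ ε₀ ε₁ lam a b ⊆
      closure {u | IsSmoothPoint (setM₃ ε₀ ε₁ lam a b) 4 u}) ∧
    Measure.hausdorffMeasure 4
      {u | u ∈ setM₃ ε₀ ε₁ lam a b ∧ ¬ IsSmoothPoint (setM₃ ε₀ ε₁ lam a b) 4 u} = 0 ∧
    -- `S` and `T`, where defined, are constant along the trajectories in the closure
    (∀ (I : Set ℝ) (γ : ℝ → Phase), I.OrdConnected →
      IsTrajectoryOn (gyroField ε₀ ε₁ lam) I γ →
      ∀ t₁ ∈ I, ∀ t₂ ∈ I, γ t₁ ∈ setM₃ ε₀ ε₁ lam a b →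
        w₁ (γ t₁) * w₂ (γ t₁) ≠ 0 → w₁ (γ t₂) * w₂ (γ t₂) ≠ 0 →
        intS (γ t₁) = intS (γ t₂) ∧
        (denT ε₀ ε₁ (γ t₁) ≠ 0 → intT ε₀ ε₁ (γ t₁) = intT ε₀ ε₁ (γ t₂))) ∧
    -- `S` does not vanish if `ε₀ > 0`
    (0 < ε₀ → ∀ u ∈ setM₃ ε₀ ε₁ lam a b, w₁ u * w₂ u ≠ 0 → intS u ≠ 0) ∧
    -- the general integrals in terms of `S` and `T`, with `p² = a² + b²`, `r² = a² - b²`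
    (∀ p r : ℝ, p ^ 2 = a ^ 2 + b ^ 2 → r ^ 2 = a ^ 2 - b ^ 2 →
      ∀ u ∈ setM₃ ε₀ ε₁ lam a b, w₁ u * w₂ u ≠ 0 → intS u ≠ 0 → denT ε₀ ε₁ u ≠ 0 →
        (hamH ε₀ ε₁ lam u : ℂ) =
          ε₀ * intS u + ε₀ / (2 * intS u) * ((p : ℂ) ^ 2 - intT ε₀ ε₁ u)
            - (ε₁ : ℂ) ^ 2 * intT ε₀ ε₁ u + (lam : ℂ) ^ 2 / 2 ∧
        (intK ε₀ ε₁ lam u : ℂ) =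
          ((ε₀ : ℂ) + 2 * (ε₁ : ℂ) ^ 2 * intS u) ^ 2 *
            ((r : ℂ) ^ 4 + intT ε₀ ε₁ u *
              (intT ε₀ ε₁ u + 4 * intS u ^ 2 - 2 * (p : ℂ) ^ 2)) / (4 * intS u ^ 2) ∧
        (intG ε₀ ε₁ lam u : ℂ) =
          ε₀ * ((p : ℂ) ^ 4 - (r : ℂ) ^ 4 + 2 * (p : ℂ) ^ 2 * intS u ^ 2) / (4 * intS u)
            - 1 / 2 * intS u * ((ε₀ : ℂ) + 2 * (ε₁ : ℂ) ^ 2 * intS u)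
              * intT ε₀ ε₁ u) := by
  have hb0 : b ≠ 0 := hb.ne'
  have ha0 : a ≠ 0 := (hb.trans hab).ne'
  refine ⟨(relationSet_nonempty ε₁ lam hε₀ ha0 hb0).closure, setM₃_subset_phaseSpace ε₀ ε₁ lam a b,
    isInvariantSet_setM₃ ε₀ ε₁ lam a b, fun u hu => isCriticalPoint_of_mem_setM₃ ha0 hb0 hu,
    setM₃_subset_closure hε₀ hb hab, hausdorffMeasure_not_isSmoothPoint hb hab,
    fun I γ hI h t₁ ht₁ t₂ ht₂ h1 hw1 hw2 =>
      partial_integrals_const ha0 hb0 hI h ht₁ ht₂ h1 hw1 hw2,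
    fun hpos u hu hw => intS_ne_zero ha0 hb0 hpos.ne'
      (mem_relationSet_of_mem_setM₃ hu ((w₁_mul_w₂_ne_zero_iff u).1 hw)),
    fun p r hp hr u hu hw h0 hd => integrals_eq_complex hp hr hu hw h0 hd⟩
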